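/- **Definitions.** Let $[N]=\{1,\dots,N\}$. A *strong-stuck-at code* of length $N$ consists of finite message sets $\mathcal M_1,\dots,\mathcal M_N$ of binary strings, encoders $E_i$ ($1\le i\le N$) mapping a cover vector $v\in\{0,1\}^N$, a set $F\subseteq[N]$ of frozen coordinates with $|F|=i$, and a message $m\in\mathcal M_i$ to a vector in $\{0,1\}^N$, and one decoder $D:\{0,1\}^N\to\bigcup_{i=1}^N\mathcal M_i$, which is given neither $F$ nor $|F|$, such that for all $i\in[N]$, $v$, $F$ with $|F|=i$, and $m\in\mathcal M_i$: $E_i(v,F,m)_j=v_j$ for every $j\in F$, and $D(E_i(v,F,m))=m$. Its rate at defect fraction $\rho=i/N$ is $\log_2|\mathcal M_{i}|/N$. The code is *$\varepsilon$-gapped* if its rate at $\rho$ is at least $1-\rho-\varepsilon$ for every defect fraction $\rho\in(0,1-\varepsilon)$ (with $\rho N$ an integer). Running time is measured on a deterministic random access machine with logarithmic cost (every elementary operation costs the total bit length of its operands, addresses included). **Theorem.** There are two fixed programs, an encoder and a decoder, and universal constants $a,b,c,d\in\mathbb N$ such that for every real $\varepsilon>0$ there is an $N(\varepsilon)$ such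 that for every $N>N(\varepsilon)$ there is an $\varepsilon$-gapped strong-stuck-at code of length $N$ with the following properties, where $k=\lceil 1/\varepsilon\rceil$. 1. For every $i\in[N]$ with $i<(1-\varepsilon)N$, the message set $\mathcal M_i$ is the set of all binary strings of length $N-\lfloor N/k\rfloor-i$ (which is at least $(1-\tfrac iN-\varepsilon)N$). 2. Given $k$, $N$, $v$, $F$ and $m\in\mathcal M_{|F|}$ (with $F\neq\emptyset$), the encoder program computes $E_{|F|}(v,F,m)$ deterministically in time at most $N^{a/\varepsilon}$. 3. Given $k$, $N$ and any $w\in\{0,1\}^N$, the decoder program computes $D(w)$ in time at most $b\cdot N\cdot(\log_2 N)^c\cdot(1/\varepsilon)^d$. -/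

import Mathlib

/-! ## Random access machines with logarithmic cost -/

namespace RAM

/-- The length of a natural number in binary, with `len 0 = 1`. -/
def len (n : ℕ) : ℕ := Nat.log 2 n + 1

/-- The binary operations of the machine. Subtraction is truncated, `div` and `mod` are quotient and
remainder, and the comparisons return `1` for true and `0` for false. -/
inductive Op
  | add | sub | mul | div | mod | lt | eq

/-- The value of a binary operation. -/
def Op.apply : Op → ℕ → ℕ → ℕ
  | .add, x, y => x + y
  | .sub, x, y => x - y
  | .mul, x, y => x * y
  | .div, x, y => x / y
  | .mod, x, y => x % y
  | .lt, x, y => if x < y then 1 else 0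
  | .eq, x, y => if x = y then 1 else 0

/-- A state of the machine: registers, and arrays indexed by natural numbers, all of whose cells hold
natural numbers. The names of registers and arrays are fixed in the program text, so that each program
uses finitely many registers and finitely many arrays. -/
structure State where
  /-- the registers -/
  reg : ℕ → ℕ
  /-- `mem a j` is cell `j` of array `a` -/
  mem : ℕ → ℕ → ℕ

/-- Expressions: constants, registers, array cells with a computed index, operations. -/
inductive Expr
  | const (n : ℕ)
  | reg (r : ℕ)
  | load (a : ℕ) (e : Expr)
  | op (o : Op) (e₁ e₂ : Expr)

/-- The value of an expression in a state. -/
def Expr.val (s : State) : Expr → ℕ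
  | .const n => n
  | .reg r => s.reg r
  | .load a e => s.mem a (e.val s)
  | .op o e₁ e₂ => o.apply (e₁.val s) (e₂.val s)

/-- The cost of evaluating an expression: each elementary operation costs the total length of its
operands, where for a memory access the address counts as an operand. -/
def Expr.cost (s : State) : Expr → ℕ
  | .const n => len n
  | .reg r => len (s.reg r)
  | .load a e => e.cost s + len (e.val s) + len (s.mem a (e.val s))
  | .op _ e₁ e₂ => e₁.cost s + e₂.cost s + len (e₁.val s) + len (e₂.val s)

/-- Programs. -/
inductive Prog
  | skip
  | assign (r : ℕ) (e : Expr)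
  | store (a : ℕ) (i e : Expr)
  | seq (p q : Prog)
  | branch (e : Expr) (p q : Prog)
  | loop (e : Expr) (p : Prog)

/-- Write `x` to register `r`. -/
def State.setReg (s : State) (r x : ℕ) : State :=
  { s with reg := Function.update s.reg r x }

/-- Write `x` to cell `i` of array `a`. -/
def State.setMem (s : State) (a i x : ℕ) : State :=
  { s with mem := Function.update s.mem a (Function.update (s.mem a) i x) }

/-- `Exec p s t s'`: the program `p`, started in the state `s`, halts in the state `s'` after a
computation of total cost `t`. A condition is true if its value is not `0`; `loop e p` repeats `p` as
long as `e` is true. -/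
inductive Exec : Prog → State → ℕ → State → Prop
  | skip (s : State) : Exec .skip s 1 s
  | assign (r : ℕ) (e : Expr) (s : State) :
      Exec (.assign r e) s (e.cost s + len (e.val s)) (s.setReg r (e.val s))
  | store (a : ℕ) (i e : Expr) (s : State) :
      Exec (.store a i e) s (i.cost s + e.cost s + len (i.val s) + len (e.val s))
        (s.setMem a (i.val s) (e.val s))
  | seq {p q : Prog} {s s' s'' : State} {t t' : ℕ} :
      Exec p s t s' → Exec q s' t' s'' → Exec (.seq p q) s (t + t') s''
  | branch_true {e : Expr} {p q : Prog} {s s' : State} {t : ℕ} :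
      e.val s ≠ 0 → Exec p s t s' → Exec (.branch e p q) s (e.cost s + 1 + t) s'
  | branch_false {e : Expr} {p q : Prog} {s s' : State} {t : ℕ} :
      e.val s = 0 → Exec q s t s' → Exec (.branch e p q) s (e.cost s + 1 + t) s'
  | loop_true {e : Expr} {p : Prog} {s s' s'' : State} {t t' : ℕ} :
      e.val s ≠ 0 → Exec p s t s' → Exec (.loop e p) s' t' s'' →
        Exec (.loop e p) s (e.cost s + 1 + t + t') s''
  | loop_false {e : Expr} {p : Prog} {s : State} :
      e.val s = 0 → Exec (.loop e p) s (e.cost s + 1) s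

/-- The machine is deterministic: the final state and the cost are functions of the program and the
initial state. -/
theorem Exec.deterministic {p : Prog} {s s₁ s₂ : State} {t₁ t₂ : ℕ}
    (h₁ : Exec p s t₁ s₁) (h₂ : Exec p s t₂ s₂) : t₁ = t₂ ∧ s₁ = s₂ := by
  induction h₁ generalizing t₂ s₂ with
  | skip s => cases h₂; exact ⟨rfl, rfl⟩
  | assign r e s => cases h₂; exact ⟨rfl, rfl⟩
  | store a i e s => cases h₂; exact ⟨rfl, rfl⟩
  | seq _ _ ih₁ ih₂ =>
    cases h₂ with
    | seq k₁ k₂ =>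
      obtain ⟨rfl, rfl⟩ := ih₁ k₁
      obtain ⟨rfl, rfl⟩ := ih₂ k₂
      exact ⟨rfl, rfl⟩
  | branch_true he _ ih =>
    cases h₂ with
    | branch_true _ k => obtain ⟨rfl, rfl⟩ := ih k; exact ⟨rfl, rfl⟩
    | branch_false he' _ => exact absurd he' he
  | branch_false he _ ih =>
    cases h₂ with
    | branch_true he' _ => exact absurd he he'
    | branch_false _ k => obtain ⟨rfl, rfl⟩ := ih k; exact ⟨rfl, rfl⟩
  | loop_true he _ _ ih₁ ih₂ =>
    cases h₂ with
    | loop_true _ k₁ k₂ =>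
      obtain ⟨rfl, rfl⟩ := ih₁ k₁
      obtain ⟨rfl, rfl⟩ := ih₂ k₂
      exact ⟨rfl, rfl⟩
    | loop_false he' => exact absurd he' he
  | loop_false he =>
    cases h₂ with
    | loop_true he' _ _ => exact absurd he he'
    | loop_false _ => exact ⟨rfl, rfl⟩

end RAM

/-! ## Strong-stuck-at codes -/

/-- All binary strings of length `m`. -/
def bitStrings (m : ℕ) : Finset (List Bool) :=
  (Finset.univ : Finset (Fin m → Bool)).image List.ofFn

/-- A strong-stuck-at code of length `N`. The coordinates `1, …, N` are represented by `Fin N`, and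
messages are binary strings. -/
structure StrongStuckAtCode (N : ℕ) where
  /-- the message set for exactly `i` frozen coordinates, `1 ≤ i ≤ N` -/
  messages : ℕ → Finset (List Bool)
  /-- `enc i v F m`: the encoding of the message `m` into the cover vector `v` with the set `F` of `i`
  frozen coordinates -/
  enc : ℕ → (Fin N → Bool) → Finset (Fin N) → List Bool → (Fin N → Bool)
  /-- the decoder, which sees neither `F` nor its size -/
  dec : (Fin N → Bool) → List Bool
  dec_mem : ∀ w, ∃ i ∈ Finset.Icc 1 N, dec w ∈ messages i
  consistent : ∀ i ∈ Finset.Icc 1 N, ∀ (v : Fin N → Bool) (F : Finset (Fin N)), F.card = i →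
    ∀ m ∈ messages i, ∀ j ∈ F, enc i v F m j = v j
  decodable : ∀ i ∈ Finset.Icc 1 N, ∀ (v : Fin N → Bool) (F : Finset (Fin N)), F.card = i →
    ∀ m ∈ messages i, dec (enc i v F m) = m

namespace StrongStuckAtCode

variable {N : ℕ}

/-- The rate at the defect fraction `i / N`. -/
noncomputable def rate (C : StrongStuckAtCode N) (i : ℕ) : ℝ :=
  Real.logb 2 ((C.messages i).card : ℝ) / N

/-- `ε`-gapped codes: at every defect fraction `ρ ∈ (0, 1 - ε)` the rate is at least `1 - ρ - ε`. -/
def IsGapped (C : StrongStuckAtCode N) (ε : ℝ) : Prop :=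
  ∀ ρ : ℝ, 0 < ρ → ρ < 1 - ε → ∀ i ∈ Finset.Icc 1 N, (i : ℝ) = ρ * N → 1 - ρ - ε ≤ C.rate i

/-- The input of an encoding program: register 0 holds the parameter `k`, register 1 the length `N`,
register 2 the length of the message; arrays 0, 1 and 2 hold the cover vector, the indicator vector of
the frozen set and the message. Everything else is `0`. -/
def encInput (k : ℕ) (v : Fin N → Bool) (F : Finset (Fin N)) (m : List Bool) : RAM.State where
  reg r := if r = 0 then k else if r = 1 then N else if r = 2 then m.length else 0
  mem a j :=
    if a = 0 then (if h : j < N then (v ⟨j, h⟩).toNat else 0)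
    else if a = 1 then (if h : j < N then (decide (⟨j, h⟩ ∈ F)).toNat else 0)
    else if a = 2 then (m.getD j false).toNat
    else 0

/-- The input of a decoding program: register 0 holds the parameter `k`, register 1 the length `N`, and
array 0 the vector to decode. Everything else is `0`. -/
def decInput (k : ℕ) (w : Fin N → Bool) : RAM.State where
  reg r := if r = 0 then k else if r = 1 then N else 0
  mem a j := if a = 0 then (if h : j < N then (w ⟨j, h⟩).toNat else 0) else 0

/-- The program `p`, given the parameter `k`, computes the encoder of `C` at cost at most `T` on every
input. The encoded vector replaces the cover vector in array 0. -/
def EncodesWithin (C : StrongStuckAtCode N) (p : RAM.Prog) (k : ℕ) (T : ℝ) : Prop :=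
  ∀ i ∈ Finset.Icc 1 N, ∀ (v : Fin N → Bool) (F : Finset (Fin N)), F.card = i →
    ∀ m ∈ C.messages i, ∃ (t : ℕ) (s : RAM.State),
      RAM.Exec p (encInput k v F m) t s ∧ (t : ℝ) ≤ T ∧
        ∀ j : Fin N, s.mem 0 j = (C.enc i v F m j).toNat

/-- The program `p`, given the parameter `k`, computes the decoder of `C` at cost at most `T` on every
vector. At the end register 2 holds the length of the decoded message and array 2 the message. -/
def DecodesWithin (C : StrongStuckAtCode N) (p : RAM.Prog) (k : ℕ) (T : ℝ) : Prop :=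
  ∀ w : Fin N → Bool, ∃ (t : ℕ) (s : RAM.State),
    RAM.Exec p (decInput k w) t s ∧ (t : ℝ) ≤ T ∧
      s.reg 2 = (C.dec w).length ∧
        ∀ j : Fin (C.dec w).length, s.mem 2 j = ((C.dec w).get j).toNat

end StrongStuckAtCode

-- A vector is used in two ways, neither of which requires the decoder to know the frozen cells.
--
-- Side information: cut the vector into `n` blocks of width `W`, where `W` is about `√(8kN)`. A
-- block with at least `2n` free cells can be given any weight modulo `2n`, and thus stores one bit
-- together with the index of another block. The encoder writes `r` bits to the first `r` usable
-- blocks from the left, each pointing back to the previous one, and uses one more usable block to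
-- make the weight of the whole vector point to the last link (`encSideProg_run`). The decoder
-- starts from the total weight and follows the list.
--
-- Message: behind these blocks the vector is cut into blocks of `B = O(k log N)` cells. A block
-- with `f` free cells carries up to `f - E` message bits, `E = O(log N)`: its free cells are chosen
-- such that a hash value of the block spells the address of the message block used before, the
-- number of message bits in that block, and the message bits of the present one. The decoder
-- follows this chain backwards (`Readable.step`) from the last block; the address and bit count of
-- that block, the message length and the seed of the hash function form the side information.
--
-- The hash functions are `x ↦ (a * x + b) mod p` with a prime `p` just above `2 ^ B`. They are
-- pairwise independent, so by Chebyshev (`card_affine_avoiding_le`) a set `X` of admissible words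
-- misses a set `Y` of admissible values for at most a fraction `p / (|X| |Y|)` of the pairs `(a,
-- b)`. For one block this is at most `2 N (B + 1) / 2 ^ E`, and a union bound gives one seed for
-- all blocks (`exists_goodSeed`). The allocation of message bits to blocks (`scan`) depends on the
-- frozen positions only, so these events are fixed before anything is written. There are `2 ^ O(B)`
-- seeds and words, so exhaustive search takes time `2 ^ O(B) = N ^ O(k)`, while the decoder
-- evaluates at most `N / B` hash values.
--
-- The cells lost to side information, to unusable blocks, to the incomplete last block and to `E`
-- cells per message block add up to less than `N / k` for large `N` (`Large.budget`). The judgement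
-- `Run` proves correctness and cost of the programs together.

local infixr:50 " ;; " => RAM.Prog.seq

namespace RAM

/-! ### Cost-bounded execution -/

instance : Add Expr := ⟨Expr.op .add⟩
instance : Sub Expr := ⟨Expr.op .sub⟩
instance : Mul Expr := ⟨Expr.op .mul⟩
instance : Div Expr := ⟨Expr.op .div⟩
instance : Mod Expr := ⟨Expr.op .mod⟩
instance (n : ℕ) : OfNat Expr n := ⟨Expr.const n⟩

/-- The comparison `e₁ < e₂`, with value `0` or `1`. -/
def Expr.lt (e₁ e₂ : Expr) : Expr := Expr.op .lt e₁ e₂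
/-- The comparison `e₁ = e₂`, with value `0` or `1`. -/
def Expr.eq (e₁ e₂ : Expr) : Expr := Expr.op .eq e₁ e₂

section val
variable (s : State) (e e' : Expr)
@[simp] theorem Expr.val_add : (e + e').val s = e.val s + e'.val s := rfl
@[simp] theorem Expr.val_sub : (e - e').val s = e.val s - e'.val s := rfl
@[simp] theorem Expr.val_mul : (e * e').val s = e.val s * e'.val s := rfl
@[simp] theorem Expr.val_div : (e / e').val s = e.val s / e'.val s := rfl
@[simp] theorem Expr.val_mod : (e % e').val s = e.val s % e'.val s := rfl
@[simp] theorem Expr.val_lt : (e.lt e').val s = if e.val s < e'.val s then 1 else 0 := rfl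
@[simp] theorem Expr.val_eq : (e.eq e').val s = if e.val s = e'.val s then 1 else 0 := rfl
@[simp] theorem Expr.val_ofNat (n : ℕ) : (no_index (OfNat.ofNat n) : Expr).val s = OfNat.ofNat n :=
  rfl
@[simp] theorem Expr.val_reg (r : ℕ) : (Expr.reg r).val s = s.reg r := rfl
@[simp] theorem Expr.val_load (a : ℕ) : (Expr.load a e).val s = s.mem a (e.val s) := rfl
end val

@[simp] theorem State.setReg_reg (s : State) (r x r' : ℕ) :
    (s.setReg r x).reg r' = if r' = r then x else s.reg r' := by
  simp [State.setReg, Function.update_apply]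
@[simp] theorem State.setReg_mem (s : State) (r x : ℕ) : (s.setReg r x).mem = s.mem := rfl
@[simp] theorem State.setMem_reg (s : State) (a i x : ℕ) : (s.setMem a i x).reg = s.reg := rfl
theorem State.setMem_mem (s : State) (a i x : ℕ) :
    (s.setMem a i x).mem = Function.update s.mem a (Function.update (s.mem a) i x) := rfl

theorem one_le_len (x : ℕ) : 1 ≤ len x := Nat.le_add_left _ _

theorem len_mono {x y : ℕ} (h : x ≤ y) : len x ≤ len y := by
  have := Nat.log_mono_right (b := 2) h
  unfold len; omega

theorem lt_two_pow_len (x : ℕ) : x < 2 ^ len x := Nat.lt_pow_succ_log_self (by norm_num) x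

theorem len_le_of_lt {x L : ℕ} (hL : 1 ≤ L) (h : x < 2 ^ L) : len x ≤ L := by
  rcases Nat.eq_zero_or_pos x with rfl | hx
  · simpa [len] using hL
  · have := Nat.log_lt_of_lt_pow (b := 2) hx.ne' h
    unfold len; omega

theorem len_le_succ (n : ℕ) : len n ≤ n + 1 := by
  have := Nat.log_le_self 2 n
  unfold len; omega

/-- This makes `Expr.weight` additive: not even a product has more bits than its factors have
together. -/
theorem len_apply_le (o : Op) (x y : ℕ) : len (o.apply x y) ≤ len x + len y := by
  have hx := one_le_len x
  have hy := one_le_len y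
  have h1 : ∀ n : ℕ, n ≤ 1 → len n ≤ len x + len y := fun n hn => by
    have : len n ≤ len 1 := len_mono hn
    have : len 1 = 1 := by simp [len]
    omega
  have h2 : ∀ n : ℕ, n ≤ x → len n ≤ len x + len y := fun n hn => by
    have := len_mono hn
    omega
  have lx := lt_two_pow_len x
  have ly := lt_two_pow_len y
  cases o with
  | add =>
    apply len_le_of_lt (by omega)
    have a : 2 ^ len x * 2 ≤ 2 ^ len x * 2 ^ len y :=
      Nat.mul_le_mul_left _ (by simpa using Nat.pow_le_pow_right (n := 2) (by norm_num) hy)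
    have b : 2 * 2 ^ len y ≤ 2 ^ len x * 2 ^ len y :=
      Nat.mul_le_mul_right _ (by simpa using Nat.pow_le_pow_right (n := 2) (by norm_num) hx)
    rw [pow_add]
    simp only [Op.apply]
    omega
  | sub => exact h2 _ (Nat.sub_le _ _)
  | mul =>
    apply len_le_of_lt (by omega)
    rw [pow_add]
    exact Nat.mul_lt_mul'' lx ly
  | div => exact h2 _ (Nat.div_le_self _ _)
  | mod => exact h2 _ (Nat.mod_le _ _)
  | lt => exact h1 _ (by simp only [Op.apply]; split_ifs <;> simp)
  | eq => exact h1 _ (by simp only [Op.apply]; split_ifs <;> simp)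

/-- A bound for the length of the value of an expression, relative to the length of the cells. -/
def Expr.weight : Expr → ℕ
  | .const n => n + 1
  | .reg _ => 1
  | .load _ _ => 1
  | .op _ e₁ e₂ => e₁.weight + e₂.weight

/-- A bound for the cost of evaluating an expression, relative to the length of the cells. -/
def Expr.size : Expr → ℕ
  | .const n => n + 1
  | .reg _ => 1
  | .load _ e => e.size + e.weight + 1
  | .op _ e₁ e₂ => e₁.size + e₂.size + e₁.weight + e₂.weight

/-- All cells hold numbers of at most `L` bits. -/
def State.Bdd (L : ℕ) (s : State) : Prop := (∀ r, s.reg r < 2 ^ L) ∧ ∀ a j, s.mem a j < 2 ^ L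

theorem Expr.len_val_le {L : ℕ} {s : State} (hL : 1 ≤ L) (h : s.Bdd L) (e : Expr) :
    len (e.val s) ≤ e.weight * L := by
  induction e with
  | const n =>
    exact (len_le_succ n).trans (Nat.le_mul_of_pos_right _ hL)
  | reg r => simpa [Expr.weight, Expr.val] using len_le_of_lt hL (h.1 r)
  | load a e ih => simpa [Expr.weight, Expr.val] using len_le_of_lt hL (h.2 a _)
  | op o e₁ e₂ ih₁ ih₂ =>
    have := len_apply_le o (e₁.val s) (e₂.val s)
    simp only [Expr.val, Expr.weight, add_mul]
    omega

theorem Expr.cost_le {L : ℕ} {s : State} (hL : 1 ≤ L) (h : s.Bdd L) (e : Expr) :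
    e.cost s ≤ e.size * L := by
  induction e with
  | const n =>
    exact (len_le_succ n).trans (Nat.le_mul_of_pos_right _ hL)
  | reg r => simpa [Expr.size, Expr.cost] using len_le_of_lt hL (h.1 r)
  | load a e ih =>
    have h1 := len_le_of_lt hL (h.2 a (e.val s))
    have h2 := e.len_val_le hL h
    simp only [Expr.size, Expr.cost, add_mul]
    omega
  | op o e₁ e₂ ih₁ ih₂ =>
    have h1 := e₁.len_val_le hL h
    have h2 := e₂.len_val_le hL h
    simp only [Expr.size, Expr.cost, add_mul]
    omega

/-- Expressions which can be evaluated and stored within one unit of `128 * L`. -/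
def Expr.Small (e : Expr) : Prop := e.size + e.weight ≤ 64

instance (e : Expr) : Decidable e.Small := inferInstanceAs (Decidable (_ ≤ _))

/-- Started in `s`, the program halts within `n` units of cost `128 * L` in a state satisfying `Q`,
provided that all cells of `s` hold at most `L` bits; the same is then true of the final state. -/
def Run (L : ℕ) (p : Prog) (s : State) (n : ℕ) (Q : State → Prop) : Prop :=
  s.Bdd L → ∃ t s', Exec p s t s' ∧ t ≤ n * (128 * L) ∧ s'.Bdd L ∧ Q s'

theorem State.Bdd.setReg {L : ℕ} {s : State} (h : s.Bdd L) {r x : ℕ} (hx : x < 2 ^ L) :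
    (s.setReg r x).Bdd L := by
  refine ⟨fun r' => ?_, h.2⟩
  rw [State.setReg_reg]
  split_ifs
  exacts [hx, h.1 r']

theorem State.Bdd.setMem {L : ℕ} {s : State} (h : s.Bdd L) {a i x : ℕ} (hx : x < 2 ^ L) :
    (s.setMem a i x).Bdd L := by
  refine ⟨h.1, fun a' j => ?_⟩
  rw [State.setMem_mem]
  by_cases ha : a' = a
  · subst ha
    by_cases hj : j = i
    · subst hj; simpa using hx
    · simpa [Function.update_of_ne hj] using h.2 a' j
  · simpa [Function.update_of_ne ha] using h.2 a' j

section rules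
variable {L : ℕ} {s : State} {Q : State → Prop} {n m : ℕ}

theorem Run.mono {p : Prog} {Q' : State → Prop} (h : Run L p s n Q) (hnm : n ≤ m)
    (hQ : ∀ s', Q s' → Q' s') : Run L p s m Q' := by
  intro hs
  obtain ⟨t, s', he, ht, hb, hq⟩ := h hs
  exact ⟨t, s', he, ht.trans (Nat.mul_le_mul_right _ hnm), hb, hQ _ hq⟩

theorem Run.assign {r : ℕ} {e : Expr} (hL : 1 ≤ L) (he : e.Small) (hv : e.val s < 2 ^ L)
    (hQ : Q (s.setReg r (e.val s))) : Run L (.assign r e) s 1 Q := by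
  intro hs
  refine ⟨_, _, Exec.assign r e s, ?_, hs.setReg hv, hQ⟩
  have h1 := e.cost_le hL hs
  have h2 := e.len_val_le hL hs
  have h3 : (e.size + e.weight) * L ≤ 64 * L := Nat.mul_le_mul_right _ he
  rw [add_mul] at h3
  omega

theorem Run.store {a : ℕ} {i e : Expr} (hL : 1 ≤ L) (hi : i.Small) (he : e.Small)
    (hv : e.val s < 2 ^ L) (hQ : Q (s.setMem a (i.val s) (e.val s))) :
    Run L (.store a i e) s 1 Q := by
  intro hs
  refine ⟨_, _, Exec.store a i e s, ?_, hs.setMem hv, hQ⟩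
  have h1 := e.cost_le hL hs
  have h2 := e.len_val_le hL hs
  have h3 : (e.size + e.weight) * L ≤ 64 * L := Nat.mul_le_mul_right _ he
  have h4 := i.cost_le hL hs
  have h5 := i.len_val_le hL hs
  have h6 : (i.size + i.weight) * L ≤ 64 * L := Nat.mul_le_mul_right _ hi
  rw [add_mul] at h3 h6
  omega

theorem Run.skip (hL : 1 ≤ L) (hQ : Q s) : Run L .skip s 1 Q :=
  fun hs => ⟨_, _, Exec.skip s, by omega, hs, hQ⟩

/-- The postcondition of `p` is the whole judgement for `q` with the remaining budget, so that
programs are verified one instruction at a time, in continuation style. -/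
theorem Run.seq {p q : Prog} (h : Run L p s m (fun s' => Run L q s' (n - m) Q)) (hm : m ≤ n) :
    Run L (.seq p q) s n Q := by
  intro hs
  obtain ⟨t, s', he, ht, hb, hq⟩ := h hs
  obtain ⟨t', s'', he', ht', hb', hq'⟩ := hq hb
  refine ⟨_, _, Exec.seq he he', ?_, hb', hq'⟩
  calc t + t' ≤ m * (128 * L) + (n - m) * (128 * L) := add_le_add ht ht'
    _ = n * (128 * L) := by rw [← add_mul]; congr 1; omega

theorem Expr.Small.guard {e : Expr} (hL : 1 ≤ L) (he : e.Small) (hs : s.Bdd L) :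
    e.cost s + 1 ≤ 128 * L := by
  have h1 := e.cost_le hL hs
  have h3 : e.size * L ≤ 64 * L := Nat.mul_le_mul_right _ (le_trans (Nat.le_add_right _ _) he)
  omega

theorem Run.branch {e : Expr} {p q : Prog} (hL : 1 ≤ L) (he : e.Small)
    (hp : e.val s ≠ 0 → Run L p s n Q) (hq : e.val s = 0 → Run L q s n Q) :
    Run L (.branch e p q) s (n + 1) Q := by
  intro hs
  have hg := he.guard hL hs
  have key : ∀ t, t ≤ n * (128 * L) → e.cost s + 1 + t ≤ (n + 1) * (128 * L) := fun t ht => by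
    rw [add_mul, one_mul]; omega
  by_cases h : e.val s = 0
  · obtain ⟨t, s', he', ht, hb, hQ⟩ := hq h hs
    exact ⟨_, _, Exec.branch_false h he', key t ht, hb, hQ⟩
  · obtain ⟨t, s', he', ht, hb, hQ⟩ := hp h hs
    exact ⟨_, _, Exec.branch_true h he', key t ht, hb, hQ⟩

/-- The invariant is indexed by the number of completed rounds. As a true guard has to imply `i <
n`, termination and the cost bound come from the same hypothesis. -/
theorem Run.loop {e : Expr} {p : Prog} (Inv : ℕ → State → Prop) (hL : 1 ≤ L) (he : e.Small)
    (h : ∀ i s, Inv i s → (e.val s = 0 ∧ Q s) ∨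
      (e.val s ≠ 0 ∧ i < n ∧ Run L p s m (Inv (i + 1)))) (h0 : Inv 0 s) :
    Run L (.loop e p) s (n * (m + 1) + 1) Q := by
  suffices H : ∀ d i s, n - i = d → Inv i s → Run L (.loop e p) s (d * (m + 1) + 1) Q from
    H n 0 s rfl h0
  intro d
  induction d with
  | zero =>
    intro i s hd hi hs
    rcases h i s hi with ⟨hz, hq⟩ | ⟨_, hlt, _⟩
    · exact ⟨_, _, Exec.loop_false hz, by simpa using he.guard hL hs, hs, hq⟩
    · omega
  | succ d ih =>
    intro i s hd hi hs
    have hg := he.guard hL hs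
    rcases h i s hi with ⟨hz, hq⟩ | ⟨hnz, hlt, hr⟩
    · refine ⟨_, _, Exec.loop_false hz, hg.trans ?_, hs, hq⟩
      exact Nat.le_mul_of_pos_left _ (by omega)
    · obtain ⟨t, s', he', ht, hb, hQ⟩ := hr hs
      obtain ⟨t', s'', he'', ht', hb', hQ'⟩ := ih (i + 1) s' (by omega) hQ hb
      refine ⟨_, _, Exec.loop_true hnz he' he'', ?_, hb', hQ'⟩
      calc e.cost s + 1 + t + t'
          ≤ 128 * L + m * (128 * L) + (d * (m + 1) + 1) * (128 * L) := by omega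
        _ = ((d + 1) * (m + 1) + 1) * (128 * L) := by ring

theorem Run.assign_seq {r : ℕ} {e : Expr} {q : Prog} (hL : 1 ≤ L) (he : e.Small) (hn : 1 ≤ n)
    (hv : e.val s < 2 ^ L) (h : Run L q (s.setReg r (e.val s)) (n - 1) Q) :
    Run L (.seq (.assign r e) q) s n Q :=
  Run.seq (Run.assign hL he hv h) hn

end rules

/-! ### Preserved registers; weights and binary numbers held by intervals of cells -/

/-- The registers below `b` agree. -/
def State.Keep (b : ℕ) (s s' : State) : Prop := ∀ r < b, s'.reg r = s.reg r

theorem State.Keep.refl (b : ℕ) (s : State) : s.Keep b s := fun _ _ => rfl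

theorem State.Keep.trans {b : ℕ} {s s' s'' : State} (h : s.Keep b s') (h' : s'.Keep b s'') :
    s.Keep b s'' := fun r hr => (h' r hr).trans (h r hr)

theorem State.Keep.mono {b b' : ℕ} {s s' : State} (h : s.Keep b s') (hb : b' ≤ b) : s.Keep b' s' :=
  fun r hr => h r (hr.trans_le hb)

theorem State.Keep.setReg {b r x : ℕ} {s s' : State} (h : s.Keep b s') (hr : b ≤ r) :
    s.Keep b (s'.setReg r x) := fun r' hr' => by
  rw [State.setReg_reg, if_neg (by omega)]
  exact h r' hr'

theorem State.Keep.setMem {b a i x : ℕ} {s s' : State} (h : s.Keep b s') :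
    s.Keep b (s'.setMem a i x) := h

/-- The sum of `len` consecutive cells from `lo` on. -/
def cellSum (f : ℕ → ℕ) (lo len : ℕ) : ℕ := ∑ j ∈ Finset.range len, f (lo + j)

/-- The number whose binary digits are the `len` cells from `lo` on, low order first. -/
def cellNum (f : ℕ → ℕ) (lo len : ℕ) : ℕ := ∑ j ∈ Finset.range len, f (lo + j) * 2 ^ j

theorem cellSum_succ (f : ℕ → ℕ) (lo len : ℕ) :
    cellSum f lo (len + 1) = cellSum f lo len + f (lo + len) := Finset.sum_range_succ _ _

theorem cellSum_le {f : ℕ → ℕ} {lo len : ℕ} (hf : ∀ j, f j ≤ 1) : cellSum f lo len ≤ len := by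
  simpa [cellSum] using Finset.sum_le_card_nsmul (Finset.range len) (fun j => f (lo + j)) 1
    fun j _ => hf _

theorem cellNum_cons (f : ℕ → ℕ) (lo len : ℕ) :
    cellNum f lo (len + 1) = 2 * cellNum f (lo + 1) len + f lo := by
  unfold cellNum
  rw [Finset.sum_range_succ', Finset.mul_sum]
  congr 1
  · refine Finset.sum_congr rfl fun j _ => ?_
    rw [pow_succ, show lo + 1 + j = lo + (j + 1) by ring]; ring
  · simp

theorem cellNum_lt {f : ℕ → ℕ} {lo len : ℕ} (hf : ∀ j, f j ≤ 1) : cellNum f lo len < 2 ^ len := by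
  induction len generalizing lo with
  | zero => simp [cellNum]
  | succ len ih =>
    rw [cellNum_cons, pow_succ]
    have := @ih (lo + 1)
    have := hf lo
    omega

theorem cellSum_congr {f g : ℕ → ℕ} {lo len : ℕ} (h : ∀ j, lo ≤ j → j < lo + len → f j = g j) :
    cellSum f lo len = cellSum g lo len :=
  Finset.sum_congr rfl fun j hj => h _ (by omega) (by simp at hj; omega)

theorem cellNum_congr {f g : ℕ → ℕ} {lo len : ℕ} (h : ∀ j, lo ≤ j → j < lo + len → f j = g j) :
    cellNum f lo len = cellNum g lo len :=
  Finset.sum_congr rfl fun j hj => by rw [h _ (by omega) (by simp at hj; omega)]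

theorem cellNum_bit {f : ℕ → ℕ} (hf : ∀ j, f j ≤ 1) {lo len j : ℕ} (hj : j < len) :
    cellNum f lo len / 2 ^ j % 2 = f (lo + j) := by
  induction len generalizing lo j with
  | zero => omega
  | succ len ih =>
    rw [cellNum_cons]
    have h0 := hf lo
    cases j with
    | zero => simp; omega
    | succ j =>
      rw [pow_succ', ← Nat.div_div_eq_div_mul,
        show (2 * cellNum f (lo + 1) len + f lo) / 2 = cellNum f (lo + 1) len by omega,
        ih (by omega)]
      congr 1; ring

section fragments
variable {L : ℕ} {s : State}

/-- Register 42 becomes the sum of the cells `reg 40 ≤ j < reg 40 + reg 41` of the array `a`. -/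
def sumProg (a : ℕ) : Prog :=
  .assign 42 0 ;; .assign 43 0 ;;
  .loop ((Expr.reg 43).lt (.reg 41))
    (.assign 42 (.reg 42 + .load a (.reg 40 + .reg 43)) ;; .assign 43 (.reg 43 + 1))

theorem sumProg_run (hL : 1 ≤ L) (a : ℕ) (ha : a ≤ 2) (hf : ∀ j, s.mem a j ≤ 1)
    (hlen : s.reg 41 + 1 < 2 ^ L) :
    Run L (sumProg a) s (3 * s.reg 41 + 3) fun s' =>
      s'.reg 42 = cellSum (s.mem a) (s.reg 40) (s.reg 41) ∧ s.Keep 42 s' ∧ s'.mem = s.mem := by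
  refine .assign_seq hL (by decide) (by omega) (by simp) ?_
  refine .assign_seq hL (by decide) (by omega) (by simp) ?_
  refine (Run.loop (n := s.reg 41) (m := 2) (fun i t => t.reg 43 = i ∧ i ≤ s.reg 41 ∧
    t.reg 42 = cellSum (s.mem a) (s.reg 40) i ∧ s.Keep 42 t ∧ t.mem = s.mem) hL (by decide) ?_
    ?_).mono (by omega) fun _ h => h
  · rintro i t ⟨h43, hi, h42, hk, hm⟩
    have h40 := hk 40 (by norm_num)
    have h41 := hk 41 (by norm_num)
    rcases eq_or_lt_of_le hi with rfl | hlt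
    · exact Or.inl ⟨by simp [h43, h41], h42, hk, hm⟩
    · refine Or.inr ⟨by simp [h43, h41, hlt], hlt, ?_⟩
      have hb : cellSum (s.mem a) (s.reg 40) (i + 1) ≤ i + 1 := cellSum_le hf
      refine .assign_seq hL (by interval_cases a <;> decide) (by omega) ?_ ?_
      · simp only [Expr.val_add, Expr.val_reg, Expr.val_load, hm, h40, h43, h42]
        rw [← cellSum_succ]; omega
      · refine .assign hL (by decide) (by simp [h43]; omega) ?_
        refine ⟨by simp [h43], hlt, ?_, (hk.setReg (by norm_num)).setReg (by norm_num),
          by simp [hm]⟩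
        simp [h42, hm, h40, h43, cellSum_succ]
  · refine ⟨by simp, by omega, by simp [cellSum], ?_, by simp⟩
    exact ((State.Keep.refl _ _).setReg (by norm_num)).setReg (by norm_num)

/-- Register 42 becomes the hash value `(reg 11 * x + reg 12) % reg 10` of the number `x` in the
`reg 4` cells of array 0 from `reg 40` on. -/
def hashProg : Prog :=
  .assign 42 0 ;; .assign 43 (.reg 4) ;;
  .loop (.reg 43)
    (.assign 43 (.reg 43 - 1) ;; .assign 42 (2 * .reg 42 + .load 0 (.reg 40 + .reg 43))) ;;
  .assign 42 ((.reg 11 * .reg 42 + .reg 12) % .reg 10)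

theorem hashProg_run (hL : 1 ≤ L) (hf : ∀ j, s.mem 0 j ≤ 1) {B : ℕ} (hB : s.reg 4 = B)
    (hBL : B < L) (hh : s.reg 11 * 2 ^ B + s.reg 12 < 2 ^ L) :
    Run L hashProg s (3 * B + 4) fun s' =>
      s'.reg 42 = (s.reg 11 * cellNum (s.mem 0) (s.reg 40) B + s.reg 12) % s.reg 10 ∧
        s.Keep 42 s' ∧ s'.mem = s.mem := by
  have hBL' : 2 ^ B < 2 ^ L := Nat.pow_lt_pow_right (by norm_num) hBL
  have hB2 : B < 2 ^ B := Nat.lt_two_pow_self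
  refine .assign_seq hL (by decide) (by omega) (by simp) ?_
  refine .assign_seq hL (by decide) (by omega) (by simp; omega) ?_
  refine Run.seq (m := 3 * B + 1) ?_ (by omega)
  -- Horner's rule from the top cell down: after `i` rounds register 42 holds the number in the
  -- topmost `i` cells.
  refine (Run.loop (n := B) (m := 2) (fun i t => i + t.reg 43 = B ∧
    t.reg 42 = cellNum (s.mem 0) (s.reg 40 + t.reg 43) i ∧ s.Keep 42 t ∧ t.mem = s.mem) hL
    (by decide) ?_ ?_).mono (by omega) fun _ h => h
  · rintro i t ⟨h43, h42, hk, hm⟩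
    have h40 := hk 40 (by norm_num)
    by_cases h0 : t.reg 43 = 0
    · have hi : i = B := by omega
      subst hi
      refine Or.inl ⟨by simpa using h0, ?_⟩
      have hx : cellNum (s.mem 0) (s.reg 40) i < 2 ^ i := cellNum_lt hf
      refine .mono (n := 1) (.assign hL (by decide) ?_ ?_) (by omega) fun _ h => h
      · simp only [Expr.val_add, Expr.val_reg, Expr.val_mul, Expr.val_mod, h42, h0,
          hk 10 (by norm_num), hk 11 (by norm_num), hk 12 (by norm_num)]
        refine (Nat.mod_le _ _).trans_lt (lt_of_le_of_lt ?_ hh)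
        gcongr
        exact hx.le
      · refine ⟨?_, hk.setReg (by norm_num), by simp [hm]⟩
        simp [h42, h0, hk 10 (by norm_num), hk 11 (by norm_num), hk 12 (by norm_num)]
    · refine Or.inr ⟨by simpa using h0, by omega, ?_⟩
      refine .assign_seq hL (by decide) (by omega) (by simp; omega) ?_
      have e : 2 * t.reg 42 + s.mem 0 (s.reg 40 + (t.reg 43 - 1)) =
          cellNum (s.mem 0) (s.reg 40 + (t.reg 43 - 1)) (i + 1) := by
        rw [cellNum_cons, h42, show s.reg 40 + (t.reg 43 - 1) + 1 = s.reg 40 + t.reg 43 by omega]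
      have hx : cellNum (s.mem 0) (s.reg 40 + (t.reg 43 - 1)) (i + 1) < 2 ^ (i + 1) := cellNum_lt hf
      have hi : 2 ^ (i + 1) ≤ 2 ^ B := Nat.pow_le_pow_right (by norm_num) (by omega)
      refine .assign hL (by decide) ?_ ?_
      · simp [h40, hm, e]; omega
      · refine ⟨by simp; omega, ?_, (hk.setReg (by norm_num)).setReg (by norm_num),
          by simp [hm]⟩
        simp [h40, hm, e]
  · refine ⟨by simp [hB], by simp [cellNum], ?_, by simp⟩
    exact ((State.Keep.refl _ _).setReg (by norm_num)).setReg (by norm_num)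

end fragments

/-- Overwrite `len` cells from `pos` on by the low order binary digits of `y`. -/
def setBits (f : ℕ → ℕ) (pos len y : ℕ) : ℕ → ℕ :=
  fun j => if pos ≤ j ∧ j < pos + len then y / 2 ^ (j - pos) % 2 else f j

@[simp] theorem setBits_zero (f : ℕ → ℕ) (pos y : ℕ) : setBits f pos 0 y = f := by
  funext j; simp [setBits]

theorem setBits_succ (f : ℕ → ℕ) (pos len y : ℕ) :
    setBits f pos (len + 1) y =
      Function.update (setBits f pos len y) (pos + len) (y / 2 ^ len % 2) := by
  funext j
  rcases eq_or_ne j (pos + len) with rfl | hj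
  · simp [setBits]
  · rw [Function.update_of_ne hj]
    unfold setBits
    congr 1
    simp only [eq_iff_iff]; omega

/-! ### Parameters and hash functions -/

/-- The parameters of the construction: the length `N` of the code, the length `B` of the blocks which
carry the message, the number `n` and the length `W` of the blocks which carry the side information,
the number `E` of free cells lost in each block, and the bound `M₀` for the length of messages. -/
structure Par where
  N : ℕ
  B : ℕ
  n : ℕ
  W : ℕ
  E : ℕ
  M₀ : ℕ

namespace Par

variable (P : Par)

/-- The base in which the side information is written. -/
def Q : ℕ := 2 ^ (P.B + 2)

/-- The number of bits of the side information. -/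
def r : ℕ := 6 * (P.B + 2)

/-- A bound for the length of all numbers in a computation. -/
def L : ℕ := 8 * (P.B + 2)

/-- The registers hold the parameters. -/
structure InRegs (s : State) : Prop where
  N : s.reg 1 = P.N
  E : s.reg 3 = P.E
  B : s.reg 4 = P.B
  Q : s.reg 5 = P.Q
  W : s.reg 6 = P.W
  n : s.reg 7 = P.n
  r : s.reg 8 = P.r
  M₀ : s.reg 9 = P.M₀

theorem InRegs.keep {P : Par} {s s' : State} {b : ℕ} (h : P.InRegs s) (hk : s.Keep b s')
    (hb : 10 ≤ b := by norm_num) : P.InRegs s' where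
  N := by rw [hk _ (by omega), h.N]
  E := by rw [hk _ (by omega), h.E]
  B := by rw [hk _ (by omega), h.B]
  Q := by rw [hk _ (by omega), h.Q]
  W := by rw [hk _ (by omega), h.W]
  n := by rw [hk _ (by omega), h.n]
  r := by rw [hk _ (by omega), h.r]
  M₀ := by rw [hk _ (by omega), h.M₀]

theorem InRegs.setReg {P : Par} {s : State} {r x : ℕ} (h : P.InRegs s) (hr : r = 2 ∨ 10 ≤ r) :
    P.InRegs (s.setReg r x) where
  N := by rw [State.setReg_reg, if_neg (by omega), h.N]
  E := by rw [State.setReg_reg, if_neg (by omega), h.E]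
  B := by rw [State.setReg_reg, if_neg (by omega), h.B]
  Q := by rw [State.setReg_reg, if_neg (by omega), h.Q]
  W := by rw [State.setReg_reg, if_neg (by omega), h.W]
  n := by rw [State.setReg_reg, if_neg (by omega), h.n]
  r := by rw [State.setReg_reg, if_neg (by omega), h.r]
  M₀ := by rw [State.setReg_reg, if_neg (by omega), h.M₀]

/-- The basic inequalities between the parameters. -/
structure Basic : Prop where
  n_pos : 0 < P.n
  W_pos : 0 < P.W
  nW_le : P.n * P.W ≤ P.N
  N_lt : P.N < 2 ^ P.B
  M₀_lt : P.M₀ ≤ P.N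
  M₀_gt : 1 < P.M₀

section bounds
variable {P}

theorem one_le_L : 1 ≤ P.L := by unfold L; omega
theorem B_lt_L : P.B < P.L := by unfold L; omega

theorem Q_pow (m : ℕ) : P.Q ^ m = 2 ^ (m * (P.B + 2)) := by
  unfold Q; rw [← pow_mul]; congr 1; ring

/-- `L` bits hold eight digits in base `Q`. The side information has six and a hash value at most
two, so every intermediate number fits. -/
theorem Q_pow_le_L {m : ℕ} (hm : m ≤ 8) : P.Q ^ m ≤ 2 ^ P.L := by
  rw [Q_pow]; exact Nat.pow_le_pow_right (by norm_num) (Nat.mul_le_mul_right _ hm)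

theorem four_two_pow : 4 * 2 ^ P.B = P.Q := by unfold Q; rw [pow_add]; ring

theorem B_lt_two_pow : P.B < 2 ^ P.B := Nat.lt_two_pow_self

theorem Q_pos : 0 < P.Q := by unfold Q; positivity

theorem four_le_Q : 4 ≤ P.Q := by
  have := four_two_pow (P := P)
  have : 1 ≤ 2 ^ P.B := Nat.one_le_two_pow
  omega

theorem Q_mul_self_lt : P.Q * P.Q * P.Q * 4 ≤ 2 ^ P.L := by
  refine le_trans ?_ (Q_pow_le_L (m := 4) (by norm_num))
  have := Nat.mul_le_mul_left (P.Q * P.Q * P.Q) (four_le_Q (P := P))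
  calc _ ≤ _ := this
    _ = _ := by ring

theorem Q_mul_Q_le : P.Q * P.Q * 4 ≤ 2 ^ P.L := by
  refine le_trans ?_ Q_mul_self_lt
  have := Q_pos (P := P)
  have : P.Q * P.Q ≤ P.Q * P.Q * P.Q := Nat.le_mul_of_pos_right _ this
  omega

theorem Q_le : P.Q * 4 ≤ 2 ^ P.L := by
  refine le_trans ?_ Q_mul_Q_le
  have := Q_pos (P := P)
  have : P.Q ≤ P.Q * P.Q := Nat.le_mul_of_pos_right _ this
  omega

theorem Basic.N_lt_Q (h : P.Basic) : 4 * P.N < P.Q := by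
  have := h.N_lt
  have := four_two_pow (P := P)
  omega

theorem Basic.n_le (h : P.Basic) : P.n ≤ P.N :=
  (Nat.le_mul_of_pos_right _ h.W_pos).trans h.nW_le

theorem Basic.W_le (h : P.Basic) : P.W ≤ P.N :=
  (Nat.le_mul_of_pos_left _ h.n_pos).trans h.nW_le

theorem B_lt_Q : 4 * P.B < P.Q := by
  have := four_two_pow (P := P)
  have := B_lt_two_pow (P := P)
  omega

end bounds

/-- The multiplier, the summand and the modulus of a hash function are the three digits of its
seed in base `Q`. -/
def hash (sd x : ℕ) : ℕ := (sd / P.Q % P.Q * x + sd % P.Q) % (sd / P.Q / P.Q)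

/-- A seed of a hash function is read from the registers 10, 11 and 12. -/
structure HasSeed (sd : ℕ) (s : State) : Prop where
  modulus : s.reg 10 = sd / P.Q / P.Q
  factor : s.reg 11 = sd / P.Q % P.Q
  summand : s.reg 12 = sd % P.Q

theorem HasSeed.keep {P : Par} {s s' : State} {b sd : ℕ} (h : P.HasSeed sd s) (hk : s.Keep b s')
    (hb : 13 ≤ b := by norm_num) : P.HasSeed sd s' where
  modulus := by rw [hk _ (by omega), h.modulus]
  factor := by rw [hk _ (by omega), h.factor]
  summand := by rw [hk _ (by omega), h.summand]

theorem hash_run {P : Par} {s : State} {sd : ℕ} (hP : P.InRegs s) (hf : ∀ j, s.mem 0 j ≤ 1)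
    (hs : P.HasSeed sd s) :
    Run P.L hashProg s (3 * P.B + 4) fun s' =>
      s'.reg 42 = P.hash sd (cellNum (s.mem 0) (s.reg 40) P.B) ∧ s.Keep 42 s' ∧ s'.mem = s.mem := by
  refine (hashProg_run one_le_L hf hP.B B_lt_L ?_).mono le_rfl ?_
  · rw [hs.factor, hs.summand]
    have h1 : sd / P.Q % P.Q < P.Q := Nat.mod_lt _ Q_pos
    have h2 : sd % P.Q < P.Q := Nat.mod_lt _ Q_pos
    have h3 : sd / P.Q % P.Q * 2 ^ P.B ≤ P.Q * P.Q :=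
      Nat.mul_le_mul h1.le (by have := four_two_pow (P := P); omega)
    have := Q_mul_Q_le (P := P)
    have : P.Q ≤ P.Q * P.Q := Nat.le_mul_of_pos_right _ Q_pos
    omega
  · rintro s' ⟨h, hk, hm⟩
    exact ⟨by rw [h, hs.factor, hs.summand, hs.modulus]; rfl, hk, hm⟩

/-- No condition on the seed is needed: even with modulus 0, where `%` returns its first argument,
the value stays below `Q ^ 2`. Both the search and the decoding of an arbitrary vector meet such
seeds. -/
theorem hash_lt {sd x : ℕ} (hx : x < 2 ^ P.B) : P.hash sd x < P.Q * P.Q := by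
  have h1 : sd / P.Q % P.Q < P.Q := Nat.mod_lt _ Q_pos
  have h2 : sd % P.Q < P.Q := Nat.mod_lt _ Q_pos
  refine (Nat.mod_le _ _).trans_lt ?_
  have h3 : sd / P.Q % P.Q * x ≤ P.Q * 2 ^ P.B := Nat.mul_le_mul h1.le hx.le
  have : P.Q * (4 * 2 ^ P.B) = P.Q * P.Q := by rw [four_two_pow]
  have : P.Q ≤ P.Q * 2 ^ P.B := Nat.le_mul_of_pos_right _ (by positivity)
  have := Q_pos (P := P)
  nlinarith

/-! ### The decoder -/

/-- Read `t` bits of side information, beginning with the block `g`, after the bits of `A`. -/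
def readChain (f : ℕ → ℕ) : ℕ → ℕ → ℕ → ℕ
  | 0, _, A => A
  | t + 1, g, A =>
    let x := cellSum f (g * P.W) P.W % (2 * P.n)
    readChain f t (x % P.n) (2 * A + x / P.n)

/-- The side information in the cells `f`. -/
def side (f : ℕ → ℕ) : ℕ := P.readChain f P.r (cellSum f 0 P.N % (2 * P.n) % P.n) 0

/-- Register 18 becomes the side information. -/
def sideProg : Prog :=
  .assign 40 0 ;; .assign 41 (.reg 1) ;; sumProg 0 ;;
  .assign 13 (.reg 42 % (2 * .reg 7) % .reg 7) ;; .assign 18 0 ;; .assign 14 0 ;;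
  .loop ((Expr.reg 14).lt (.reg 8))
    (.assign 40 (.reg 13 * .reg 6) ;; .assign 41 (.reg 6) ;; sumProg 0 ;;
      .assign 42 (.reg 42 % (2 * .reg 7)) ;; .assign 18 (2 * .reg 18 + .reg 42 / .reg 7) ;;
      .assign 13 (.reg 42 % .reg 7) ;; .assign 14 (.reg 14 + 1))

theorem sideProg_run {P : Par} {s : State} (hB : P.Basic) (hP : P.InRegs s)
    (hf : ∀ j, s.mem 0 j ≤ 1) :
    Run P.L sideProg s (3 * P.N + 20 + P.r * (3 * P.W + 20)) fun s' =>
      s'.reg 18 = P.side (s.mem 0) ∧ s'.reg 18 < 2 ^ P.r ∧ s.Keep 13 s' ∧ s'.mem = s.mem := by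
  have hL := one_le_L (P := P)
  have hN := hB.N_lt_Q
  have hQ := Q_le (P := P)
  have hn := hB.n_pos
  have hnN := hB.n_le
  have hWN := hB.W_le
  have hnW := hB.nW_le
  refine .assign_seq hL (by decide) (by omega) (by simp) ?_
  refine .assign_seq hL (by decide) (by omega) (by simp [hP.N]; omega) ?_
  refine Run.seq (m := 3 * P.N + 3) ?_ (by omega)
  refine (sumProg_run hL 0 (by norm_num) (by simpa using hf) (by simp [hP.N]; omega)).mono
    (by simp [hP.N]) ?_
  rintro s₁ ⟨h42, hk, hm⟩
  simp only [State.setReg_reg, State.setReg_mem, Expr.val_reg] at h42 hm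
  norm_num [hP.N] at h42
  have hk1 : s.Keep 13 s₁ := (((State.Keep.refl _ _).setReg (by norm_num)).setReg
    (by norm_num)).trans (hk.mono (by norm_num))
  have hP1 : P.InRegs s₁ := hP.keep hk1
  have hmod : cellSum (s.mem 0) 0 P.N % (2 * P.n) % P.n < P.n := Nat.mod_lt _ hn
  have h42b : s₁.reg 42 ≤ P.N := h42 ▸ cellSum_le hf
  refine .assign_seq hL (by decide) (by omega) ?_ ?_
  · have := Nat.mod_lt (cellSum (s.mem 0) 0 P.N) hn
    simp [hP1.n, h42]; omega
  refine .assign_seq hL (by decide) (by omega) (by simp) ?_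
  refine .assign_seq hL (by decide) (by omega) (by simp) ?_
  -- The invariant fixes the outcome: reading the remaining bits from the present block, after the
  -- prefix found so far, always yields the whole side information.
  refine (Run.loop (n := P.r) (m := 3 * P.W + 10) (fun i t => t.reg 14 = i ∧ i ≤ P.r ∧
    P.readChain (s.mem 0) (P.r - i) (t.reg 13) (t.reg 18) = P.side (s.mem 0) ∧
    t.reg 18 < 2 ^ i ∧ t.reg 13 < P.n ∧ s.Keep 13 t ∧ t.mem = s.mem) hL (by decide) ?_ ?_).mono
    ?_ fun _ h => h
  · rintro i t ⟨h14, hi, hch, h18, h13, hkt, hmt⟩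
    have hPt : P.InRegs t := hP.keep hkt
    rcases eq_or_lt_of_le hi with rfl | hlt
    · refine Or.inl ⟨by simp [hPt.r, h14], ?_, h18, hkt, hmt⟩
      simpa [readChain] using hch
    refine Or.inr ⟨by simp [hPt.r, h14, hlt], hlt, ?_⟩
    have hgW : t.reg 13 * P.W ≤ P.N := (Nat.mul_le_mul_right _ h13.le).trans hnW
    refine .assign_seq hL (by decide) (by omega) (by simp [hPt.W]; omega) ?_
    refine .assign_seq hL (by decide) (by omega) (by simp [hPt.W]; omega) ?_
    refine Run.seq (m := 3 * P.W + 3) ?_ (by omega)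
    refine (sumProg_run hL 0 (by norm_num) (by simpa [hmt] using hf)
      (by simp [hPt.W]; omega)).mono (by simp [hPt.W]) ?_
    rintro u ⟨hu, hku, hmu⟩
    simp only [State.setReg_reg, State.setReg_mem, Expr.val_reg] at hu hmu
    norm_num [hPt.W, hmt] at hu
    have hku1 : t.Keep 20 u := (((State.Keep.refl _ _).setReg (by norm_num)).setReg
      (by norm_num)).trans (hku.mono (by norm_num))
    have hPu : P.InRegs u := hPt.keep hku1
    set x := cellSum (s.mem 0) (t.reg 13 * P.W) P.W % (2 * P.n) with hx
    have hx2 : x < 2 * P.n := Nat.mod_lt _ (by omega)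
    have hxd : x / P.n < 2 := Nat.div_lt_of_lt_mul (by omega)
    have hxm : x % P.n < P.n := Nat.mod_lt _ hn
    have hA : 2 * t.reg 18 + x / P.n < 2 ^ (i + 1) := by rw [pow_succ]; omega
    have hAL : 2 ^ (i + 1) ≤ 2 ^ P.L :=
      Nat.pow_le_pow_right (by norm_num) (by unfold r at hlt; unfold L; omega)
    have h18u := hku1 18 (by norm_num)
    have h14u := hku1 14 (by norm_num)
    refine .assign_seq hL (by decide) (by omega) (by simp [hPu.n, hu, ← hx]; omega) ?_
    refine .assign_seq hL (by decide) (by omega) (by simp [hPu.n, hu, ← hx, h18u]; omega) ?_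
    refine .assign_seq hL (by decide) (by omega) (by simp [hPu.n, hu, ← hx]; omega) ?_
    have hrL : P.r < 2 ^ P.L := by
      refine lt_of_le_of_lt ?_ (Nat.lt_two_pow_self (n := P.L))
      unfold r L; omega
    refine (Run.assign hL (by decide) (by simp [h14u, h14]; omega) ?_).mono (by omega) fun _ h => h
    refine ⟨by simp [h14u, h14], hlt, ?_, ?_, ?_, ?_, ?_⟩
    · rw [show P.r - i = (P.r - (i + 1)) + 1 by omega] at hch
      simp only [readChain, ← hx] at hch
      simpa [hPu.n, hu, ← hx, h18u] using hch
    · simpa [hPu.n, hu, ← hx, h18u] using hA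
    · simpa [hPu.n, hu, ← hx] using hxm
    · exact ((((hkt.trans (hku1.mono (by norm_num))).setReg (by norm_num)).setReg
        (by norm_num)).setReg (by norm_num)).setReg (by norm_num)
    · simp [hmu, hmt]
  · refine ⟨by simp, by omega, ?_, by simp, ?_, ?_, by simp [hm]⟩
    · simp [hP1.n, h42, side]
    · simpa [hP1.n, h42] using hmod
    · exact ((hk1.setReg (by norm_num)).setReg (by norm_num)).setReg (by norm_num)
  · have : P.r * (3 * P.W + 10 + 1) ≤ P.r * (3 * P.W + 20) := Nat.mul_le_mul_left _ (by omega)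
    omega

/-- The state of the decoder: the address `p` of the next block, the number `l` of message bits in it,
the number `pos` of message bits which are still to be found, and the cells of the output. -/
structure DecState where
  p : ℕ
  l : ℕ
  pos : ℕ
  out : ℕ → ℕ

/-- The decoder reads a block: the bits of the hash value of the block are the address of the next
block, the number of message bits in that block, and message bits. -/
def decStep (sd : ℕ) (f : ℕ → ℕ) (d : DecState) : DecState :=
  let h := P.hash sd (cellNum f d.p P.B)
  { p := h % P.N
    l := h / P.N % (P.B + 1)
    pos := d.pos - (d.l - (d.l - d.pos))
    out := setBits d.out (d.pos - (d.l - (d.l - d.pos))) (d.l - (d.l - d.pos))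
      (h / (P.N * (P.B + 1))) }

/-- The length of the message in the side information `S`. -/
def decLen (S : ℕ) : ℕ := if 0 < S % P.Q ∧ S % P.Q < P.M₀ then S % P.Q else 1

/-- The initial state of the decoder. -/
def decInit (S : ℕ) : DecState where
  p := S / P.Q / P.Q % P.Q
  l := S / P.Q % P.Q % (P.B + 1)
  pos := P.decLen S
  out := fun _ => 0

/-- The output cells of the decoder. -/
def decOut (f : ℕ → ℕ) : ℕ → ℕ :=
  ((P.decStep (P.side f / P.Q / P.Q / P.Q) f)^[P.N / P.B] (P.decInit (P.side f))).out

/-- Write the `reg 14` low order bits of register 43 to the cells of array 2 from `reg 15` on. -/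
def writeProg : Prog :=
  .assign 44 0 ;;
  .loop ((Expr.reg 44).lt (.reg 14))
    (.store 2 (.reg 15 + .reg 44) (.reg 43 % 2) ;; .assign 43 (.reg 43 / 2) ;;
      .assign 44 (.reg 44 + 1))

theorem writeProg_run {L : ℕ} {s : State} (hL : 1 ≤ L) (h43 : s.reg 43 < 2 ^ L)
    (h14 : s.reg 14 < 2 ^ L) :
    Run L writeProg s (4 * s.reg 14 + 2) fun s' =>
      s'.mem = Function.update s.mem 2 (setBits (s.mem 2) (s.reg 15) (s.reg 14) (s.reg 43)) ∧
        s.Keep 43 s' := by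
  have h1L : 2 ≤ 2 ^ L := by simpa using Nat.pow_le_pow_right (n := 2) (by norm_num) hL
  refine .assign_seq hL (by decide) (by omega) (by simp) ?_
  refine (Run.loop (n := s.reg 14) (m := 3) (fun i t => t.reg 44 = i ∧ i ≤ s.reg 14 ∧
    t.reg 43 = s.reg 43 / 2 ^ i ∧
    t.mem = Function.update s.mem 2 (setBits (s.mem 2) (s.reg 15) i (s.reg 43)) ∧
    s.Keep 43 t) hL (by decide) ?_ ?_).mono (by omega) fun _ h => h
  · rintro i t ⟨h44, hi, h43t, hm, hk⟩
    have k14 := hk 14 (by norm_num)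
    have k15 := hk 15 (by norm_num)
    rcases eq_or_lt_of_le hi with rfl | hlt
    · exact Or.inl ⟨by simp [k14, h44], hm, hk⟩
    refine Or.inr ⟨by simp [k14, h44, hlt], hlt, ?_⟩
    have hd : s.reg 43 / 2 ^ i < 2 ^ L := (Nat.div_le_self _ _).trans_lt h43
    refine Run.seq (m := 1) ?_ (by omega)
    refine Run.store hL (by decide) (by decide) (by simp; omega) ?_
    refine .assign_seq hL (by decide) (by omega) (by simp [h43t]; omega) ?_
    refine (Run.assign hL (by decide) (by simp [h44]; omega) ?_).mono (by omega) fun _ h => h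
    refine ⟨by simp [h44], hlt, ?_, ?_, ((hk.setMem).setReg (by norm_num)).setReg (by norm_num)⟩
    · simp [h43t, pow_succ, Nat.div_div_eq_div_mul]
    · simp [State.setMem_mem, hm, setBits_succ, h43t, k15, h44]
  · exact ⟨by simp, by omega, by simp, by simp,
      (State.Keep.refl _ _).setReg (by norm_num)⟩

/-- One step of the decoder, whose state is held by the registers 13, 14 and 15 and array 2. -/
def stepProg : Prog :=
  .assign 14 (.reg 14 - (.reg 14 - .reg 15)) ;; .assign 15 (.reg 15 - .reg 14) ;;
  .assign 40 (.reg 13) ;; hashProg ;; .assign 43 (.reg 42 / (.reg 1 * (.reg 4 + 1))) ;;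
  writeProg ;; .assign 13 (.reg 42 % .reg 1) ;; .assign 14 (.reg 42 / .reg 1 % (.reg 4 + 1)) ;;
  .assign 16 (.reg 16 + 1)

/-- The decoder has to keep its time on every vector, so `d` is only assumed to be in range, not to
lie on a chain written by the encoder. The bound `d.l ≤ P.B` keeps the writing within `O(B)`. -/
theorem stepProg_run {P : Par} {s : State} {sd : ℕ} {d : DecState} (hB : P.Basic)
    (hP : P.InRegs s) (hf : ∀ j, s.mem 0 j ≤ 1) (hs : P.HasSeed sd s) (h13 : s.reg 13 = d.p)
    (h14 : s.reg 14 = d.l) (h15 : s.reg 15 = d.pos) (h16 : s.reg 16 < P.N) (h2 : s.mem 2 = d.out)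
    (hp : d.p < P.Q) (hl : d.l ≤ P.B) (hpos : d.pos ≤ P.N) :
    Run P.L stepProg s (7 * P.B + 13) fun s' =>
      s'.reg 13 = (P.decStep sd (s.mem 0) d).p ∧ s'.reg 14 = (P.decStep sd (s.mem 0) d).l ∧
        s'.reg 15 = (P.decStep sd (s.mem 0) d).pos ∧ s'.reg 16 = s.reg 16 + 1 ∧
        s'.reg 17 = s.reg 17 ∧ s'.mem = Function.update s.mem 2 (P.decStep sd (s.mem 0) d).out ∧
        s.Keep 13 s' := by
  have hL := one_le_L (P := P)
  have hN := hB.N_lt_Q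
  have hQ := Q_le (P := P)
  have hBQ := B_lt_Q (P := P)
  have hQQ := Q_mul_Q_le (P := P)
  refine .assign_seq hL (by decide) (by omega) (by simp [h14, h15]; omega) ?_
  refine .assign_seq hL (by decide) (by omega) (by simp [h14, h15]; omega) ?_
  refine .assign_seq hL (by decide) (by omega) (by simp [h13]; omega) ?_
  refine Run.seq (m := 3 * P.B + 4) ?_ (by omega)
  refine (hash_run (sd := sd) (P := P) ?_ (by simpa using hf) ?_).mono le_rfl ?_
  · exact hP.keep (((((State.Keep.refl 13 _).setReg (by norm_num)).setReg (by norm_num)).setReg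
      (by norm_num)))
  · exact hs.keep (((((State.Keep.refl 13 _).setReg (by norm_num)).setReg (by norm_num)).setReg
      (by norm_num)))
  rintro u ⟨h42, hk, hm⟩
  have hku : s.Keep 13 u := ((((State.Keep.refl 13 _).setReg (by norm_num)).setReg
    (by norm_num)).setReg (by norm_num)).trans (hk.mono (by norm_num))
  have u14 := hk 14 (by norm_num)
  have u15 := hk 15 (by norm_num)
  have u16 := hk 16 (by norm_num)
  norm_num [h13, h14, h15] at h42 hm u14 u15 u16
  have hPu : P.InRegs u := hP.keep hku
  set h := P.hash sd (cellNum (s.mem 0) d.p P.B) with hh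
  have hhQ : h < P.Q * P.Q := P.hash_lt (cellNum_lt hf)
  have hdiv : ∀ x, h / x ≤ h := fun x => Nat.div_le_self _ _
  refine .assign_seq hL (by decide) (by omega) ?_ ?_
  · simp [h42]
    exact (hdiv _).trans_lt (by omega)
  refine Run.seq (m := 4 * P.B + 2) ?_ (by omega)
  refine (writeProg_run hL ?_ ?_).mono ?_ ?_
  · simp [h42]
    exact (hdiv _).trans_lt (by omega)
  · simp [u14]; omega
  · simp [u14]; omega
  rintro w ⟨hmw, hkw⟩
  have hkw' : u.Keep 43 w := ((State.Keep.refl _ _).setReg (by norm_num)).trans hkw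
  have w42 := hkw' 42 (by norm_num)
  have w15 := hkw' 15 (by norm_num)
  have w16 := hkw' 16 (by norm_num)
  have w17 := (hkw' 17 (by norm_num)).trans (hk 17 (by norm_num))
  have hPw : P.InRegs w := hPu.keep hkw'
  have hmod : h % P.N ≤ h := Nat.mod_le _ _
  have hmod' : h / P.N % (P.B + 1) ≤ h := (Nat.mod_le _ _).trans (hdiv _)
  refine .assign_seq hL (by decide) (by omega) (by simp [w42, h42, hPw.N]; omega) ?_
  refine .assign_seq hL (by decide) (by omega) (by simp [w42, h42, hPw.N, hPw.B]; omega) ?_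
  refine (Run.assign hL (by decide) (by simp [w16, u16]; omega) ?_).mono (by omega) fun _ h => h
  refine ⟨?_, ?_, ?_, ?_, ?_, ?_, ?_⟩
  · simp [w42, h42, hPw.N, decStep, ← hh]
  · simp [w42, h42, hPw.N, hPw.B, decStep, ← hh]
  · simp [w15, u15, decStep]
  · simp [w16, u16]
  · simpa using w17
  · simp [hmw, hm, u14, u15, h42, hPu.N, hPu.B, decStep, ← hh, h2]
  · exact (((hku.trans (hkw'.mono (by norm_num))).setReg (by norm_num)).setReg
      (by norm_num)).setReg (by norm_num)

/-- Load the hash function whose seed is in register 18. -/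
def seedProg : Prog :=
  .assign 12 (.reg 18 % .reg 5) ;; .assign 11 (.reg 18 / .reg 5 % .reg 5) ;;
  .assign 10 (.reg 18 / .reg 5 / .reg 5)

theorem seedProg_run {P : Par} {s : State} (hP : P.InRegs s) (h18 : s.reg 18 < 2 ^ P.L) :
    Run P.L seedProg s 3 fun s' => P.HasSeed (s.reg 18) s' ∧ s'.mem = s.mem ∧ s.Keep 10 s' ∧
      ∀ r, 13 ≤ r → s'.reg r = s.reg r := by
  have hL := one_le_L (P := P)
  have h1 : s.reg 18 % P.Q ≤ s.reg 18 := Nat.mod_le _ _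
  have h2 : s.reg 18 / P.Q % P.Q ≤ s.reg 18 := (Nat.mod_le _ _).trans (Nat.div_le_self _ _)
  have h3 : s.reg 18 / P.Q / P.Q ≤ s.reg 18 := (Nat.div_le_self _ _).trans (Nat.div_le_self _ _)
  refine .assign_seq hL (by decide) (by omega) (by simp [hP.Q]; omega) ?_
  refine .assign_seq hL (by decide) (by omega) (by simp [hP.Q]; omega) ?_
  refine (Run.assign hL (by decide) (by simp [hP.Q]; omega) ?_).mono (by omega) fun _ h => h
  refine ⟨⟨by simp [hP.Q], by simp [hP.Q], by simp [hP.Q]⟩, by simp, ?_, ?_⟩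
  · exact (((State.Keep.refl _ _).setReg (by norm_num)).setReg (by norm_num)).setReg (by norm_num)
  · intro r hr
    simp [show r ≠ 10 by omega, show r ≠ 11 by omega, show r ≠ 12 by omega]

/-- The decoder, after the computation of the parameters. -/
def decodeProg : Prog :=
  sideProg ;; .assign 2 (.reg 18 % .reg 5) ;;
  .assign 40 (Expr.lt 0 (.reg 2) * (Expr.reg 2).lt (.reg 9)) ;;
  .assign 2 (.reg 40 * .reg 2 + (1 - .reg 40)) ;;
  .assign 14 (.reg 18 / .reg 5 % .reg 5 % (.reg 4 + 1)) ;;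
  .assign 13 (.reg 18 / .reg 5 / .reg 5 % .reg 5) ;;
  .assign 18 (.reg 18 / .reg 5 / .reg 5 / .reg 5) ;; seedProg ;;
  .assign 15 (.reg 2) ;; .assign 16 0 ;; .assign 17 (.reg 1 / .reg 4) ;;
  .loop ((Expr.reg 16).lt (.reg 17)) stepProg

/-- Together with `decLen_pos` this puts the decoded string into some message set even if the vector
encodes nothing. The fallback length 1 in `decLen` is there for this purpose, and `1 < M₀` makes it
legitimate. -/
theorem decLen_le {P : Par} (hB : P.Basic) (S : ℕ) : P.decLen S < P.M₀ := by
  have := hB.M₀_gt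
  unfold decLen; split_ifs <;> omega

theorem decLen_pos {P : Par} (S : ℕ) : 0 < P.decLen S := by
  unfold decLen; split_ifs <;> omega

theorem decodeProg_run {P : Par} {s : State} (hB : P.Basic) (hP : P.InRegs s)
    (hf : ∀ j, s.mem 0 j ≤ 1) (h2 : s.mem 2 = fun _ => 0) :
    Run P.L decodeProg s (3 * P.N + 34 + P.r * (3 * P.W + 20) + P.N / P.B * (7 * P.B + 14))
      fun s' => s'.reg 2 = P.decLen (P.side (s.mem 0)) ∧ s'.mem 2 = P.decOut (s.mem 0) := by
  have hL := one_le_L (P := P)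
  have hN := hB.N_lt_Q
  have hQ := Q_le (P := P)
  have hBQ := B_lt_Q (P := P)
  have hQ0 := Q_pos (P := P)
  have hM := hB.M₀_lt
  refine Run.seq (m := 3 * P.N + 20 + P.r * (3 * P.W + 20)) ?_ (by omega)
  refine (sideProg_run hB hP hf).mono le_rfl ?_
  rintro t ⟨ht, htr, hkt, hmt⟩
  have hPt : P.InRegs t := hP.keep hkt
  set S := P.side (s.mem 0) with hS
  have hSL : S < 2 ^ P.L := by
    rw [← ht]
    exact htr.trans_le (Nat.pow_le_pow_right (by norm_num) (by unfold r L; omega))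
  have hlen := decLen_le hB S
  have hMlt : S % P.Q < P.Q := Nat.mod_lt _ hQ0
  have hl1 : S / P.Q % P.Q % (P.B + 1) < P.B + 1 := Nat.mod_lt _ (by omega)
  have hp1 : S / P.Q / P.Q % P.Q < P.Q := Nat.mod_lt _ hQ0
  have hS3 : S / P.Q / P.Q / P.Q ≤ S :=
    (Nat.div_le_self _ _).trans ((Nat.div_le_self _ _).trans (Nat.div_le_self _ _))
  -- The program makes this case distinction by arithmetic: the product of the two comparisons is
  -- the indicator of a valid length.
  have e2 : (if 0 < S % P.Q then 1 else 0) * (if S % P.Q < P.M₀ then 1 else 0) * (S % P.Q) +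
      (1 - (if 0 < S % P.Q then 1 else 0) * (if S % P.Q < P.M₀ then 1 else 0)) = P.decLen S := by
    unfold decLen
    by_cases a : 0 < S % P.Q <;> by_cases b : S % P.Q < P.M₀ <;> simp [a, b]
  refine .assign_seq hL (by decide) (by omega) (by simp [hPt.Q, ht]; omega) ?_
  refine .assign_seq hL (by decide) (by omega) ?_ ?_
  · simp only [Expr.val_mul, Expr.val_lt]
    split_ifs <;> (simp; try omega)
  refine .assign_seq hL (by decide) (by omega) ?_ ?_
  · simp [hPt.Q, hPt.M₀, ht, -mul_ite, -ite_mul]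
    rw [e2]; omega
  refine .assign_seq hL (by decide) (by omega) (by simp [hPt.Q, hPt.B, ht]; omega) ?_
  refine .assign_seq hL (by decide) (by omega) (by simp [hPt.Q, ht]; omega) ?_
  refine .assign_seq hL (by decide) (by omega) (by simp [hPt.Q, ht]; omega) ?_
  refine Run.seq (m := 3) ?_ (by omega)
  refine (seedProg_run (P := P) ?_ ?_).mono le_rfl ?_
  · exact (((((hPt.setReg (by norm_num)).setReg (by norm_num)).setReg (by norm_num)).setReg
      (by norm_num)).setReg (by norm_num)).setReg (by norm_num)
  · simp [hPt.Q, ht]; omega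
  rintro w ⟨hsd, hmw, hkw, hkw'⟩
  have w2 := hkw 2 (by norm_num)
  have w13 := hkw' 13 (by norm_num)
  have w14 := hkw' 14 (by norm_num)
  simp only [State.setReg_mem] at hmw
  simp [hPt.Q, hPt.M₀, hPt.B, ht, -mul_ite, -ite_mul] at w2 w13 w14 hsd
  rw [e2] at w2
  have hPw : P.InRegs w := by
    refine InRegs.keep ?_ hkw
    exact (((((hPt.setReg (by norm_num)).setReg (by norm_num)).setReg (by norm_num)).setReg
      (by norm_num)).setReg (by norm_num)).setReg (by norm_num)
  have hNB : P.N / P.B ≤ P.N := Nat.div_le_self _ _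
  have hNB0 : 0 ≤ P.N / P.B := Nat.zero_le _
  have hB0 : 0 < P.B := by
    by_contra h0
    have := hB.N_lt
    have := hB.M₀_gt
    simp [show P.B = 0 by omega] at *
    omega
  refine .assign_seq hL (by decide) (by omega) (by simp [w2]; omega) ?_
  refine .assign_seq hL (by decide) (by omega) (by simp) ?_
  refine .assign_seq hL (by decide) (by omega) (by simp [hPw.N, hPw.B]; omega) ?_
  set sd := S / P.Q / P.Q / P.Q with hsd'
  set D := fun i => (P.decStep sd (s.mem 0))^[i] (P.decInit S) with hD
  have hDs : ∀ i, D (i + 1) = P.decStep sd (s.mem 0) (D i) := fun i =>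
    Function.iterate_succ_apply' _ _ _
  refine (Run.loop (n := P.N / P.B) (m := 7 * P.B + 13) (fun i u => u.reg 16 = i ∧
    i ≤ P.N / P.B ∧ P.InRegs u ∧ P.HasSeed sd u ∧ u.reg 17 = P.N / P.B ∧
    u.reg 2 = P.decLen S ∧ u.reg 13 = (D i).p ∧ u.reg 14 = (D i).l ∧ u.reg 15 = (D i).pos ∧
    u.mem 2 = (D i).out ∧ u.mem 0 = s.mem 0 ∧ (D i).p < P.Q ∧ (D i).l ≤ P.B ∧ (D i).pos ≤ P.N)
    hL (by decide) ?_ ?_).mono ?_ fun _ h => h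
  · rintro i u ⟨h16, hi, hPu, hsu, h17, hu2, h13, h14, h15, hm2, hm0, hp, hl, hpos⟩
    rcases eq_or_lt_of_le hi with rfl | hlt
    · exact Or.inl ⟨by simp [h16, h17], hu2, by rw [hm2]; rfl⟩
    refine Or.inr ⟨by simp [h16, h17, hlt], hlt, ?_⟩
    refine (stepProg_run hB hPu (by simpa [hm0] using hf) hsu h13 h14 h15 (by omega) hm2 hp hl
      hpos).mono le_rfl ?_
    rintro x ⟨x13, x14, x15, x16, x17, hmx, hkx⟩
    rw [hm0, ← hDs] at x13 x14 x15
    refine ⟨by omega, hlt, hPu.keep hkx, hsu.keep hkx, ?_, ?_, x13, x14, x15, ?_, ?_, ?_, ?_, ?_⟩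
    · rw [x17, h17]
    · rw [hkx 2 (by norm_num), hu2]
    · simp [hmx, hDs, hm0]
    · simp [hmx, hm0]
    · rw [hDs]
      exact (Nat.mod_lt _ (by have := hB.M₀_gt; omega)).trans (by omega)
    · rw [hDs]
      exact Nat.le_of_lt_succ (Nat.mod_lt _ (by omega))
    · rw [hDs]
      exact (Nat.sub_le _ _).trans hpos
  · refine ⟨by simp, Nat.zero_le _, ((hPw.setReg (by norm_num)).setReg (by norm_num)).setReg
      (by norm_num), ?_, by simp [hPw.N, hPw.B], by simp [w2], by simp [w13, hD, decInit],
      by simp [w14, hD, decInit], by simp [w2, hD, decInit], by simp [hmw, hmt, h2, hD, decInit],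
      by simp [hmw, hmt], by simpa [hD, decInit] using hp1,
      by simpa [hD, decInit] using Nat.le_of_lt_succ hl1, by simp [hD, decInit]; omega⟩
    exact hsd.keep (b := 13) (((((State.Keep.refl _ _).setReg (by norm_num)).setReg
      (by norm_num)).setReg (by norm_num)))
  · rw [show 7 * P.B + 13 + 1 = 7 * P.B + 14 by ring]
    omega

end Par

/-! ### Adjusting weights, and the linked list of side information -/

theorem cellSum_update {f : ℕ → ℕ} {lo len j : ℕ} (x : ℕ) (h1 : lo ≤ j) (h2 : j < lo + len) :
    cellSum (Function.update f j x) lo len + f j = cellSum f lo len + x := by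
  obtain ⟨i, rfl⟩ := Nat.exists_eq_add_of_le h1
  have hi : i ∈ Finset.range len := by simp; omega
  unfold cellSum
  rw [← Finset.add_sum_erase _ _ hi, ← Finset.add_sum_erase (f := fun j => f (lo + j)) _ hi]
  have : ∑ x_1 ∈ (Finset.range len).erase i, Function.update f (lo + i) x (lo + x_1) =
      ∑ x ∈ (Finset.range len).erase i, f (lo + x) := by
    refine Finset.sum_congr rfl fun y hy => ?_
    rw [Function.update_of_ne]
    have := Finset.ne_of_mem_erase hy
    omega
  rw [this]
  simp; omega

/-- This is why `2n` free cells suffice to adjust a weight modulo `2n`. -/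
theorem exists_add_mod_eq (a : ℕ) {m t : ℕ} (ht : t < m) : ∃ c < m, (a + c) % m = t := by
  refine ⟨(t + (m - a % m)) % m, Nat.mod_lt _ (by omega), ?_⟩
  have h := Nat.mod_lt a (show 0 < m by omega)
  have h2 := Nat.div_add_mod a m
  rw [Nat.add_mod_mod, show a + (t + (m - a % m)) = t + m * (a / m + 1) by
    rw [mul_add]; omega, Nat.add_mul_mod_self_left, Nat.mod_eq_of_lt ht]

namespace Par

variable (P : Par)

/-- Clear the free cells among the `reg 6` cells from `reg 28` on. -/
def clearProg : Prog :=
  .assign 44 0 ;;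
  .loop ((Expr.reg 44).lt (.reg 6))
    (.branch (.load 1 (.reg 28 + .reg 44)) .skip (.store 0 (.reg 28 + .reg 44) 0) ;;
      .assign 44 (.reg 44 + 1))

/-- Set free cells among the `reg 6` cells from `reg 28` on, until the sum in register 42 is
congruent to `reg 45` modulo `2 * reg 7`. -/
def fillProg : Prog :=
  .assign 44 0 ;;
  .loop ((Expr.reg 44).lt (.reg 6))
    (.branch (.load 1 (.reg 28 + .reg 44)) .skip
      (.branch ((Expr.reg 42 % (2 * .reg 7)).eq (.reg 45)) .skip
        (.store 0 (.reg 28 + .reg 44) 1 ;; .assign 42 (.reg 42 + 1))) ;;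
      .assign 44 (.reg 44 + 1))

theorem clearProg_run {P : Par} {s : State} {lo : ℕ} (hB : P.Basic) (hP : P.InRegs s)
    (hlo : s.reg 28 = lo) (hf : ∀ j, s.mem 0 j ≤ 1) :
    Run P.L clearProg s (4 * P.W + 2) fun s' => ∃ f, s'.mem = Function.update s.mem 0 f ∧
      (∀ j, f j ≤ 1) ∧ (∀ j, j < lo ∨ lo + P.W ≤ j ∨ s.mem 1 j ≠ 0 → f j = s.mem 0 j) ∧
      (∀ j, lo ≤ j → j < lo + P.W → s.mem 1 j = 0 → f j = 0) ∧ s.Keep 44 s' := by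
  have hL := one_le_L (P := P)
  have hN := hB.N_lt_Q
  have hQ := Q_le (P := P)
  have hW := hB.W_le
  refine .assign_seq hL (by decide) (by omega) (by simp) ?_
  refine (Run.loop (n := P.W) (m := 3) (fun i t => t.reg 44 = i ∧ i ≤ P.W ∧ s.Keep 44 t ∧
    ∃ f, t.mem = Function.update s.mem 0 f ∧ (∀ j, f j ≤ 1) ∧
      (∀ j, j < lo ∨ lo + i ≤ j ∨ s.mem 1 j ≠ 0 → f j = s.mem 0 j) ∧
      (∀ j, lo ≤ j → j < lo + i → s.mem 1 j = 0 → f j = 0)) hL (by decide) ?_ ?_).mono (by omega)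
    fun _ h => h
  · rintro i t ⟨h44, hi, hk, f, hm, hf1, hout, hin⟩
    have k28 := hk 28 (by norm_num)
    have hPt : P.InRegs t := hP.keep hk
    rcases eq_or_lt_of_le hi with rfl | hlt
    · exact Or.inl ⟨by simp [h44, hPt.W], f, hm, hf1, hout, hin, hk⟩
    refine Or.inr ⟨by simp [h44, hPt.W, hlt], hlt, ?_⟩
    refine Run.seq (m := 2) ?_ (by omega)
    have hm1 : t.mem 1 = s.mem 1 := by simp [hm]
    refine Run.branch (n := 1) hL (by decide) (fun hc => ?_) (fun hc => ?_)
    · refine Run.skip hL ?_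
      simp [hm1, k28, hlo, h44] at hc
      refine Run.assign hL (by decide) (by simp [h44]; omega) ?_
      refine ⟨by simp [h44], hlt, hk.setReg (by norm_num), f, by simp [hm], hf1, ?_, ?_⟩
      · intro j hj
        rcases eq_or_ne j (lo + i) with rfl | hne
        · exact hout _ (Or.inr (Or.inl le_rfl))
        · exact hout j (by omega)
      · intro j h1 h2 h3
        rcases eq_or_ne j (lo + i) with rfl | hne
        · exact absurd h3 hc
        · exact hin j h1 (by omega) h3
    · refine Run.store hL (by decide) (by decide) (by simp) ?_
      simp [hm1, k28, hlo, h44] at hc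
      refine Run.assign hL (by decide) (by simp [h44]; omega) ?_
      refine ⟨by simp [h44], hlt, (hk.setMem).setReg (by norm_num),
        Function.update f (lo + i) 0, ?_, ?_, ?_, ?_⟩
      · simp [State.setMem_mem, hm, k28, hlo, h44]
      · intro j
        rcases eq_or_ne j (lo + i) with rfl | hne
        · simp
        · simpa [hne] using hf1 j
      · intro j hj
        rcases eq_or_ne j (lo + i) with rfl | hne
        · omega
        · simpa [hne] using hout j (by omega)
      · intro j h1 h2 h3
        rcases eq_or_ne j (lo + i) with rfl | hne
        · simp
        · simpa [hne] using hin j h1 (by omega) h3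
  · refine ⟨by simp, by omega, (State.Keep.refl _ _).setReg (by norm_num), s.mem 0, by simp, hf,
      fun _ _ => rfl, fun j h1 h2 => by omega⟩

/-- The interval from `a` on whose weight is adjusted only has to contain the block that is filled:
it is the block itself for a link of the list, and the whole vector for the anchor of the list. -/
theorem fillProg_run {P : Par} {s : State} {lo a len : ℕ} (hB : P.Basic) (hP : P.InRegs s)
    (hlo : s.reg 28 = lo) (hf : ∀ j, s.mem 0 j ≤ 1) (hF : ∀ j, s.mem 1 j ≤ 1)
    (hfree : cellSum (s.mem 1) lo P.W + 2 * P.n ≤ P.W) (h45 : s.reg 45 < 2 * P.n)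
    (h42 : s.reg 42 = cellSum (s.mem 0) a len) (hlen : len ≤ P.N)
    (ha : a ≤ lo) (hal : lo + P.W ≤ a + len)
    (hclear : ∀ j, lo ≤ j → j < lo + P.W → s.mem 1 j = 0 → s.mem 0 j = 0) :
    Run P.L fillProg s (6 * P.W + 2) fun s' => ∃ f, s'.mem = Function.update s.mem 0 f ∧
      (∀ j, f j ≤ 1) ∧ (∀ j, j < lo ∨ lo + P.W ≤ j ∨ s.mem 1 j ≠ 0 → f j = s.mem 0 j) ∧
      cellSum f a len % (2 * P.n) = s.reg 45 ∧ s.Keep 42 s' := by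
  have hL := one_le_L (P := P)
  have hN := hB.N_lt_Q
  have hQ := Q_le (P := P)
  have hW := hB.W_le
  have hn := hB.n_pos
  have hnN := hB.n_le
  set wt := s.reg 42 with hwt
  refine .assign_seq hL (by decide) (by omega) (by simp) ?_
  -- As long as the target residue is missed, all free cells passed have been set, and every
  -- increment up to their number has missed it. At the end of the block there are at least `2n` of
  -- them, which contradicts `exists_add_mod_eq`.
  refine (Run.loop (n := P.W) (m := 5) (fun i t => t.reg 44 = i ∧ i ≤ P.W ∧ s.Keep 42 t ∧
    t.reg 45 = s.reg 45 ∧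
    ∃ f, t.mem = Function.update s.mem 0 f ∧ (∀ j, f j ≤ 1) ∧
      (∀ j, j < lo ∨ lo + i ≤ j ∨ s.mem 1 j ≠ 0 → f j = s.mem 0 j) ∧
      t.reg 42 = cellSum f a len ∧ (t.reg 42 % (2 * P.n) = s.reg 45 ∨
        t.reg 42 + cellSum (s.mem 1) lo i = wt + i ∧
          ∀ c, c + cellSum (s.mem 1) lo i ≤ i → (wt + c) % (2 * P.n) ≠ s.reg 45)) hL (by decide)
    ?_ ?_).mono (by omega) fun _ h => h
  · rintro i t ⟨h44, hi, hk, ht45, f, hm, hf1, hout, ht42, hdone⟩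
    have k28 := hk 28 (by norm_num)
    have hPt : P.InRegs t := hP.keep hk
    rcases eq_or_lt_of_le hi with rfl | hlt
    · refine Or.inl ⟨by simp [h44, hPt.W], f, hm, hf1, hout, ?_, hk⟩
      rcases hdone with hd | ⟨_, hd⟩
      · rw [← ht42, hd]
      · obtain ⟨c, hc, he⟩ := exists_add_mod_eq wt h45
        exact absurd he (hd c (by omega))
    refine Or.inr ⟨by simp [h44, hPt.W, hlt], hlt, ?_⟩
    refine Run.seq (m := 4) ?_ (by omega)
    have hm1 : t.mem 1 = s.mem 1 := by simp [hm]
    have hcs := cellSum_succ (s.mem 1) lo i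
    refine Run.branch (n := 3) hL (by decide) (fun hc => ?_) (fun hc => ?_)
    · refine (Run.skip hL ?_).mono (by omega) fun _ h => h
      simp [hm1, k28, hlo, h44] at hc
      have hFi : s.mem 1 (lo + i) = 1 := by have := hF (lo + i); omega
      refine Run.assign hL (by decide) (by simp [h44]; omega) ?_
      refine ⟨by simp [h44], hlt, hk.setReg (by norm_num), by simp [ht45], f, by simp [hm], hf1,
        ?_, by simp [ht42], ?_⟩
      · intro j hj
        rcases eq_or_ne j (lo + i) with rfl | hne
        · exact hout _ (Or.inr (Or.inl le_rfl))
        · exact hout j (by omega)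
      · rcases hdone with hd | ⟨hd1, hd⟩
        · exact Or.inl (by simpa using hd)
        · refine Or.inr ⟨by simp; omega, fun c hc' => hd c (by omega)⟩
    · simp [hm1, k28, hlo, h44] at hc
      have hkeep : ∀ f' : ℕ → ℕ, (∀ j, j ≠ lo + i → f' j = f j) →
          ∀ j, j < lo ∨ lo + (i + 1) ≤ j ∨ s.mem 1 j ≠ 0 → f' j = s.mem 0 j := by
        intro f' hf' j hj
        rcases eq_or_ne j (lo + i) with rfl | hne
        · omega
        · rw [hf' j hne]; exact hout j (by omega)
      refine (Run.branch (n := 2) hL (by decide) (fun hc' => ?_) (fun hc' => ?_)).mono (by omega)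
        fun _ h => h
      · refine (Run.skip hL ?_).mono (by omega) fun _ h => h
        simp [hPt.n, ht45] at hc'
        refine Run.assign hL (by decide) (by simp [h44]; omega) ?_
        exact ⟨by simp [h44], hlt, hk.setReg (by norm_num), by simp [ht45], f, by simp [hm], hf1,
          hkeep f fun _ _ => rfl, by simp [ht42], Or.inl (by simpa using hc')⟩
      · simp [hPt.n, ht45] at hc'
        have h0 : f (lo + i) = 0 := by
          rw [hout _ (Or.inr (Or.inl le_rfl))]
          exact hclear _ (by omega) (by omega) hc
        have hup := cellSum_update (f := f) (lo := a) (len := len) (j := lo + i) 1 (by omega)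
          (by omega)
        have hle : cellSum f a len ≤ len := cellSum_le hf1
        refine Run.seq (m := 1) ?_ (by omega)
        refine Run.store hL (by decide) (by decide) (by simp; omega) ?_
        refine (Run.assign hL (by decide) (by simp [ht42]; omega) ?_).mono (by omega) fun _ h => h
        refine Run.assign hL (by decide) (by simp [h44]; omega) ?_
        refine ⟨by simp [h44], hlt, ((hk.setMem).setReg (by norm_num)).setReg (by norm_num),
          by simp [ht45], Function.update f (lo + i) 1, ?_, ?_, ?_, ?_, ?_⟩
        · simp [State.setMem_mem, hm, k28, hlo, h44]
        · intro j
          rcases eq_or_ne j (lo + i) with rfl | hne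
          · simp
          · simpa [hne] using hf1 j
        · exact hkeep _ fun j hj => by simp [hj]
        · simp [ht42]; omega
        · rcases hdone with hd | ⟨hd1, hd⟩
          · exact absurd hd hc'
          · by_cases hnew : (t.reg 42 + 1) % (2 * P.n) = s.reg 45
            · exact Or.inl (by simpa using hnew)
            · refine Or.inr ⟨by simp; omega, fun c hc' => ?_⟩
              rcases eq_or_lt_of_le hc' with h | h
              · rwa [show wt + c = t.reg 42 + 1 by omega]
              · exact hd c (by omega)
  · refine ⟨by simp, by omega, (State.Keep.refl _ _).setReg (by norm_num), by simp, s.mem 0,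
      by simp, hf, fun _ _ => rfl, by simp [← hwt, h42], ?_⟩
    by_cases h : wt % (2 * P.n) = s.reg 45
    · exact Or.inl (by simpa using h)
    · exact Or.inr ⟨by simp [cellSum, hwt], fun c hc => by
        simp [cellSum] at hc
        simpa [hc] using h⟩

end Par

theorem cellSum_add (f : ℕ → ℕ) (lo a b : ℕ) :
    cellSum f lo (a + b) = cellSum f lo a + cellSum f (lo + a) b := by
  simp only [cellSum, Finset.sum_range_add, add_assoc]

namespace Par

variable (P : Par)

/-- Write a digit of side information, and a pointer to the previous block with side information,
to the block from `reg 28` on; after the last digit write only the pointer. -/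
def placeProg : Prog :=
  clearProg ;;
  .branch ((Expr.reg 25).lt (.reg 8)) (.assign 40 (.reg 28) ;; .assign 41 (.reg 6))
    (.assign 40 0 ;; .assign 41 (.reg 1)) ;;
  sumProg 0 ;; .assign 45 (.reg 26 + .reg 7 * (.reg 27 % 2)) ;; fillProg ;;
  .assign 26 (.reg 24) ;; .assign 27 (.reg 27 / 2) ;; .assign 25 (.reg 25 + 1)

/-- For `reg 25 = r` the block is no link of the list. It corrects the weight of the whole vector,
the only pointer which can be read without knowing an address. -/
theorem placeProg_run {P : Par} {s : State} {lo : ℕ} (hB : P.Basic) (hP : P.InRegs s)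
    (hlo : s.reg 28 = lo) (hloN : lo + P.W ≤ P.N) (hf : ∀ j, s.mem 0 j ≤ 1)
    (hF : ∀ j, s.mem 1 j ≤ 1) (hfree : cellSum (s.mem 1) lo P.W + 2 * P.n ≤ P.W)
    (h25 : s.reg 25 ≤ P.r) (h26 : s.reg 26 < P.n) (h24 : s.reg 24 ≤ P.N)
    (h27 : s.reg 27 < 2 ^ P.L) :
    Run P.L placeProg s (10 * P.W + 3 * P.N + 20) fun s' => ∃ f,
      s'.mem = Function.update s.mem 0 f ∧ (∀ j, f j ≤ 1) ∧
      (∀ j, j < lo ∨ lo + P.W ≤ j ∨ s.mem 1 j ≠ 0 → f j = s.mem 0 j) ∧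
      (s.reg 25 < P.r →
        cellSum f lo P.W % (2 * P.n) = s.reg 26 + P.n * (s.reg 27 % 2)) ∧
      (s.reg 25 = P.r →
        cellSum f 0 P.N % (2 * P.n) = s.reg 26 + P.n * (s.reg 27 % 2)) ∧
      s'.reg 26 = s.reg 24 ∧ s'.reg 27 = s.reg 27 / 2 ∧ s'.reg 25 = s.reg 25 + 1 ∧
      s.Keep 25 s' := by
  have hL := one_le_L (P := P)
  have hN := hB.N_lt_Q
  have hQ := Q_le (P := P)
  have hW := hB.W_le
  have hn := hB.n_pos
  have hnN := hB.n_le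
  have hrL : P.r < 2 ^ P.L := by
    refine lt_of_le_of_lt ?_ (Nat.lt_two_pow_self (n := P.L))
    unfold r L; omega
  have hrL' : P.r + 1 < 2 ^ P.L := by
    refine lt_of_le_of_lt ?_ (Nat.lt_two_pow_self (n := P.L))
    unfold r L; omega
  refine Run.seq (m := 4 * P.W + 2) ?_ (by omega)
  refine (clearProg_run hB hP hlo hf).mono le_rfl ?_
  rintro t ⟨f, hm, hf1, hout, hin, hk⟩
  have hPt := hP.keep hk
  have k25 := hk 25 (by norm_num)
  have k28 := hk 28 (by norm_num)
  have hm0 : t.mem 0 = f := by simp [hm]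
  have hm1 : t.mem 1 = s.mem 1 := by simp [hm]
  obtain ⟨a, len, ha, hal, hlen, halen, hscope⟩ : ∃ a len, a ≤ lo ∧ lo + P.W ≤ a + len ∧
      len ≤ P.N ∧ a + len ≤ P.N ∧
      ((s.reg 25 < P.r ∧ a = lo ∧ len = P.W) ∨ (s.reg 25 = P.r ∧ a = 0 ∧ len = P.N)) := by
    rcases eq_or_lt_of_le h25 with h | h
    · exact ⟨0, P.N, by omega, by omega, le_rfl, by omega, Or.inr ⟨h, rfl, rfl⟩⟩
    · exact ⟨lo, P.W, le_rfl, le_rfl, by omega, by omega, Or.inl ⟨h, rfl, rfl⟩⟩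
  refine Run.seq (m := 3) ?_ (by omega)
  have hbr : ∀ u : State, u.reg 40 = a → u.reg 41 = len → u.mem = t.mem → t.Keep 40 u →
      Run P.L (sumProg 0 ;; .assign 45 (.reg 26 + .reg 7 * (.reg 27 % 2)) ;; fillProg ;;
        .assign 26 (.reg 24) ;; .assign 27 (.reg 27 / 2) ;; .assign 25 (.reg 25 + 1)) u
        (10 * P.W + 3 * P.N + 20 - (4 * P.W + 2) - 3) fun s' => ∃ f,
      s'.mem = Function.update s.mem 0 f ∧ (∀ j, f j ≤ 1) ∧
      (∀ j, j < lo ∨ lo + P.W ≤ j ∨ s.mem 1 j ≠ 0 → f j = s.mem 0 j) ∧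
      (s.reg 25 < P.r →
        cellSum f lo P.W % (2 * P.n) = s.reg 26 + P.n * (s.reg 27 % 2)) ∧
      (s.reg 25 = P.r →
        cellSum f 0 P.N % (2 * P.n) = s.reg 26 + P.n * (s.reg 27 % 2)) ∧
      s'.reg 26 = s.reg 24 ∧ s'.reg 27 = s.reg 27 / 2 ∧ s'.reg 25 = s.reg 25 + 1 ∧
      s.Keep 25 s' := by
    intro u u40 u41 hmu hku
    refine Run.seq (m := 3 * P.N + 3) ?_ (by omega)
    refine (sumProg_run hL 0 (by norm_num) (by simpa [hmu, hm0] using hf1) (by omega)).mono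
      (by omega) ?_
    rintro v ⟨v42, hkv, hmv⟩
    rw [u40, u41, hmu, hm0] at v42
    have hk' : s.Keep 40 v := ((hk.mono (by norm_num)).trans hku).trans (hkv.mono (by norm_num))
    have hPv := hP.keep hk'
    have v24 := hk' 24 (by norm_num)
    have v25 := hk' 25 (by norm_num)
    have v26 := hk' 26 (by norm_num)
    have v27 := hk' 27 (by norm_num)
    have v28 := hk' 28 (by norm_num)
    have hnb : P.n * (s.reg 27 % 2) ≤ P.n * 1 := Nat.mul_le_mul_left _ (by omega)
    refine .assign_seq hL (by decide) (by omega) (by simp [hPv.n, v26, v27]; omega) ?_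
    refine Run.seq (m := 6 * P.W + 2) ?_ (by omega)
    refine (fillProg_run (lo := lo) (a := a) (len := len) hB
      (hPv.setReg (by norm_num)) (by simp [v28, hlo]) (by simpa [hmv, hmu, hm0] using hf1)
      (by simpa [hmv, hmu, hm1] using hF) (by simpa [hmv, hmu, hm1] using hfree)
      (by simp [hPv.n, v26, v27]; omega) (by simp [v42, hmv, hmu, hm0]) hlen ha hal
      (by simpa [hmv, hmu, hm0, hm1] using hin)).mono le_rfl ?_
    rintro w ⟨g, hmw, hg1, hgout, hgsum, hkw⟩
    have hkw' : v.Keep 42 w := ((State.Keep.refl _ _).setReg (by norm_num)).trans hkw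
    have w24 := hkw' 24 (by norm_num)
    have w25 := hkw' 25 (by norm_num)
    have w27 := hkw' 27 (by norm_num)
    have hd : s.reg 27 / 2 ≤ s.reg 27 := Nat.div_le_self _ _
    simp [hPv.n, v26, v27, hmv, hmu, hm0, hm1] at hgsum hgout
    refine .assign_seq hL (by decide) (by omega) (by simp [w24, v24]; omega) ?_
    refine .assign_seq hL (by decide) (by omega) (by simp [w27, v27]; omega) ?_
    refine (Run.assign hL (by decide) (by simp [w25, v25]; omega) ?_).mono (by omega)
      fun _ h => h
    refine ⟨g, by simp [hmw, hmv, hmu, hm], hg1, ?_, ?_, ?_, by simp [w24, v24],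
      by simp [w27, v27], by simp [w25, v25], ?_⟩
    · intro j hj
      rw [hgout j hj, hout j hj]
    · intro h
      rcases hscope with ⟨_, rfl, rfl⟩ | ⟨h', _, _⟩
      · exact hgsum
      · omega
    · intro h
      rcases hscope with ⟨h', _, _⟩ | ⟨_, rfl, rfl⟩
      · omega
      · exact hgsum
    · exact ((((hk'.mono (by norm_num)).trans (hkw'.mono (by norm_num))).setReg
        (by norm_num)).setReg (by norm_num)).setReg (by norm_num)
  refine Run.branch (n := 2) hL (by decide) (fun hc => ?_) (fun hc => ?_)
  · simp [k25, hPt.r] at hc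
    rcases hscope with ⟨h', rfl, rfl⟩ | ⟨h', _, _⟩
    · refine .assign_seq hL (by decide) (by omega) (by simp [k28, hlo]; omega) ?_
      refine Run.assign hL (by decide) (by simp [hPt.W]; omega) ?_
      refine hbr _ (by simp [k28, hlo]) (by simp [hPt.W]) (by simp)
        (((State.Keep.refl _ _).setReg (by norm_num)).setReg (by norm_num))
    · omega
  · simp [k25, hPt.r] at hc
    rcases hscope with ⟨h', rfl, rfl⟩ | ⟨h', rfl, rfl⟩
    · omega
    · refine .assign_seq hL (by decide) (by omega) (by simp) ?_
      refine Run.assign hL (by decide) (by simp [hPt.N]; omega) ?_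
      refine hbr _ (by simp) (by simp [hPt.N]) (by simp)
        (((State.Keep.refl _ _).setReg (by norm_num)).setReg (by norm_num))

/-- A block with enough free cells for side information. -/
def Usable (F : ℕ → ℕ) (G : ℕ) : Prop := cellSum F (G * P.W) P.W + 2 * P.n ≤ P.W

instance (F : ℕ → ℕ) : DecidablePred (P.Usable F) := fun _ => inferInstanceAs (Decidable (_ ≤ _))

/-- `G` is the least number such that there are `r + 1` usable blocks before block `G`. -/
def IsStart (F : ℕ → ℕ) (G : ℕ) : Prop :=
  Nat.count (P.Usable F) G = P.r + 1 ∧ ∀ G' < G, Nat.count (P.Usable F) G' < P.r + 1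

/-- Side information is written twice, before and after the message. As usability depends on the
frozen positions only, both passes end at the same block. -/
theorem IsStart.unique {P : Par} {F : ℕ → ℕ} {G G' : ℕ} (h : P.IsStart F G)
    (h' : P.IsStart F G') : G = G' := by
  rcases lt_trichotomy G G' with hlt | h | hlt
  · have := h'.2 G hlt; have := h.1; omega
  · exact h
  · have := h.2 G' hlt; have := h'.1; omega

/-- Write the side information in register 27 to the first `r + 1` usable blocks; register 20
becomes the address after these blocks. -/
def encSideProg : Prog :=
  .assign 24 0 ;; .assign 25 0 ;; .assign 26 0 ;;
  .loop ((Expr.reg 25).lt (.reg 8 + 1))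
    (.assign 28 (.reg 24 * .reg 6) ;; .assign 40 (.reg 28) ;; .assign 41 (.reg 6) ;; sumProg 1 ;;
      .branch ((Expr.reg 42 + 2 * .reg 7).lt (.reg 6 + 1)) placeProg .skip ;;
      .assign 24 (.reg 24 + 1)) ;;
  .assign 20 (.reg 24 * .reg 6)

/-- An unusable block has fewer than `2n` free cells. Hence if only `r` blocks were usable, the `n *
W` cells would be covered by the frozen cells, `r * W` and `2 * n * n`, contrary to `hbud`. The same
count up to block `G` bounds the space lost before the message. -/
theorem encSideProg_run {P : Par} {s : State} (hB : P.Basic) (hP : P.InRegs s)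
    (hf : ∀ j, s.mem 0 j ≤ 1) (hF : ∀ j, s.mem 1 j ≤ 1)
    (hbud : cellSum (s.mem 1) 0 (P.n * P.W) + P.r * P.W + 2 * P.n * P.n < P.n * P.W)
    (hS : s.reg 27 < 2 ^ P.r) :
    Run P.L encSideProg s (P.n * (13 * P.W + 3 * P.N + 40) + 10) fun s' => ∃ f G,
      s'.mem = Function.update s.mem 0 f ∧ (∀ j, f j ≤ 1) ∧ P.IsStart (s.mem 1) G ∧ G ≤ P.n ∧
      s'.reg 20 = G * P.W ∧ (∀ j, G * P.W ≤ j ∨ s.mem 1 j ≠ 0 → f j = s.mem 0 j) ∧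
      G * P.W ≤ cellSum (s.mem 1) 0 (G * P.W) + (P.r + 1) * P.W + 2 * P.n * P.n ∧
      P.side f = s.reg 27 ∧ s.Keep 20 s' := by
  have hL := one_le_L (P := P)
  have hN := hB.N_lt_Q
  have hQ := Q_le (P := P)
  have hW := hB.W_le
  have hn := hB.n_pos
  have hnN := hB.n_le
  have hnW := hB.nW_le
  have hrL' : P.r + 1 < 2 ^ P.L := by
    refine lt_of_le_of_lt ?_ (Nat.lt_two_pow_self (n := P.L))
    unfold r L; omega
  have hSL : s.reg 27 < 2 ^ P.L :=
    hS.trans_le (Nat.pow_le_pow_right (by norm_num) (by unfold r L; omega))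
  set S := s.reg 27 with hSdef
  set F := s.mem 1 with hFdef
  refine .assign_seq hL (by decide) (by omega) (by simp) ?_
  refine .assign_seq hL (by decide) (by omega) (by simp) ?_
  refine .assign_seq hL (by decide) (by omega) (by simp) ?_
  refine Run.seq (m := P.n * (13 * P.W + 3 * P.N + 40) + 1) ?_ (by omega)
  -- The list grows from its tail: the low order bits are written first and read last. Its content
  -- is stated for all `f'` that agree on the blocks passed, because the later blocks are still to
  -- change. The initial pointer 0 is a dummy that is never followed.
  refine (Run.loop (n := P.n) (m := 13 * P.W + 3 * P.N + 39) (fun i t => t.reg 24 = i ∧ i ≤ P.n ∧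
    t.reg 25 = Nat.count (P.Usable F) i ∧ t.reg 25 ≤ P.r + 1 ∧
    t.reg 27 = S / 2 ^ t.reg 25 ∧ t.reg 26 < P.n ∧ s.Keep 24 t ∧
    (∀ G' < i, Nat.count (P.Usable F) G' < P.r + 1) ∧
    i * P.W ≤ cellSum F 0 (i * P.W) + t.reg 25 * P.W + 2 * P.n * i ∧
    ∃ f, t.mem = Function.update s.mem 0 f ∧ (∀ j, f j ≤ 1) ∧
      (∀ j, i * P.W ≤ j ∨ F j ≠ 0 → f j = s.mem 0 j) ∧
      (t.reg 25 ≤ P.r → ∀ f', (∀ j < i * P.W, f' j = f j) → ∀ A,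
        P.readChain f' (t.reg 25) (t.reg 26) A = A * 2 ^ t.reg 25 + S % 2 ^ t.reg 25) ∧
      (t.reg 25 = P.r + 1 → P.side f = S)) hL (by decide) ?_ ?_).mono le_rfl fun _ h => h
  · rintro i t ⟨h24, hi, h25, h25r, h27, h26, hk, hmin, hcov, f, hm, hf1, hout, hch, hside⟩
    have hPt : P.InRegs t := hP.keep hk
    rcases eq_or_lt_of_le h25r with heq | hlt
    · refine Or.inl ⟨by simp [hPt.r, heq], ?_⟩
      have hGW : i * P.W ≤ P.N := (Nat.mul_le_mul_right _ hi).trans hnW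
      refine (Run.assign hL (by decide) (by simp [h24, hPt.W]; omega) ?_).mono (by omega)
        fun _ h => h
      refine ⟨f, i, by simp [hm], hf1, ⟨by omega, hmin⟩, hi, by simp [h24, hPt.W], hout, ?_,
        hside heq, (hk.mono (by norm_num)).setReg (by norm_num)⟩
      rw [heq] at hcov
      have : 2 * P.n * i ≤ 2 * P.n * P.n := Nat.mul_le_mul_left _ hi
      omega
    have hin : i < P.n := by
      rcases eq_or_lt_of_le hi with rfl | h
      · have : t.reg 25 * P.W ≤ P.r * P.W := Nat.mul_le_mul_right _ (by omega)
        omega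
      · exact h
    refine Or.inr ⟨by simp [hPt.r]; omega, hin, ?_⟩
    have hiW : i * P.W + P.W ≤ P.N := by
      have : (i + 1) * P.W ≤ P.n * P.W := Nat.mul_le_mul_right _ hin
      rw [add_mul, one_mul] at this
      omega
    have hm1 : t.mem 1 = F := by simp [hm, hFdef]
    have hm0 : t.mem 0 = f := by simp [hm]
    refine .assign_seq hL (by decide) (by omega) (by simp [h24, hPt.W]; omega) ?_
    refine .assign_seq hL (by decide) (by omega) (by simp [h24, hPt.W]; omega) ?_
    refine .assign_seq hL (by decide) (by omega) (by simp [hPt.W]; omega) ?_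
    refine Run.seq (m := 3 * P.W + 3) ?_ (by omega)
    refine (sumProg_run hL 1 (by norm_num) (by simpa [hm1] using hF)
      (by simp [hPt.W]; omega)).mono (by simp [hPt.W]) ?_
    rintro u ⟨u42, hku, hmu⟩
    have u28 := hku 28 (by norm_num)
    simp [hPt.W, h24, hm1] at u42 hmu u28
    have hku' : t.Keep 28 u := ((((State.Keep.refl 28 _).setReg (by norm_num)).setReg
      (by norm_num)).setReg (by norm_num)).trans (hku.mono (by norm_num))
    have hPu : P.InRegs u := hPt.keep hku'
    have u24 := hku' 24 (by norm_num)
    have u25 := hku' 25 (by norm_num)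
    have u26 := hku' 26 (by norm_num)
    have u27 := hku' 27 (by norm_num)
    have hsum1 := cellSum_add F 0 (i * P.W) P.W
    rw [zero_add] at hsum1
    have hcount := Nat.count_succ (P.Usable F) i
    have hmin' : ∀ G' < i + 1, Nat.count (P.Usable F) G' < P.r + 1 := by
      intro G' hG'
      rcases Nat.lt_succ_iff_lt_or_eq.mp hG' with h | rfl
      · exact hmin G' h
      · omega
    refine Run.seq (m := 10 * P.W + 3 * P.N + 21) ?_ (by omega)
    refine Run.branch (n := 10 * P.W + 3 * P.N + 20) hL (by decide) (fun hc => ?_) (fun hc => ?_)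
    · have hus : P.Usable F i := by
        simp [u42, hPu.n, hPu.W] at hc
        unfold Usable; omega
      refine (placeProg_run (lo := i * P.W) hB hPu u28 (by omega) (by simpa [hmu, hm0] using hf1)
        (by simpa [hmu, hm1] using hF) (by have := hus; unfold Usable at this; simpa [hmu, hm1] using this)
        (by omega) (by omega)
        (by omega) ?_).mono le_rfl ?_
      · rw [u27, h27]
        exact (Nat.div_le_self _ _).trans_lt hSL
      rintro w ⟨g, hmw, hg1, hgout, hglt, hgeq, w26, w27, w25, hkw⟩
      rw [u25, u26, u27, h27] at *
      rw [if_pos hus] at hcount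
      have w24 := hkw 24 (by norm_num)
      simp only [hmu, hm0, hm1] at hgout
      have hgf : ∀ j < i * P.W, g j = f j := fun j hj => hgout j (Or.inl hj)
      have hbit : S / 2 ^ t.reg 25 % 2 < 2 := Nat.mod_lt _ (by norm_num)
      refine (Run.assign hL (by decide) (by simp [w24, u24, h24]; omega) ?_).mono (by omega)
        fun _ h => h
      refine ⟨by simp [w24, u24, h24], hin, by simp [w25]; omega, by simp [w25]; omega, ?_,
        by simp [w26, u24, h24, hin], ?_, hmin', ?_, g, by simp [hmw, hmu, hm], hg1, ?_, ?_, ?_⟩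
      · simp [w25, w27, pow_succ, Nat.div_div_eq_div_mul]
      · exact (((hk.trans (hku'.mono (by norm_num))).trans (hkw.mono (by norm_num))).setReg
          (by norm_num))
      · have e1 : (i + 1) * P.W = i * P.W + P.W := by ring
        simp only [State.setReg_reg, w25, if_neg (show (25 : ℕ) ≠ 24 by norm_num)]
        rw [e1, hsum1]
        have e2 : (t.reg 25 + 1) * P.W = t.reg 25 * P.W + P.W := by ring
        have e3 : 2 * P.n * (i + 1) = 2 * P.n * i + 2 * P.n := by ring
        omega
      · intro j hj
        have e1 : (i + 1) * P.W = i * P.W + P.W := by ring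
        rcases hj with hj | hj
        · rw [hgout j (by omega), hout j (by omega)]
        · rw [hgout j (Or.inr (Or.inr hj)), hout j (Or.inr hj)]
      · simp only [State.setReg_reg, w25, w26, u24, h24, if_neg (show (25 : ℕ) ≠ 24 by norm_num),
          if_neg (show (26 : ℕ) ≠ 24 by norm_num)]
        intro hr f' hf' A
        have hx : cellSum f' (i * P.W) P.W % (2 * P.n) =
            t.reg 26 + P.n * (S / 2 ^ t.reg 25 % 2) := by
          rw [← hglt (by omega)]
          congr 1
          exact cellSum_congr fun j _ h2 => hf' j (by rw [add_mul, one_mul]; exact h2)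
        simp only [readChain, hx]
        rw [Nat.add_mul_mod_self_left, Nat.mod_eq_of_lt h26, Nat.add_mul_div_left _ _ hn,
          Nat.div_eq_of_lt h26, zero_add, hch (by omega) f' fun j hj => by
            rw [hf' j (by rw [add_mul]; omega), hgf j hj]]
        have e4 := Nat.mod_pow_succ (b := 2) (k := t.reg 25) (x := S)
        rw [e4, pow_succ]
        ring
      · simp only [State.setReg_reg, w25, if_neg (show (25 : ℕ) ≠ 24 by norm_num)]
        intro hr
        have hr' : t.reg 25 = P.r := by omega
        -- All `r` bits are used up, so `S / 2 ^ r = 0` and the residue of the total weight is the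
        -- bare pointer to the last link.
        have hx := hgeq hr'
        rw [hr', Nat.div_eq_of_lt hS] at hx
        unfold side
        rw [hx]
        simp only [Nat.zero_mod, mul_zero, add_zero]
        rw [Nat.mod_eq_of_lt h26, ← hr', hch (by omega) g hgf, hr', Nat.mod_eq_of_lt hS]
        simp
    · have hus : ¬ P.Usable F i := by
        simp [u42, hPu.n, hPu.W] at hc
        unfold Usable; omega
      rw [if_neg hus] at hcount
      unfold Usable at hus
      refine (Run.skip hL ?_).mono (by omega) fun _ h => h
      refine (Run.assign hL (by decide) (by simp [u24, h24]; omega) ?_).mono (by omega)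
        fun _ h => h
      have e1 : (i + 1) * P.W = i * P.W + P.W := by ring
      refine ⟨by simp [u24, h24], hin, by simp [u25]; omega, by simp [u25]; omega,
        by simp [u27, h27, u25], by simp [u26, h26], ?_, hmin', ?_, f, by simp [hmu, hm], hf1,
        ?_, ?_, ?_⟩
      · exact ((hk.trans (hku'.mono (by norm_num))).setReg (by norm_num))
      · simp only [State.setReg_reg, u25, if_neg (show (25 : ℕ) ≠ 24 by norm_num)]
        rw [e1, hsum1]
        have e3 : 2 * P.n * (i + 1) = 2 * P.n * i + 2 * P.n := by ring
        omega
      · intro j hj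
        exact hout j (by omega)
      · simp only [State.setReg_reg, u25, u26, if_neg (show (25 : ℕ) ≠ 24 by norm_num),
          if_neg (show (26 : ℕ) ≠ 24 by norm_num)]
        intro hr f' hf' A
        exact hch hr f' (fun j hj => hf' j (by omega)) A
      · simpa [u25] using hside
  · refine ⟨by simp, by omega, by simp, by simp, by simp [hSdef], by simpa using hn, ?_, by simp,
      by simp, s.mem 0, by simp, hf, fun _ _ => rfl, by simp [readChain, Nat.mod_one], by simp⟩
    exact (((State.Keep.refl _ _).setReg (by norm_num)).setReg (by norm_num)).setReg (by norm_num)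

/-! ### Exhaustive search for a word with a prescribed hash value -/

/-- Overwrite the free cells of the block from `cur` on by binary digits of `x`. -/
def fillFree (F f : ℕ → ℕ) (cur x : ℕ) : ℕ → ℕ :=
  fun j => if (cur ≤ j ∧ j < cur + P.B) ∧ F j = 0 then x / 2 ^ (j - cur) % 2 else f j

/-- The hash value `h` consists of the address `p` of the next block, the number `l` of message bits
in that block, and the `len` message bits from `pos` on. -/
def Matches (m : ℕ → ℕ) (p l pos len h : ℕ) : Prop :=
  h % P.N = p ∧ h / P.N % (P.B + 1) = l ∧
    ∀ j < len, h / (P.N * (P.B + 1)) / 2 ^ j % 2 = m (pos + j)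

/-- Completeness of the search: an admissible content `g` of the block reappears when its own number
is tried. The digits at frozen positions are ignored, and there `g` agrees with the cells anyway. -/
theorem cellNum_fillFree {F f g : ℕ → ℕ} {cur : ℕ} (hg : ∀ j, g j ≤ 1)
    (hgf : ∀ j, F j ≠ 0 → g j = f j) :
    cellNum (P.fillFree F f cur (cellNum g cur P.B)) cur P.B = cellNum g cur P.B := by
  refine cellNum_congr fun j h1 h2 => ?_
  unfold fillFree
  split_ifs with h
  · rw [cellNum_bit hg (by omega)]
    congr 1; omega
  · have : F j ≠ 0 := fun h0 => h ⟨⟨h1, h2⟩, h0⟩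
    rw [hgf j this]

/-- Write the bits of register 23 to the free cells of the block from `reg 16` on. -/
def fillFreeProg : Prog :=
  .assign 43 (.reg 23) ;; .assign 44 0 ;;
  .loop ((Expr.reg 44).lt (.reg 4))
    (.branch (.load 1 (.reg 16 + .reg 44)) .skip (.store 0 (.reg 16 + .reg 44) (.reg 43 % 2)) ;;
      .assign 43 (.reg 43 / 2) ;; .assign 44 (.reg 44 + 1))

theorem fillFreeProg_run {P : Par} {s : State} (hP : P.InRegs s) (h23 : s.reg 23 < P.Q) :
    Run P.L fillFreeProg s (5 * P.B + 3) fun s' =>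
      s'.mem = Function.update s.mem 0 (P.fillFree (s.mem 1) (s.mem 0) (s.reg 16) (s.reg 23)) ∧
        s.Keep 43 s' := by
  have hL := one_le_L (P := P)
  have hQ := Q_le (P := P)
  have hBQ := B_lt_Q (P := P)
  refine .assign_seq hL (by decide) (by omega) (by simp; omega) ?_
  refine .assign_seq hL (by decide) (by omega) (by simp) ?_
  refine (Run.loop (n := P.B) (m := 4) (fun i t => t.reg 44 = i ∧ i ≤ P.B ∧
    t.reg 43 = s.reg 23 / 2 ^ i ∧ s.Keep 43 t ∧
    t.mem = Function.update s.mem 0 (fun j =>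
      if (s.reg 16 ≤ j ∧ j < s.reg 16 + i) ∧ s.mem 1 j = 0 then
        s.reg 23 / 2 ^ (j - s.reg 16) % 2 else s.mem 0 j)) hL (by decide) ?_ ?_).mono (by omega)
    fun _ h => h
  · rintro i t ⟨h44, hi, h43, hk, hm⟩
    have hPt : P.InRegs t := hP.keep hk
    have k16 := hk 16 (by norm_num)
    rcases eq_or_lt_of_le hi with rfl | hlt
    · exact Or.inl ⟨by simp [h44, hPt.B], hm, hk⟩
    refine Or.inr ⟨by simp [h44, hPt.B, hlt], hlt, ?_⟩
    have hm1 : t.mem 1 = s.mem 1 := by simp [hm]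
    have hd : s.reg 23 / 2 ^ i ≤ s.reg 23 := Nat.div_le_self _ _
    refine Run.seq (m := 2) ?_ (by omega)
    refine Run.branch (n := 1) hL (by decide) (fun hc => ?_) (fun hc => ?_)
    · simp [hm1, k16, h44] at hc
      refine Run.skip hL ?_
      refine .assign_seq hL (by decide) (by omega) (by simp [h43]; omega) ?_
      refine (Run.assign hL (by decide) (by simp [h44]; omega) ?_).mono (by omega) fun _ h => h
      refine ⟨by simp [h44], hlt, by simp [h43, pow_succ, Nat.div_div_eq_div_mul],
        (hk.setReg (by norm_num)).setReg (by norm_num), ?_⟩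
      simp only [State.setReg_mem, hm]
      congr 1
      funext j
      congr 1
      simp only [eq_iff_iff, and_congr_left_iff]
      intro h0
      have : j ≠ s.reg 16 + i := by rintro rfl; exact hc h0
      omega
    · simp [hm1, k16, h44] at hc
      refine Run.store hL (by decide) (by decide) (by simp [h43]; omega) ?_
      refine .assign_seq hL (by decide) (by omega) (by simp [h43]; omega) ?_
      refine (Run.assign hL (by decide) (by simp [h44]; omega) ?_).mono (by omega) fun _ h => h
      refine ⟨by simp [h44], hlt, by simp [h43, pow_succ, Nat.div_div_eq_div_mul],
        ((hk.setMem).setReg (by norm_num)).setReg (by norm_num), ?_⟩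
      simp only [State.setReg_mem, State.setMem_mem, hm]
      simp only [Function.update_self, Function.update_idem]
      congr 1
      funext j
      simp only [Expr.val_add, Expr.val_reg, Expr.val_mod, k16, h44, h43, Expr.val_ofNat]
      rcases eq_or_ne j (s.reg 16 + i) with rfl | hne
      · simp [hc]
      · rw [Function.update_of_ne hne]
        congr 1
        simp only [eq_iff_iff, and_congr_left_iff]
        intro h0
        omega
  · refine ⟨by simp, by omega, by simp,
      ((State.Keep.refl _ _).setReg (by norm_num)).setReg (by norm_num), ?_⟩
    simp only [State.setReg_mem]
    rw [Function.eq_update_iff]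
    refine ⟨?_, fun _ _ => rfl⟩
    funext j
    rw [if_neg (by omega)]

/-- Write a word to the free cells of a block and test its hash value: register 22 tells whether
it matches. -/
def tryProg : Prog :=
  fillFreeProg ;; .assign 40 (.reg 16) ;; hashProg ;;
  .assign 22 ((Expr.reg 42 % .reg 1).eq (.reg 13) *
    (Expr.reg 42 / .reg 1 % (.reg 4 + 1)).eq (.reg 14)) ;;
  .assign 43 (.reg 42 / (.reg 1 * (.reg 4 + 1))) ;; .assign 44 0 ;;
  .loop ((Expr.reg 44).lt (.reg 21))
    (.assign 22 (.reg 22 * (Expr.reg 43 % 2).eq (.load 2 (.reg 15 + .reg 44))) ;;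
      .assign 43 (.reg 43 / 2) ;; .assign 44 (.reg 44 + 1)) ;;
  .assign 23 (.reg 23 + 1)

open Classical in
theorem tryProg_run {P : Par} {s : State} {sd : ℕ} (hP : P.InRegs s) (hs : P.HasSeed sd s)
    (hf : ∀ j, s.mem 0 j ≤ 1) (h23 : s.reg 23 < P.Q) (h16 : s.reg 16 < P.Q)
    (h21 : s.reg 21 ≤ P.B) :
    Run P.L tryProg s (12 * P.B + 14) fun s' =>
      s'.mem = Function.update s.mem 0 (P.fillFree (s.mem 1) (s.mem 0) (s.reg 16) (s.reg 23)) ∧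
      s'.reg 22 = (if P.Matches (s.mem 2) (s.reg 13) (s.reg 14) (s.reg 15) (s.reg 21)
        (P.hash sd (cellNum (P.fillFree (s.mem 1) (s.mem 0) (s.reg 16) (s.reg 23)) (s.reg 16) P.B))
        then 1 else 0) ∧ s'.reg 23 = s.reg 23 + 1 ∧ s.Keep 22 s' := by
  have hL := one_le_L (P := P)
  have hQ := Q_le (P := P)
  have hBQ := B_lt_Q (P := P)
  have hQQ := Q_mul_Q_le (P := P)
  set g := P.fillFree (s.mem 1) (s.mem 0) (s.reg 16) (s.reg 23) with hg
  have hg1 : ∀ j, g j ≤ 1 := fun j => by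
    rw [hg]; unfold fillFree
    split_ifs
    · omega
    · exact hf j
  refine Run.seq (m := 5 * P.B + 3) ?_ (by omega)
  refine (fillFreeProg_run hP h23).mono le_rfl ?_
  rintro t ⟨hm, hk⟩
  rw [← hg] at hm
  have k16 := hk 16 (by norm_num)
  refine .assign_seq hL (by decide) (by omega) (by simp [k16]; omega) ?_
  refine Run.seq (m := 3 * P.B + 4) ?_ (by omega)
  refine (hash_run (sd := sd) (P := P) ((hP.keep hk).setReg (by norm_num))
    (by simpa [hm] using hg1) ((hs.keep hk).keep (b := 13)
      ((State.Keep.refl _ _).setReg (by norm_num)))).mono le_rfl ?_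
  rintro u ⟨u42, hku, hmu⟩
  simp [k16, hm] at u42 hmu
  have hku' : s.Keep 40 u := ((hk.mono (by norm_num)).setReg (by norm_num)).trans
    (hku.mono (by norm_num))
  set h := P.hash sd (cellNum g (s.reg 16) P.B) with hh
  have hhQ : h < P.Q * P.Q := P.hash_lt (cellNum_lt hg1)
  have hPu := hP.keep hku'
  have hh2 : h / (P.N * (P.B + 1)) ≤ h := Nat.div_le_self _ _
  refine .assign_seq hL (by decide) (by omega) ?_ ?_
  · simp only [Expr.val_mul, Expr.val_eq]
    split_ifs <;> (simp; try omega)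
  refine .assign_seq hL (by decide) (by omega) (by simp [u42, hPu.N, hPu.B]; omega) ?_
  refine .assign_seq hL (by decide) (by omega) (by simp) ?_
  refine Run.seq (m := 4 * P.B + 1) ?_ (by omega)
  have u13 := hku' 13 (by norm_num)
  have u14 := hku' 14 (by norm_num)
  have u23 := hku' 23 (by norm_num)
  refine (Run.loop (n := s.reg 21) (m := 3) (fun i w => w.reg 44 = i ∧ i ≤ s.reg 21 ∧
    w.reg 43 = h / (P.N * (P.B + 1)) / 2 ^ i ∧ w.reg 23 = s.reg 23 ∧ s.Keep 22 w ∧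
    w.mem = Function.update s.mem 0 g ∧
    w.reg 22 = if P.Matches (s.mem 2) (s.reg 13) (s.reg 14) (s.reg 15) i h then 1 else 0) hL
    (by decide) ?_ ?_).mono (by omega) fun _ h => h
  · rintro i w ⟨w44, hi, w43, w23, hkw, hmw, w22⟩
    have w21 := hkw 21 (by norm_num)
    have w15 := hkw 15 (by norm_num)
    rcases eq_or_lt_of_le hi with rfl | hlt
    · refine Or.inl ⟨by simp [w21, w44], ?_⟩
      refine (Run.assign hL (by decide) (by simp [w23]; omega) ?_).mono (by omega) fun _ h => h
      exact ⟨by simp [hmw], by simp [w22], by simp [w23], hkw.setReg (by norm_num)⟩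
    refine Or.inr ⟨by simp [w21, w44, hlt], hlt, ?_⟩
    have hd : h / (P.N * (P.B + 1)) / 2 ^ i ≤ h := (Nat.div_le_self _ _).trans hh2
    refine .assign_seq hL (by decide) (by omega) ?_ ?_
    · simp only [Expr.val_mul, Expr.val_eq, Expr.val_reg, w22]
      split_ifs <;> (simp; try omega)
    refine .assign_seq hL (by decide) (by omega) (by simp [w43]; omega) ?_
    refine (Run.assign hL (by decide) (by simp [w44]; omega) ?_).mono (by omega) fun _ h => h
    refine ⟨by simp [w44], hlt, by simp [w43, pow_succ, Nat.div_div_eq_div_mul, mul_assoc],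
      by simp [w23],
      ((hkw.setReg (by norm_num)).setReg (by norm_num)).setReg (by norm_num), by simp [hmw], ?_⟩
    have hiff : P.Matches (s.mem 2) (s.reg 13) (s.reg 14) (s.reg 15) (i + 1) h ↔
        P.Matches (s.mem 2) (s.reg 13) (s.reg 14) (s.reg 15) i h ∧
          h / (P.N * (P.B + 1)) / 2 ^ i % 2 = s.mem 2 (s.reg 15 + i) := by
      unfold Matches
      rw [and_assoc, and_assoc]
      refine and_congr_right fun _ => and_congr_right fun _ => ⟨fun H => ⟨fun j hj => H j
        (by omega), H i (by omega)⟩, fun H j hj => ?_⟩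
      rcases Nat.lt_succ_iff_lt_or_eq.mp hj with h | rfl
      · exact H.1 j h
      · exact H.2
    simp only [hiff]
    simp [w22, w43, hmw, w15, w44, ite_and]
    split_ifs <;> rfl
  · refine ⟨by simp, by omega, by simp [u42, hPu.N, hPu.B], by simp [u23], ?_, by simp [hmu],
      ?_⟩
    · exact (((hku'.mono (by norm_num)).setReg (by norm_num)).setReg (by norm_num)).setReg
        (by norm_num)
    · simp [Matches, u42, hPu.N, hPu.B, u13, u14, ite_and]
      split_ifs <;> rfl

/-- Search a word for the block from `reg 16` on, whose hash value matches. -/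
def findProg : Prog :=
  .assign 22 0 ;; .assign 23 0 ;;
  .loop ((1 - .reg 22) * (Expr.reg 23).lt (.reg 5)) tryProg

/-- The numbers below `Q = 4 * 2 ^ B` include every word of `B` bits. Failure is reported rather
than excluded, since a match need not exist for the seed under test. -/
theorem findProg_run {P : Par} {s : State} {sd : ℕ} (hP : P.InRegs s) (hs : P.HasSeed sd s)
    (hf : ∀ j, s.mem 0 j ≤ 1) (h16 : s.reg 16 < P.Q) (h21 : s.reg 21 ≤ P.B) :
    Run P.L findProg s (P.Q * (12 * P.B + 15) + 3) fun s' => ∃ g,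
      s'.mem = Function.update s.mem 0 g ∧ (∀ j, g j ≤ 1) ∧
      (∀ j, j < s.reg 16 ∨ s.reg 16 + P.B ≤ j ∨ s.mem 1 j ≠ 0 → g j = s.mem 0 j) ∧
      s'.reg 22 ≤ 1 ∧
      (s'.reg 22 = 1 → P.Matches (s.mem 2) (s.reg 13) (s.reg 14) (s.reg 15) (s.reg 21)
        (P.hash sd (cellNum g (s.reg 16) P.B))) ∧
      ((∃ g' : ℕ → ℕ, (∀ j, g' j ≤ 1) ∧ (∀ j, s.mem 1 j ≠ 0 → g' j = s.mem 0 j) ∧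
        P.Matches (s.mem 2) (s.reg 13) (s.reg 14) (s.reg 15) (s.reg 21)
          (P.hash sd (cellNum g' (s.reg 16) P.B))) → s'.reg 22 = 1) ∧ s.Keep 22 s' := by
  have hL := one_le_L (P := P)
  have hQ := Q_le (P := P)
  have hBQ := B_lt_Q (P := P)
  refine .assign_seq hL (by decide) (by omega) (by simp) ?_
  refine .assign_seq hL (by decide) (by omega) (by simp) ?_
  refine (Run.loop (n := P.Q) (m := 12 * P.B + 14) (fun i t => t.reg 23 = i ∧ i ≤ P.Q ∧
    s.Keep 22 t ∧ ∃ g, t.mem = Function.update s.mem 0 g ∧ (∀ j, g j ≤ 1) ∧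
      (∀ j, j < s.reg 16 ∨ s.reg 16 + P.B ≤ j ∨ s.mem 1 j ≠ 0 → g j = s.mem 0 j) ∧
      t.reg 22 ≤ 1 ∧
      (t.reg 22 = 1 → P.Matches (s.mem 2) (s.reg 13) (s.reg 14) (s.reg 15) (s.reg 21)
        (P.hash sd (cellNum g (s.reg 16) P.B))) ∧
      (t.reg 22 = 0 → ∀ x < i, ¬ P.Matches (s.mem 2) (s.reg 13) (s.reg 14) (s.reg 15) (s.reg 21)
        (P.hash sd (cellNum (P.fillFree (s.mem 1) (s.mem 0) (s.reg 16) x) (s.reg 16) P.B)))) hL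
    (by decide) ?_ ?_).mono (show P.Q * (12 * P.B + 15) + 1 ≤ _ by omega) fun _ h => h
  · rintro i t ⟨h23, hi, hk, g, hm, hg1, hgout, h22, hyes, hno⟩
    have hPt : P.InRegs t := hP.keep hk
    by_cases hdone : t.reg 22 = 1 ∨ i = P.Q
    · refine Or.inl ⟨?_, g, hm, hg1, hgout, h22, hyes, ?_, hk⟩
      · rcases hdone with h | h
        · simp [h]
        · simp [hPt.Q, h23, h]
      · rintro ⟨g', hg'1, hg'f, hmat⟩
        rcases hdone with h | h
        · exact h
        · by_contra hne
          refine hno (by omega) (cellNum g' (s.reg 16) P.B) ?_ ?_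
          · rw [h, ← four_two_pow]
            have := cellNum_lt (lo := s.reg 16) (len := P.B) hg'1
            omega
          · rwa [cellNum_fillFree P hg'1 hg'f]
    push Not at hdone
    have h0 : t.reg 22 = 0 := by omega
    have hlt : i < P.Q := by omega
    refine Or.inr ⟨by simp [h0, hPt.Q, h23, hlt], hlt, ?_⟩
    have k13 := hk 13 (by norm_num)
    have k14 := hk 14 (by norm_num)
    have k15 := hk 15 (by norm_num)
    have k16 := hk 16 (by norm_num)
    have k21 := hk 21 (by norm_num)
    refine (tryProg_run hPt (hs.keep hk) (by simpa [hm] using hg1) (by omega) (by omega)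
      (by omega)).mono le_rfl ?_
    rintro u ⟨hmu, u22, u23, hku⟩
    have hff : P.fillFree (t.mem 1) (t.mem 0) (t.reg 16) (t.reg 23) =
        P.fillFree (s.mem 1) (s.mem 0) (s.reg 16) i := by
      funext j
      simp only [fillFree, hm, k16, h23, Function.update_self, Function.update_of_ne one_ne_zero]
      split_ifs with h
      · rfl
      · exact hgout j (by omega)
    rw [hff] at hmu u22
    have ht2 : t.mem 2 = s.mem 2 := by simp [hm]
    rw [k13, k14, k15, k16, k21, ht2] at u22
    refine ⟨by omega, hlt, hk.trans hku, _, by rw [hmu, hm, Function.update_idem], ?_, ?_, ?_, ?_,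
      ?_⟩
    · intro j
      unfold fillFree
      split_ifs
      · omega
      · exact hf j
    · intro j hj
      unfold fillFree
      rw [if_neg (by omega)]
    · rw [u22]; split_ifs <;> omega
    · intro h
      by_contra hne
      rw [u22, if_neg hne] at h
      omega
    · intro h x hx
      rcases Nat.lt_succ_iff_lt_or_eq.mp hx with hx | rfl
      · exact hno h0 x hx
      · intro hmat
        rw [u22, if_pos hmat] at h
        omega
  · exact ⟨by simp, by omega, ((State.Keep.refl _ _).setReg (by norm_num)).setReg (by norm_num),
      s.mem 0, by simp, hf, fun _ _ => rfl, by simp, by simp, by simp⟩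

/-! ### The chain of message blocks and the search for a seed -/

/-- The state of the encoder: the number `pos` of message bits which are already written, the address
`p` of the last block used, and the number `l` of message bits in it. -/
structure EncState where
  pos : ℕ
  p : ℕ
  l : ℕ

/-- The number of message bits written to the block from `cur` on. -/
def newLen (F : ℕ → ℕ) (M cur pos : ℕ) : ℕ := min (P.B - cellSum F cur P.B - P.E) (M - pos)

/-- The state of the encoder after `i` blocks. -/
def scan (F : ℕ → ℕ) (z M : ℕ) : ℕ → EncState
  | 0 => ⟨0, 0, 0⟩
  | i + 1 =>
    let e := scan F z M i
    let u := P.newLen F M (z + i * P.B) e.pos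
    if u = 0 then e else ⟨e.pos + u, z + i * P.B, u⟩

/-- The cells `g` hold, in the `i` blocks from `z` on, a chain of blocks from which the decoder reads
the message `m`. -/
def Readable (m : ℕ → ℕ) (sd z i : ℕ) (e : EncState) (g : ℕ → ℕ) : Prop :=
  ∀ f : ℕ → ℕ, (∀ j, z ≤ j → j < z + i * P.B → f j = g j) → ∀ t, i ≤ t → ∀ out : ℕ → ℕ, ∀ j,
    ((P.decStep sd f)^[t] ⟨e.p, e.l, e.pos, out⟩).out j = if j < e.pos then m j else out j

/-- The hash function with seed `sd` allows to write the message `m` to all of the `nb` blocks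
from `z` on, if the frozen cells hold the values `v`. -/
def GoodSeed (F v m : ℕ → ℕ) (z M nb sd : ℕ) : Prop :=
  ∀ i < nb, P.newLen F M (z + i * P.B) (P.scan F z M i).pos ≠ 0 → ∃ g : ℕ → ℕ, (∀ j, g j ≤ 1) ∧
    (∀ j, F j ≠ 0 → g j = v j) ∧ P.Matches m (P.scan F z M i).p (P.scan F z M i).l
      (P.scan F z M i).pos (P.newLen F M (z + i * P.B) (P.scan F z M i).pos)
      (P.hash sd (cellNum g (z + i * P.B) P.B))

/-- The decoder does not know how many blocks were used and always makes `N / B` steps; surplus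
steps do no harm. -/
theorem decStep_of_pos_zero (sd : ℕ) (f : ℕ → ℕ) (t : ℕ) (d : DecState) (hd : d.pos = 0) :
    ((P.decStep sd f)^[t] d).out = d.out := by
  induction t generalizing d with
  | zero => rfl
  | succ t ih =>
    rw [Function.iterate_succ_apply, ih _ (by simp [decStep, hd])]
    simp [decStep, hd]

theorem readable_zero (m : ℕ → ℕ) (sd z : ℕ) (g : ℕ → ℕ) : P.Readable m sd z 0 ⟨0, 0, 0⟩ g := by
  intro f _ t _ out j
  rw [decStep_of_pos_zero _ _ _ _ _ rfl]
  simp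

/-- The decoder undoes the encoder's last block first: one step at the new block yields its `u` bits
and arrives at the state `e`. There the hypothesis takes over, with the partly written output as
`out`; this is why `Readable` quantifies over `out`. -/
theorem Readable.step {P : Par} {m : ℕ → ℕ} {sd z i u : ℕ} {e : EncState} {g g' : ℕ → ℕ}
    (h : P.Readable m sd z i e g) (hg : ∀ j, j < z + i * P.B → g' j = g j)
    (hm : P.Matches m e.p e.l e.pos u (P.hash sd (cellNum g' (z + i * P.B) P.B))) :
    P.Readable m sd z (i + 1) ⟨e.pos + u, z + i * P.B, u⟩ g' := by
  intro f hf t ht out j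
  obtain ⟨t, rfl⟩ : ∃ t', t = t' + 1 := ⟨t - 1, by omega⟩
  have hB : (i + 1) * P.B = i * P.B + P.B := by ring
  have hnum : cellNum f (z + i * P.B) P.B = cellNum g' (z + i * P.B) P.B :=
    cellNum_congr fun j h1 h2 => hf j (by omega) (by omega)
  obtain ⟨h1, h2, h3⟩ := hm
  have hsub : u - (u - (e.pos + u)) = u := by omega
  rw [Function.iterate_succ_apply]
  have hstep : P.decStep sd f ⟨z + i * P.B, u, e.pos + u, out⟩ = ⟨e.p, e.l, e.pos,
      setBits out e.pos u
        (P.hash sd (cellNum g' (z + i * P.B) P.B) / (P.N * (P.B + 1)))⟩ := by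
    simp only [decStep, hnum, h1, h2, hsub, Nat.add_sub_cancel]
  rw [hstep, h f (fun j hj1 hj2 => by rw [hf j hj1 (by omega), hg j hj2]) t (by omega)]
  simp only [setBits]
  by_cases hj : j < e.pos
  · simp [hj, show j < e.pos + u by omega]
  · by_cases hj2 : j < e.pos + u
    · rw [if_neg hj, if_pos ⟨by omega, hj2⟩, if_pos hj2, h3 _ (by omega)]
      congr 1; omega
    · simp [hj, hj2]

theorem Readable.skip {P : Par} {m : ℕ → ℕ} {sd z i : ℕ} {e : EncState} {g : ℕ → ℕ}
    (h : P.Readable m sd z i e g) : P.Readable m sd z (i + 1) e g := by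
  intro f hf t ht
  have hB : (i + 1) * P.B = i * P.B + P.B := by ring
  exact h f (fun j hj1 hj2 => hf j hj1 (by omega)) t (by omega)

/-- Write the message to the blocks from `reg 16` on. -/
def blocksProg : Prog :=
  .loop ((Expr.reg 16 + .reg 4).lt (.reg 1 + 1))
    (.assign 40 (.reg 16) ;; .assign 41 (.reg 4) ;; sumProg 1 ;;
      .assign 21 (.reg 4 - .reg 42 - .reg 3) ;; .assign 40 (.reg 2 - .reg 15) ;;
      .assign 21 (.reg 21 - (.reg 21 - .reg 40)) ;;
      .branch (.reg 21)
        (findProg ;; .assign 19 (.reg 19 * .reg 22) ;; .assign 15 (.reg 15 + .reg 21) ;;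
          .assign 13 (.reg 16) ;; .assign 14 (.reg 21)) .skip ;;
      .assign 16 (.reg 16 + .reg 4))

theorem scan_pos_le (F : ℕ → ℕ) (z M i : ℕ) : (P.scan F z M i).pos ≤ M := by
  induction i with
  | zero => simp [scan]
  | succ i ih =>
    simp only [scan]
    split_ifs with h
    · exact ih
    · simp only [newLen]; omega

theorem scan_l_le (F : ℕ → ℕ) (z M i : ℕ) : (P.scan F z M i).l ≤ P.B := by
  induction i with
  | zero => simp [scan]
  | succ i ih =>
    simp only [scan]
    split_ifs with h
    · exact ih
    · simp only [newLen]; omega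

theorem scan_p_lt {P : Par} (hN : 0 < P.N) (hB : 0 < P.B) {F : ℕ → ℕ} {z M nb i : ℕ}
    (hnb : ∀ i, i < nb ↔ z + i * P.B + P.B ≤ P.N) (hi : i ≤ nb) : (P.scan F z M i).p < P.N := by
  induction i with
  | zero => simpa [scan] using hN
  | succ i ih =>
    simp only [scan]
    split_ifs with h
    · exact ih (by omega)
    · have := (hnb i).mp (by omega)
      show z + i * P.B < P.N
      omega

/-- A failed block does not end the pass; register 19 merely records it. As `scan` does not look at
hash values, registers 13 and 14 end with the same values in any case. `GoodSeed` refers to the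
values of frozen cells only, so it excludes failure whatever the free cells held before. -/
theorem blocksProg_run {P : Par} {s : State} {sd z M nb : ℕ} (hB : P.Basic) (hP : P.InRegs s)
    (hs : P.HasSeed sd s) (hf : ∀ j, s.mem 0 j ≤ 1) (hF : ∀ j, s.mem 1 j ≤ 1)
    (hnb : ∀ i, i < nb ↔ z + i * P.B + P.B ≤ P.N) (hz : z ≤ P.N) (hM : M ≤ P.N)
    (h2 : s.reg 2 = M) (h13 : s.reg 13 = 0) (h14 : s.reg 14 = 0) (h15 : s.reg 15 = 0)
    (h16 : s.reg 16 = z) (h19 : s.reg 19 = 1) :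
    Run P.L blocksProg s (nb * (P.Q * (12 * P.B + 15) + 3 * P.B + 25) + 1) fun s' => ∃ g,
      s'.mem = Function.update s.mem 0 g ∧ (∀ j, g j ≤ 1) ∧
      (∀ j, P.N ≤ j ∨ s.mem 1 j ≠ 0 → g j = s.mem 0 j) ∧
      s'.reg 13 = (P.scan (s.mem 1) z M nb).p ∧ s'.reg 14 = (P.scan (s.mem 1) z M nb).l ∧
      s'.reg 19 ≤ 1 ∧
      (s'.reg 19 = 1 → P.Readable (s.mem 2) sd z nb (P.scan (s.mem 1) z M nb) g) ∧
      (P.GoodSeed (s.mem 1) (s.mem 0) (s.mem 2) z M nb sd → s'.reg 19 = 1) ∧ s.Keep 13 s' ∧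
      s'.reg 18 = s.reg 18 ∧ s'.reg 20 = s.reg 20 := by
  have hL := one_le_L (P := P)
  have hQ := Q_le (P := P)
  have hBQ := B_lt_Q (P := P)
  have hN := hB.N_lt_Q
  set F := s.mem 1 with hFd
  set m := s.mem 2 with hmd
  refine (Run.loop (n := nb) (m := P.Q * (12 * P.B + 15) + 3 * P.B + 24) (fun i t =>
    i ≤ nb ∧ t.reg 16 = z + i * P.B ∧ s.Keep 13 t ∧ t.reg 18 = s.reg 18 ∧ t.reg 20 = s.reg 20 ∧
    t.reg 13 = (P.scan F z M i).p ∧ t.reg 14 = (P.scan F z M i).l ∧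
    t.reg 15 = (P.scan F z M i).pos ∧ t.reg 19 ≤ 1 ∧ z + i * P.B ≤ P.N ∧
    ∃ g, t.mem = Function.update s.mem 0 g ∧ (∀ j, g j ≤ 1) ∧
      (∀ j, P.N ≤ j ∨ F j ≠ 0 → g j = s.mem 0 j) ∧
      (t.reg 19 = 1 → P.Readable m sd z i (P.scan F z M i) g) ∧
      (P.GoodSeed F (s.mem 0) m z M nb sd → t.reg 19 = 1)) hL (by decide) ?_ ?_).mono le_rfl
    fun _ h => h
  · rintro i t ⟨hi, t16, hk, t18, t20, t13, t14, t15, t19, hziB, g, hm, hg1, hgF, hread, hgood⟩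
    have hPt : P.InRegs t := hP.keep hk
    have k2 := hk 2 (by norm_num)
    by_cases hlt : i < nb
    · have hcur := (hnb i).mp hlt
      refine Or.inr ⟨by simp [hPt.N, hPt.B, t16]; omega, hlt, ?_⟩
      have hm1 : t.mem 1 = F := by simp [hm, hFd]
      have hm0 : t.mem 0 = g := by simp [hm]
      have hm2 : t.mem 2 = m := by simp [hm, hmd]
      set e := P.scan F z M i with he
      have hepos : e.pos ≤ M := P.scan_pos_le F z M i
      have hel : e.l ≤ P.B := P.scan_l_le F z M i
      set u := P.newLen F M (z + i * P.B) e.pos with hu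
      have huB : u ≤ P.B := by rw [hu]; unfold newLen; omega
      have huM : e.pos + u ≤ M := by rw [hu]; unfold newLen; omega
      refine .assign_seq hL (by decide) (by omega) (by simp [t16]; omega) ?_
      refine .assign_seq hL (by decide) (by omega) (by simp [hPt.B]; omega) ?_
      refine Run.seq (m := 3 * P.B + 3) ?_ (by omega)
      refine (sumProg_run hL 1 (by norm_num) (by simpa [hm1] using hF)
        (by simp [hPt.B]; omega)).mono (by simp [hPt.B]) ?_
      rintro a ⟨a42, hka, hma⟩
      simp [hPt.B, t16, hm1] at a42 hma
      have hka' : t.Keep 40 a := (((State.Keep.refl 40 _).setReg (by norm_num)).setReg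
        (by norm_num)).trans (hka.mono (by norm_num))
      have hPa := hPt.keep hka'
      have a2 := hka' 2 (by norm_num)
      have a13 := hka' 13 (by norm_num)
      have a14 := hka' 14 (by norm_num)
      have a15 := hka' 15 (by norm_num)
      have a16 := hka' 16 (by norm_num)
      have a18 := hka' 18 (by norm_num)
      have a19 := hka' 19 (by norm_num)
      have a20 := hka' 20 (by norm_num)
      refine .assign_seq hL (by decide) (by omega) (by simp [hPa.B]; omega) ?_
      refine .assign_seq hL (by decide) (by omega) (by simp [a2, k2, h2]; omega) ?_
      refine .assign_seq hL (by decide) (by omega) (by simp [hPa.B]; omega) ?_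
      refine Run.seq (m := P.Q * (12 * P.B + 15) + 8) ?_ (by omega)
      generalize hbe : State.setReg (State.setReg _ _ _) 21 _ = b
      have b21 : b.reg 21 = u := by
        rw [← hbe, hu]
        simp [hPa.B, hPa.E, a42, a2, k2, h2, a15, t15, newLen]
        omega
      have hkb : a.Keep 21 b := by
        rw [← hbe]
        exact (((State.Keep.refl _ _).setReg (by norm_num)).setReg (by norm_num)).setReg
          (by norm_num)
      have hmb : b.mem = Function.update s.mem 0 g := by rw [← hbe]; simp [hma, hm]
      clear hbe
      have hPb := hPa.keep hkb
      have b13 := hkb 13 (by norm_num)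
      have b14 := hkb 14 (by norm_num)
      have b15 := hkb 15 (by norm_num)
      have b16 := hkb 16 (by norm_num)
      have b18 := hkb 18 (by norm_num)
      have b19 := hkb 19 (by norm_num)
      have b20 := hkb 20 (by norm_num)
      have hkb13 : s.Keep 13 b :=
        (hk.trans (hka'.mono (by norm_num))).trans (hkb.mono (by norm_num))
      have hscan : P.scan F z M (i + 1) = if u = 0 then e else ⟨e.pos + u, z + i * P.B, u⟩ := rfl
      have hiB : z + (i + 1) * P.B = z + i * P.B + P.B := by ring
      refine Run.branch (n := P.Q * (12 * P.B + 15) + 7) hL (by decide) (fun hc => ?_)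
        (fun hc => ?_)
      · simp [b21] at hc
        rw [if_neg hc] at hscan
        refine Run.seq (m := P.Q * (12 * P.B + 15) + 3) ?_ (by omega)
        refine (findProg_run (sd := sd) hPb (hs.keep hkb13) (by simpa [hmb] using hg1) (by omega)
          (by omega)).mono le_rfl ?_
        have hmb2 : b.mem 2 = m := by simp [hmb, hmd]
        have hmb1 : b.mem 1 = F := by simp [hmb, hFd]
        have hmb0 : b.mem 0 = g := by simp [hmb]
        rw [b13, a13, t13, b14, a14, t14, b15, a15, t15, b16, a16, t16, b21, hmb2, hmb1, hmb0]
        rintro w ⟨g', hmw, hg'1, hg'out, w22, hyes, hno, hkw⟩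
        have w13 := hkw 13 (by norm_num)
        have w14 := hkw 14 (by norm_num)
        have w15 := hkw 15 (by norm_num)
        have w16 := hkw 16 (by norm_num)
        have w18 := hkw 18 (by norm_num)
        have w19 := hkw 19 (by norm_num)
        have w20 := hkw 20 (by norm_num)
        have w21 := hkw 21 (by norm_num)
        have hPw := hPb.keep hkw
        have hw19 : w.reg 19 * w.reg 22 ≤ 1 * 1 := Nat.mul_le_mul (by omega) (by omega)
        refine .assign_seq hL (by decide) (by omega) (by simp; omega) ?_
        refine .assign_seq hL (by decide) (by omega) (by simp; omega) ?_
        refine .assign_seq hL (by decide) (by omega) (by simp; omega) ?_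
        refine (Run.assign hL (by decide) (by simp; omega) ?_).mono (by omega) fun _ h => h
        refine (Run.assign hL (by decide) ?_ ?_).mono (by omega) fun _ h => h
        · simp [hPw.B]; omega
        refine ⟨hlt, by simp [hPw.B, w16, b16, a16, t16, hiB], ?_, by simp; omega,
          by simp; omega, by rw [hscan]; simp; omega, by rw [hscan]; simp; omega,
          by rw [hscan]; simp; omega, by simpa using hw19, by omega, g', ?_, hg'1, ?_, ?_, ?_⟩
        · exact (((((hkb13.trans (hkw.mono (by norm_num))).setReg (by norm_num)).setReg
            (by norm_num)).setReg (by norm_num)).setReg (by norm_num)).setReg (by norm_num)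
        · simp [hmw, hmb]
        · intro j hj
          rw [hg'out j (by omega), hgF j hj]
        · simp
          intro h1 h2
          rw [hscan]
          exact Readable.step (hread (by omega)) (fun j hj => hg'out j (by omega)) (hyes h2)
        · intro hG
          simp
          refine ⟨by have := hgood hG; omega, ?_⟩
          obtain ⟨q, hq1, hq2, hq3⟩ := hG i hlt hc
          exact hno ⟨q, hq1, fun j hj => by rw [hq2 j hj, hgF j (Or.inr hj)], hq3⟩
      · simp [b21] at hc
        rw [if_pos hc] at hscan
        refine (Run.skip hL ?_).mono (by omega) fun _ h => h
        refine (Run.assign hL (by decide) ?_ ?_).mono (by omega) fun _ h => h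
        · simp [hPb.B]; omega
        refine ⟨hlt, by simp [hPb.B, b16, a16, t16, hiB], hkb13.setReg (by norm_num),
          by simp; omega, by simp; omega, by rw [hscan]; simp; omega, by rw [hscan]; simp; omega,
          by rw [hscan]; simp; omega, by simp; omega, by omega, g, by simp [hmb], hg1, hgF, ?_, ?_⟩
        · intro h
          rw [hscan]
          refine Readable.skip (hread ?_)
          simp at h; omega
        · intro hG
          have := hgood hG
          simp; omega
    · have hinb : i = nb := by omega
      subst hinb
      have := (hnb i).not.mp hlt
      exact Or.inl ⟨by simp [hPt.N, hPt.B, t16]; omega, g, hm, hg1, hgF, t13, t14, t19, hread,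
        hgood, hk, t18, t20⟩
  · exact ⟨by omega, by simp [h16], State.Keep.refl _ _, rfl, rfl, by simp [h13, scan],
      by simp [h14, scan], by simp [h15, scan], by omega, by simpa using hz, s.mem 0, by simp, hf,
      fun _ _ => rfl, fun _ => P.readable_zero _ _ _ _, fun _ => h19⟩

/-- Search a seed which allows to write the message to the blocks from `reg 20` on. -/
def searchProg : Prog :=
  .assign 18 0 ;; .assign 19 0 ;;
  .loop (1 - .reg 19)
    (seedProg ;; .assign 13 0 ;; .assign 14 0 ;; .assign 15 0 ;; .assign 16 (.reg 20) ;;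
      .assign 19 1 ;; blocksProg ;; .assign 18 (.reg 18 + 1))

/-- A seed is tested by carrying out the pass, so the seed found need not have a prime modulus; the
seed `sd₀` only guarantees that the search stops. -/
theorem searchProg_run {P : Par} {s : State} {sd₀ z M nb : ℕ} (hB : P.Basic) (hP : P.InRegs s)
    (hf : ∀ j, s.mem 0 j ≤ 1) (hF : ∀ j, s.mem 1 j ≤ 1)
    (hnb : ∀ i, i < nb ↔ z + i * P.B + P.B ≤ P.N) (hz : z ≤ P.N) (hM : M ≤ P.N)
    (h2 : s.reg 2 = M) (h20 : s.reg 20 = z) (hsd : sd₀ < P.Q * P.Q * P.Q)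
    (hgood : P.GoodSeed (s.mem 1) (s.mem 0) (s.mem 2) z M nb sd₀) :
    Run P.L searchProg s
      ((sd₀ + 1) * (nb * (P.Q * (12 * P.B + 15) + 3 * P.B + 25) + 20) + 3) fun s' => ∃ g sd,
      s'.mem = Function.update s.mem 0 g ∧ (∀ j, g j ≤ 1) ∧
      (∀ j, P.N ≤ j ∨ s.mem 1 j ≠ 0 → g j = s.mem 0 j) ∧
      s'.reg 13 = (P.scan (s.mem 1) z M nb).p ∧ s'.reg 14 = (P.scan (s.mem 1) z M nb).l ∧
      s'.reg 18 = sd + 1 ∧ sd ≤ sd₀ ∧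
      P.Readable (s.mem 2) sd z nb (P.scan (s.mem 1) z M nb) g ∧ s.Keep 10 s' := by
  have hL := one_le_L (P := P)
  have hQ := Q_mul_self_lt (P := P)
  have hQ1 := Q_le (P := P)
  have hN := hB.N_lt_Q
  set F := s.mem 1 with hFd
  set m := s.mem 2 with hmd
  refine .assign_seq hL (by decide) (by omega) (by simp) ?_
  refine .assign_seq hL (by decide) (by omega) (by simp) ?_
  refine (Run.loop (n := sd₀ + 1)
    (m := nb * (P.Q * (12 * P.B + 15) + 3 * P.B + 25) + 19) (fun i t =>
    t.reg 18 = i ∧ s.Keep 10 t ∧ t.reg 20 = z ∧ t.reg 19 ≤ 1 ∧ (t.reg 19 = 0 → i ≤ sd₀) ∧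
    i ≤ sd₀ + 1 ∧
    ∃ g, t.mem = Function.update s.mem 0 g ∧ (∀ j, g j ≤ 1) ∧
      (∀ j, P.N ≤ j ∨ F j ≠ 0 → g j = s.mem 0 j) ∧
      (t.reg 19 = 1 → ∃ sd, i = sd + 1 ∧ t.reg 13 = (P.scan F z M nb).p ∧
        t.reg 14 = (P.scan F z M nb).l ∧ P.Readable m sd z nb (P.scan F z M nb) g)) hL
    (by decide) ?_ ?_).mono le_rfl fun _ h => h
  · rintro i t ⟨t18, hk, t20, t19, hi0, hi, g, hm, hg1, hgF, hdone⟩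
    have hPt : P.InRegs t := hP.keep hk
    by_cases h1 : t.reg 19 = 1
    · obtain ⟨sd, hsd', t13, t14, hr⟩ := hdone h1
      exact Or.inl ⟨by simp [h1], g, sd, hm, hg1, hgF, t13, t14, by omega, by omega, hr, hk⟩
    have h0 : t.reg 19 = 0 := by omega
    have hisd := hi0 h0
    refine Or.inr ⟨by simp [h0], by omega, ?_⟩
    refine Run.seq (m := 3) ?_ (by omega)
    refine (seedProg_run hPt (by omega)).mono le_rfl ?_
    rintro a ⟨hsa, hma, hka, hka'⟩
    rw [t18] at hsa
    have a18 := hka' 18 (by norm_num)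
    have a20 := hka' 20 (by norm_num)
    refine .assign_seq hL (by decide) (by omega) (by simp) ?_
    refine .assign_seq hL (by decide) (by omega) (by simp) ?_
    refine .assign_seq hL (by decide) (by omega) (by simp) ?_
    refine .assign_seq hL (by decide) (by omega) (by simp; omega) ?_
    refine .assign_seq hL (by decide) (by omega) (by simp; omega) ?_
    refine Run.seq (m := nb * (P.Q * (12 * P.B + 15) + 3 * P.B + 25) + 1) ?_ (by omega)
    generalize hbe : State.setReg (State.setReg _ _ _) 19 _ = b
    have hkb : a.Keep 13 b := by
      rw [← hbe]
      exact (((((State.Keep.refl _ _).setReg (by norm_num)).setReg (by norm_num)).setReg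
        (by norm_num)).setReg (by norm_num)).setReg (by norm_num)
    have hmb : b.mem = Function.update s.mem 0 g := by rw [← hbe]; simp [hma, hm]
    have b13 : b.reg 13 = 0 := by rw [← hbe]; simp
    have b14 : b.reg 14 = 0 := by rw [← hbe]; simp
    have b15 : b.reg 15 = 0 := by rw [← hbe]; simp
    have b16 : b.reg 16 = z := by rw [← hbe]; simp [a20, t20]
    have b19 : b.reg 19 = 1 := by rw [← hbe]; simp
    have b18 : b.reg 18 = i := by rw [← hbe]; simp [a18, t18]
    have b20 : b.reg 20 = z := by rw [← hbe]; simp [a20, t20]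
    clear hbe
    have hkb10 : s.Keep 10 b := (hk.trans hka).trans (hkb.mono (by norm_num))
    have hmb0 : b.mem 0 = g := by simp [hmb]
    have hmb1 : b.mem 1 = F := by simp [hmb, hFd]
    have hmb2 : b.mem 2 = m := by simp [hmb, hmd]
    refine (blocksProg_run hB (hP.keep hkb10) (hsa.keep hkb) (by simpa [hmb0] using hg1)
      (by simpa [hmb1] using hF) hnb hz hM (by rw [hkb10 2 (by norm_num), h2]) b13 b14 b15 b16
      b19).mono le_rfl ?_
    rw [hmb0, hmb1, hmb2]
    rintro w ⟨g', hmw, hg'1, hg'F, w13, w14, w19, hread, hgo, hkw, w18, w20⟩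
    refine (Run.assign hL (by decide) (by simp; omega) ?_).mono (by omega) fun _ h => h
    refine ⟨by simp; omega, (hkb10.trans (hkw.mono (by norm_num))).setReg (by norm_num),
      by simp; omega, by simp; omega, ?_, by omega, g', by simp [hmw, hmb], hg'1, ?_, ?_⟩
    · intro h
      simp at h
      by_contra hlt
      have : i = sd₀ := by omega
      subst this
      -- Failed attempts have changed free cells only, so `sd₀` is still good.
      have := hgo (fun x hx hne => by
        obtain ⟨q, hq1, hq2, hq3⟩ := hgood x hx hne
        exact ⟨q, hq1, fun j hj => by rw [hq2 j hj, hgF j (Or.inr hj)], hq3⟩)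
      omega
    · intro j hj
      rw [hg'F j hj, hgF j hj]
    · intro h
      exact ⟨i, rfl, by simpa using w13, by simpa using w14, hread (by simpa using h)⟩
  · exact ⟨by simp, ((State.Keep.refl _ _).setReg (by norm_num)).setReg (by norm_num),
      by simp [h20], by simp, by omega, by omega, s.mem 0, by simp, hf, fun _ _ => rfl, by simp⟩

/-- The encoder, after the computation of the parameters. -/
def encodeProg : Prog :=
  .assign 27 0 ;; encSideProg ;; searchProg ;;
  .assign 18 (.reg 18 - 1) ;;
  .assign 27 (.reg 2 + .reg 5 * (.reg 14 + .reg 5 * (.reg 13 + .reg 5 * .reg 18))) ;; encSideProg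

/-- Writing the side information 0 serves only to find the address `z` behind the usable blocks. The
true side information is written after the message, when the seed is known and the total weight
includes the message; it changes no cell from `z` on, so the message stays readable. -/
theorem encodeProg_run {P : Par} {s : State} {M : ℕ} (hB : P.Basic) (hP : P.InRegs s)
    (hB0 : 0 < P.B) (hf : ∀ j, s.mem 0 j ≤ 1) (hF : ∀ j, s.mem 1 j ≤ 1)
    (hbud : cellSum (s.mem 1) 0 (P.n * P.W) + P.r * P.W + 2 * P.n * P.n < P.n * P.W)
    (hM0 : 0 < M) (hM : M < P.M₀) (h2 : s.reg 2 = M)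
    (hgood : ∀ z ≤ P.N, z ≤ cellSum (s.mem 1) 0 z + (P.r + 1) * P.W + 2 * P.n * P.n →
      ∃ nb sd, (∀ i, i < nb ↔ z + i * P.B + P.B ≤ P.N) ∧ nb ≤ P.N / P.B ∧ sd < P.Q * P.Q * P.Q ∧
        P.GoodSeed (s.mem 1) (s.mem 0) (s.mem 2) z M nb sd ∧ (P.scan (s.mem 1) z M nb).pos = M) :
    Run P.L encodeProg s (2 * (P.n * (13 * P.W + 3 * P.N + 40) + 10) +
      P.Q * P.Q * P.Q * (P.N * (P.Q * (12 * P.B + 15) + 3 * P.B + 25) + 20) + 6) fun s' => ∃ g,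
      s'.mem 0 = g ∧ (∀ j, g j ≤ 1) ∧ (∀ j, P.N ≤ j ∨ s.mem 1 j ≠ 0 → g j = s.mem 0 j) ∧
      P.decLen (P.side g) = M ∧ ∀ j < M, P.decOut g j = s.mem 2 j := by
  have hL := one_le_L (P := P)
  have hQ1 := Q_le (P := P)
  have hQ0 := Q_pos (P := P)
  have hN := hB.N_lt_Q
  have hBQ := B_lt_Q (P := P)
  have hM₀ := hB.M₀_lt
  set F := s.mem 1 with hFd
  set m := s.mem 2 with hmd
  set T₁ := P.n * (13 * P.W + 3 * P.N + 40) + 10 with hT₁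
  set T₂ := P.N * (P.Q * (12 * P.B + 15) + 3 * P.B + 25) + 20 with hT₂
  refine .assign_seq hL (by decide) (by omega) (by simp) ?_
  refine Run.seq (m := T₁) ?_ (by omega)
  refine (encSideProg_run hB (hP.setReg (by norm_num)) (by simpa using hf) (by simpa using hF)
    (by simpa using hbud) (by simp)).mono le_rfl ?_
  rintro a ⟨f, G, hma, hf1, hst, hGn, a20, hfout, hcov, -, hka⟩
  simp only [State.setReg_mem, ← hFd] at hma hst hfout hcov
  have hka' : s.Keep 20 a := ((State.Keep.refl _ _).setReg (by norm_num)).trans hka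
  have hPa := hP.keep hka'
  have hz : G * P.W ≤ P.N := (Nat.mul_le_mul_right _ hGn).trans hB.nW_le
  obtain ⟨nb, sd₀, hnb, hnbN, hsd₀, hgs, hpos⟩ := hgood (G * P.W) hz hcov
  have hma0 : a.mem 0 = f := by simp [hma]
  have hma1 : a.mem 1 = F := by simp [hma, hFd]
  have hma2 : a.mem 2 = m := by simp [hma, hmd]
  have hgs' : P.GoodSeed F f m (G * P.W) M nb sd₀ := fun i hi hne => by
    obtain ⟨q, hq1, hq2, hq3⟩ := hgs i hi hne
    exact ⟨q, hq1, fun j hj => by rw [hq2 j hj, hfout j (Or.inr hj)], hq3⟩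
  have hT : (sd₀ + 1) * (nb * (P.Q * (12 * P.B + 15) + 3 * P.B + 25) + 20) ≤
      P.Q * P.Q * P.Q * T₂ := by
    refine Nat.mul_le_mul (by omega) ?_
    rw [hT₂]
    gcongr
    exact hnbN.trans (Nat.div_le_self _ _)
  refine Run.seq (m := P.Q * P.Q * P.Q * T₂ + 3) ?_ (by omega)
  refine (searchProg_run (M := M) hB hPa (by simpa [hma0] using hf1) (by simpa [hma1] using hF) hnb
    hz (by omega) (by rw [hka' 2 (by norm_num), h2]) a20 hsd₀
    (by simpa [hma0, hma1, hma2] using hgs')).mono (Nat.add_le_add_right hT 3) ?_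
  clear hT
  rw [hma0, hma1, hma2]
  rintro b ⟨g, sd, hmb, hg1, hgF, b13, b14, b18, hsd, hread, hkb⟩
  have hPb := hPa.keep hkb
  have b2 : b.reg 2 = M := by rw [hkb 2 (by norm_num), hka' 2 (by norm_num), h2]
  set e := P.scan F (G * P.W) M nb with he
  have hl : e.l ≤ P.B := P.scan_l_le F _ _ _
  have hp : e.p < P.N := P.scan_p_lt (by omega) hB0 hnb le_rfl
  have hsdQ : sd < P.Q ^ 3 := by
    calc sd < P.Q * P.Q * P.Q := by omega
      _ = P.Q ^ 3 := by ring
  have hpQ : e.p + P.Q * sd < P.Q ^ 4 := by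
    have : P.Q * (sd + 1) ≤ P.Q * P.Q ^ 3 := Nat.mul_le_mul_left _ hsdQ
    calc e.p + P.Q * sd < P.Q * (sd + 1) := by rw [mul_add]; omega
      _ ≤ _ := this
      _ = P.Q ^ 4 := by ring
  have hlQ : e.l + P.Q * (e.p + P.Q * sd) < P.Q ^ 5 := by
    have : P.Q * (e.p + P.Q * sd + 1) ≤ P.Q * P.Q ^ 4 := Nat.mul_le_mul_left _ hpQ
    calc e.l + P.Q * (e.p + P.Q * sd) < P.Q * (e.p + P.Q * sd + 1) := by rw [mul_add _ _ 1]; omega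
      _ ≤ _ := this
      _ = P.Q ^ 5 := by ring
  -- Length, bit count and address take one digit each and the seed three: this is the 6 in `r = 6 *
  -- (B + 2)`.
  have hSQ : M + P.Q * (e.l + P.Q * (e.p + P.Q * sd)) < P.Q ^ 6 := by
    have : P.Q * (e.l + P.Q * (e.p + P.Q * sd) + 1) ≤ P.Q * P.Q ^ 5 := Nat.mul_le_mul_left _ hlQ
    calc M + P.Q * (e.l + P.Q * (e.p + P.Q * sd))
        < P.Q * (e.l + P.Q * (e.p + P.Q * sd) + 1) := by rw [mul_add _ _ 1]; omega
      _ ≤ _ := this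
      _ = P.Q ^ 6 := by ring
  have hSr : M + P.Q * (e.l + P.Q * (e.p + P.Q * sd)) < 2 ^ P.r := by
    rwa [Q_pow] at hSQ
  have hrL : 2 ^ P.r ≤ 2 ^ P.L := Nat.pow_le_pow_right (by norm_num) (by unfold r L; omega)
  have hQ3 := Q_mul_self_lt (P := P)
  refine .assign_seq hL (by decide) (by omega) (by simp [b18]; omega) ?_
  refine .assign_seq hL (by decide) (by omega) ?_ ?_
  · simp [b18, b14, b13, b2, hPb.Q]; omega
  generalize hce : State.setReg (State.setReg _ _ _) 27 _ = c
  have c27 : c.reg 27 = M + P.Q * (e.l + P.Q * (e.p + P.Q * sd)) := by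
    rw [← hce]; simp [b18, b14, b13, b2, hPb.Q]
  have hkc : b.Keep 18 c := by
    rw [← hce]; exact ((State.Keep.refl _ _).setReg (by norm_num)).setReg (by norm_num)
  have hmc : c.mem = Function.update s.mem 0 g := by rw [← hce]; simp [hmb, hma]
  clear hce
  have hmc0 : c.mem 0 = g := by simp [hmc]
  have hmc1 : c.mem 1 = F := by simp [hmc, hFd]
  refine (encSideProg_run hB (hPb.keep hkc) (by simpa [hmc0] using hg1) (by simpa [hmc1] using hF)
    (by simpa [hmc1] using hbud) (by rw [c27]; exact hSr)).mono (by omega) ?_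
  rw [hmc0, hmc1, c27]
  rintro d ⟨q, G', hmd, hq1, hst', -, -, hqout, -, hside, -⟩
  rw [hst'.unique hst] at hqout
  set S := M + P.Q * (e.l + P.Q * (e.p + P.Q * sd)) with hS
  have hMQ : M < P.Q := by omega
  have d1 : S % P.Q = M := by rw [hS, Nat.add_mul_mod_self_left, Nat.mod_eq_of_lt hMQ]
  have d2 : S / P.Q = e.l + P.Q * (e.p + P.Q * sd) := by
    rw [hS, Nat.add_mul_div_left _ _ hQ0, Nat.div_eq_of_lt hMQ, zero_add]
  have hlQ' : e.l < P.Q := by omega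
  have hpQ' : e.p < P.Q := by omega
  have d3 : S / P.Q % P.Q = e.l := by
    rw [d2, Nat.add_mul_mod_self_left, Nat.mod_eq_of_lt hlQ']
  have d4 : S / P.Q / P.Q = e.p + P.Q * sd := by
    rw [d2, Nat.add_mul_div_left _ _ hQ0, Nat.div_eq_of_lt hlQ', zero_add]
  have d5 : S / P.Q / P.Q % P.Q = e.p := by
    rw [d4, Nat.add_mul_mod_self_left, Nat.mod_eq_of_lt hpQ']
  have d6 : S / P.Q / P.Q / P.Q = sd := by
    rw [d4, Nat.add_mul_div_left _ _ hQ0, Nat.div_eq_of_lt hpQ', zero_add]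
  have hlen : P.decLen S = M := by
    unfold decLen
    rw [d1, if_pos ⟨hM0, hM⟩]
  refine ⟨q, by simp [hmd], hq1, ?_, by rw [hside, hlen], ?_⟩
  · intro j hj
    rw [hqout j (by omega), hgF j hj, hfout j (by omega)]
  · intro j hj
    have hinit : P.decInit S = ⟨e.p, e.l, e.pos, fun _ => 0⟩ := by
      unfold decInit
      rw [d5, d3, hlen, hpos, Nat.mod_eq_of_lt (by omega)]
    unfold decOut
    rw [hside, d6, hinit, hread q (fun j hj1 _ => hqout j (Or.inl hj1)) _ hnbN, hpos, if_pos hj]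

end Par

end RAM

/-! ### The second moment method for affine maps -/

open Finset in
/-- Affine maps are pairwise independent: few of them avoid a large set `Y` on a large set `X`. -/
theorem card_affine_avoiding_le (p : ℕ) [Fact p.Prime] (X Y : Finset (ZMod p)) :
    #{ab : ZMod p × ZMod p | ∀ x ∈ X, ab.1 * x + ab.2 ∉ Y} * (#X * #Y) ≤ p ^ 3 := by
  classical
  -- `Z` counts the points of `X` sent into `Y`. Its mean is `c / p`, and an avoiding pair, having
  -- `Z = 0`, deviates from it by the full mean. Deviations are scaled by `p` to stay in the
  -- integers.
  let I : ZMod p → ZMod p × ZMod p → ℤ := fun x ab => if ab.1 * x + ab.2 ∈ Y then 1 else 0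
  let Z : ZMod p × ZMod p → ℤ := fun ab => ∑ x ∈ X, I x ab
  set c : ℤ := #X * #Y with hc
  have hI : ∀ x, ∑ ab, I x ab = p * #Y := by
    intro x
    rw [Fintype.sum_prod_type]
    have : ∀ a : ZMod p, ∑ b : ZMod p, I x (a, b) = #Y := by
      intro a
      simp only [I]
      rw [Fintype.sum_equiv (Equiv.addLeft (a * x)) _ (fun b => if b ∈ Y then (1 : ℤ) else 0)
        fun b => by simp only [Equiv.coe_addLeft]; congr]
      simp
    simp [this, ZMod.card]
  -- Pairwise independence: an affine map is determined by its values at two distinct points.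
  have hII : ∀ x x', x ≠ x' → ∑ ab, I x ab * I x' ab ≤ (#Y : ℤ) ^ 2 := by
    intro x x' hne
    have e : ∀ ab : ZMod p × ZMod p, I x ab * I x' ab =
        if ab.1 * x + ab.2 ∈ Y ∧ ab.1 * x' + ab.2 ∈ Y then 1 else 0 := by
      intro ab
      simp only [I]
      split_ifs <;> simp_all
    simp only [e]
    rw [sum_boole]
    norm_cast
    rw [sq, ← card_product]
    refine card_le_card_of_injOn (fun ab => (ab.1 * x + ab.2, ab.1 * x' + ab.2)) ?_ ?_
    · intro ab hab
      simpa using hab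
    · rintro ⟨a, b⟩ _ ⟨a', b'⟩ _ h
      simp only [Prod.mk.injEq] at h
      have h1 : (a - a') * (x - x') = 0 := by linear_combination h.1 - h.2
      have h2 : a = a' := by
        rcases mul_eq_zero.mp h1 with h | h
        · exact sub_eq_zero.mp h
        · exact absurd (sub_eq_zero.mp h) hne
      subst h2
      simpa using h.1
  have hZ1 : ∑ ab, Z ab = p * c := by
    simp only [Z]
    rw [sum_comm, sum_congr rfl fun x _ => hI x]
    simp [hc]; ring
  have hZ2 : ∑ ab, Z ab ^ 2 ≤ p * c + c ^ 2 := by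
    have e : ∀ ab, Z ab ^ 2 = ∑ x ∈ X, ∑ x' ∈ X, I x ab * I x' ab := fun ab => by
      simp only [Z]; rw [sq, sum_mul_sum]
    simp only [e]
    rw [sum_comm]
    have h1 : ∀ x ∈ X, ∑ ab, ∑ x' ∈ X, I x ab * I x' ab ≤ p * #Y + #X * (#Y : ℤ) ^ 2 := by
      intro x hx
      rw [sum_comm, ← add_sum_erase _ _ hx]
      refine add_le_add ?_ ?_
      · rw [← hI x]
        refine (sum_congr rfl fun ab _ => ?_).le
        simp only [I]; split_ifs <;> simp
      · refine (sum_le_card_nsmul _ _ ((#Y : ℤ) ^ 2) fun x' hx' => hII x x'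
          (ne_of_mem_erase hx').symm).trans ?_
        rw [nsmul_eq_mul]
        gcongr
        exact erase_subset _ _
    refine (sum_le_card_nsmul _ _ _ h1).trans (le_of_eq ?_)
    simp [hc]; ring
  -- The off-diagonal part `c ^ 2` of the second moment cancels against the square of the mean; only
  -- the diagonal part `p * c` remains.
  have hvar : ∑ ab, ((p : ℤ) * Z ab - c) ^ 2 ≤ p ^ 3 * c := by
    have e : ∀ ab, ((p : ℤ) * Z ab - c) ^ 2 = p ^ 2 * Z ab ^ 2 - 2 * p * c * Z ab + c ^ 2 :=
      fun ab => by ring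
    simp only [e]
    rw [sum_add_distrib, sum_sub_distrib, ← mul_sum, ← mul_sum, hZ1]
    simp only [sum_const, card_univ, Fintype.card_prod, ZMod.card, nsmul_eq_mul]
    push_cast
    have : (p : ℤ) ^ 2 * ∑ ab, Z ab ^ 2 ≤ p ^ 2 * (p * c + c ^ 2) := by gcongr
    linarith
  set A := ({ab : ZMod p × ZMod p | ∀ x ∈ X, ab.1 * x + ab.2 ∉ Y} : Finset _) with hA
  have hfail : (#A : ℤ) * c ^ 2 ≤ ∑ ab, ((p : ℤ) * Z ab - c) ^ 2 := by
    rw [← nsmul_eq_mul]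
    refine (card_nsmul_le_sum A _ (c ^ 2) fun ab hab => ?_).trans
      (sum_le_sum_of_subset_of_nonneg (subset_univ _) fun _ _ _ => sq_nonneg _)
    have : Z ab = 0 := sum_eq_zero fun x hx => by
      simp only [hA, mem_filter, mem_univ, true_and] at hab
      simp [I, hab x hx]
    simp [this]
  rcases eq_or_ne c 0 with h0 | h0
  · have : #X * #Y = 0 := by rw [hc] at h0; exact_mod_cast h0
    simp [this]
  · have hcpos : 0 < c := lt_of_le_of_ne (by positivity) (Ne.symm h0)
    have h : ((#A : ℤ) * c) * c ≤ p ^ 3 * c := by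
      calc ((#A : ℤ) * c) * c = #A * c ^ 2 := by ring
        _ ≤ _ := hfail.trans hvar
    have := le_of_mul_le_mul_right h hcpos
    rw [hc] at this
    exact_mod_cast this

open Finset in
theorem card_affine_mod_avoiding_le {p : ℕ} (hp : p.Prime) {X Y : Finset ℕ}
    (hX : ∀ x ∈ X, x < p) (hY : ∀ y ∈ Y, y < p) :
    #{ab ∈ range p ×ˢ range p | ∀ x ∈ X, (ab.1 * x + ab.2) % p ∉ Y} * (#X * #Y) ≤ p ^ 3 := by
  classical
  have : Fact p.Prime := ⟨hp⟩
  have hcast : ∀ x y : ℕ, x < p → y < p → (x : ZMod p) = y → x = y := fun x y hx hy h => by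
    have := (ZMod.natCast_eq_natCast_iff' x y p).mp h
    rwa [Nat.mod_eq_of_lt hx, Nat.mod_eq_of_lt hy] at this
  have key := card_affine_avoiding_le p (X.image (Nat.cast : ℕ → ZMod p))
    (Y.image (Nat.cast : ℕ → ZMod p))
  rw [card_image_of_injOn fun x hx y hy h => hcast x y (hX x hx) (hX y hy) h,
    card_image_of_injOn fun x hx y hy h => hcast x y (hY x hx) (hY y hy) h] at key
  refine le_trans (Nat.mul_le_mul_right _ ?_) key
  refine card_le_card_of_injOn (fun ab => ((ab.1 : ZMod p), (ab.2 : ZMod p))) ?_ ?_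
  · rintro ⟨a, b⟩ hab
    simp only [coe_filter, mem_product, mem_range, Set.mem_ofPred_eq] at hab
    simp only [coe_filter, mem_univ, true_and, Set.mem_ofPred_eq]
    intro x hx hmem
    obtain ⟨x, hx', rfl⟩ := mem_image.mp hx
    obtain ⟨y, hy, hxy⟩ := mem_image.mp hmem
    refine hab.2 x hx' ?_
    have : (a * x + b) % p = y := by
      refine hcast _ _ (Nat.mod_lt _ hp.pos) (hY y hy) ?_
      rw [ZMod.natCast_mod]
      push_cast
      exact hxy.symm
    rwa [this]
  · rintro ⟨a, b⟩ hab ⟨a', b'⟩ hab' h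
    simp only [coe_filter, mem_product, mem_range, Set.mem_ofPred_eq] at hab hab'
    simp only [Prod.mk.injEq] at h ⊢
    exact ⟨hcast _ _ hab.1.1 hab'.1.1 h.1, hcast _ _ hab.1.2 hab'.1.2 h.2⟩

/-! ### A seed that suits all blocks -/

namespace RAM

/-- The words which can be written to the block from `cur` on. -/
theorem exists_words {F v : ℕ → ℕ} (hF : ∀ j, F j ≤ 1) (hv : ∀ j, v j ≤ 1) (cur B : ℕ) :
    ∃ X : Finset ℕ, X.card = 2 ^ (B - cellSum F cur B) ∧ ∀ x ∈ X, x < 2 ^ B ∧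
      ∃ g : ℕ → ℕ, (∀ j, g j ≤ 1) ∧ (∀ j, F j ≠ 0 → g j = v j) ∧ cellNum g cur B = x := by
  classical
  let A := (Finset.range B).filter fun j => F (cur + j) = 0
  let g : Finset ℕ → ℕ → ℕ := fun T j => if F j ≠ 0 then v j else if j - cur ∈ T then 1 else 0
  have hg : ∀ T j, g T j ≤ 1 := fun T j => by
    simp only [g]; split_ifs <;> first | exact hv j | omega
  have hA : A.card + cellSum F cur B = B := by
    have : cellSum F cur B = ((Finset.range B).filter fun j => ¬ F (cur + j) = 0).card := by
      rw [Finset.card_filter]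
      refine Finset.sum_congr rfl fun j _ => ?_
      have := hF (cur + j)
      split_ifs <;> omega
    rw [this, Finset.card_filter_add_card_filter_not, Finset.card_range]
  refine ⟨A.powerset.image fun T => cellNum (g T) cur B, ?_, ?_⟩
  · rw [Finset.card_image_of_injOn, Finset.card_powerset]
    · congr 1; omega
    · intro T hT T' hT' h
      simp only [Finset.coe_powerset, Set.mem_preimage, Set.mem_powerset_iff,
        Finset.coe_subset] at hT hT'
      simp only at h
      have hb : ∀ j ∈ A, (j ∈ T ↔ j ∈ T') := by
        intro j hj
        simp only [A, Finset.mem_filter, Finset.mem_range] at hj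
        have h1 := cellNum_bit (hg T) (lo := cur) hj.1
        have h2 := cellNum_bit (hg T') (lo := cur) hj.1
        rw [h, h2] at h1
        simp only [g, hj.2, ne_eq, not_true_eq_false, if_false, Nat.add_sub_cancel_left] at h1
        by_cases a : j ∈ T <;> by_cases b : j ∈ T' <;> simp_all
      ext j
      exact ⟨fun h => (hb j (hT h)).mp h, fun h => (hb j (hT' h)).mpr h⟩
  · intro x hx
    obtain ⟨T, _, rfl⟩ := Finset.mem_image.mp hx
    exact ⟨cellNum_lt (hg T), g T, hg T, fun j hj => by simp [g, hj], rfl⟩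

namespace Par

variable {P : Par}

/-- The hash values which match. -/
theorem exists_matching {m : ℕ → ℕ} (hm : ∀ j, m j ≤ 1) {p l pos len q : ℕ} (hp : p < P.N)
    (hl : l ≤ P.B) (hq : P.N * (P.B + 1) * 2 ^ len ≤ q) :
    ∃ Y : Finset ℕ, q ≤ 2 * (P.N * (P.B + 1) * 2 ^ len) * Y.card ∧
      ∀ y ∈ Y, y < q ∧ P.Matches m p l pos len y := by
  set R := P.N * (P.B + 1) * 2 ^ len with hR
  set ch := cellNum m pos len with hch
  have hchl : ch < 2 ^ len := cellNum_lt hm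
  have hN : 0 < P.N := by omega
  have hR0 : 0 < R := by positivity
  -- The least hash value with the prescribed fields. Adding multiples of `R` changes none of them,
  -- so the admissible values form an arithmetic progression.
  set y₀ := p + P.N * (l + (P.B + 1) * ch) with hy₀
  have hy₀R : y₀ < R := by
    have h1 : (P.B + 1) * (ch + 1) ≤ (P.B + 1) * 2 ^ len := Nat.mul_le_mul_left _ hchl
    have h2 : P.N * ((P.B + 1) * (ch + 1)) ≤ P.N * ((P.B + 1) * 2 ^ len) :=
      Nat.mul_le_mul_left _ h1
    have h3 : P.N * l ≤ P.N * P.B := Nat.mul_le_mul_left _ hl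
    rw [hR, mul_assoc]
    refine lt_of_lt_of_le ?_ h2
    rw [hy₀]
    nlinarith
  refine ⟨(Finset.range (q / R)).image fun t => y₀ + R * t, ?_, ?_⟩
  · rw [Finset.card_image_of_injective _ fun a b h => by
      simpa [hR0.ne'] using h, Finset.card_range]
    have h1 := Nat.div_add_mod q R
    have h2 := Nat.mod_lt q hR0
    -- As the quotient is at least 1, rounding down costs at most a factor 2.
    have h3 : 1 ≤ q / R := (Nat.one_le_div_iff hR0).mpr hq
    have h4 : R * 1 ≤ R * (q / R) := Nat.mul_le_mul_left _ h3
    rw [mul_assoc]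
    omega
  · intro y hy
    obtain ⟨t, ht, rfl⟩ := Finset.mem_image.mp hy
    rw [Finset.mem_range] at ht
    have hlt : y₀ + R * t < q := by
      have h1 : R * (t + 1) ≤ R * (q / R) := Nat.mul_le_mul_left _ ht
      have h2 := Nat.mul_div_le q R
      rw [mul_add] at h1
      omega
    have e : y₀ + R * t = p + P.N * (l + (P.B + 1) * (ch + 2 ^ len * t)) := by
      rw [hy₀, hR]; ring
    have e1 : (y₀ + R * t) / P.N = l + (P.B + 1) * (ch + 2 ^ len * t) := by
      rw [e, Nat.add_mul_div_left _ _ hN, Nat.div_eq_of_lt hp, zero_add]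
    refine ⟨hlt, ?_, ?_, ?_⟩
    · rw [e, Nat.add_mul_mod_self_left, Nat.mod_eq_of_lt hp]
    · rw [e1, Nat.add_mul_mod_self_left, Nat.mod_eq_of_lt (by omega)]
    · intro j hj
      rw [← Nat.div_div_eq_div_mul, e1, Nat.add_mul_div_left _ _ (by omega),
        Nat.div_eq_of_lt (show l < P.B + 1 by omega), zero_add]
      have e2 : 2 ^ len * t = 2 ^ j * (2 * (2 ^ (len - j - 1) * t)) := by
        rw [← mul_assoc, ← mul_assoc, ← pow_succ, ← pow_add]
        congr 2; omega
      rw [e2, Nat.add_mul_div_left _ _ (by positivity), Nat.add_mul_mod_self_left, hch,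
        cellNum_bit hm hj]

-- With `R = N * (B + 1) * 2 ^ u` there are at least `2 ^ (u + E)` words and at least `p / (2 * R)`
-- admissible values for a block that takes `u` bits. The factor `2 ^ u` cancels, so at most `2 * N
-- * (B + 1) * p ^ 2 / 2 ^ E` of the `p ^ 2` pairs fail there, and by `hE` the failures at all `nb`
-- blocks do not exhaust the pairs.
open Finset in
theorem exists_goodSeed {F v m : ℕ → ℕ} (hF : ∀ j, F j ≤ 1) (hv : ∀ j, v j ≤ 1)
    (hm : ∀ j, m j ≤ 1) {z M nb : ℕ} (hnb : ∀ i, i < nb ↔ z + i * P.B + P.B ≤ P.N)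
    (hN : 0 < P.N) (hB : 0 < P.B) (hE : 2 * (P.N * (P.B + 1)) * nb < 2 ^ P.E)
    (hE' : P.N * (P.B + 1) ≤ 2 ^ P.E) :
    ∃ sd < P.Q * P.Q * P.Q, P.GoodSeed F v m z M nb sd := by
  classical
  -- Bertrand's postulate: distinct words are distinct residues modulo `p`, and `p` is still a digit
  -- in base `Q`.
  obtain ⟨p, hp, hp1, hp2⟩ := Nat.exists_prime_lt_and_le_two_mul (2 ^ P.B) (by positivity)
  have hpQ : p < P.Q := by
    have := four_two_pow (P := P)
    have : 0 < 2 ^ P.B := by positivity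
    omega
  let bad : ℕ → Finset (ℕ × ℕ) := fun i => {ab ∈ range p ×ˢ range p |
    P.newLen F M (z + i * P.B) (P.scan F z M i).pos ≠ 0 ∧
    ¬ ∃ g : ℕ → ℕ, (∀ j, g j ≤ 1) ∧ (∀ j, F j ≠ 0 → g j = v j) ∧
      P.Matches m (P.scan F z M i).p (P.scan F z M i).l (P.scan F z M i).pos
        (P.newLen F M (z + i * P.B) (P.scan F z M i).pos)
        ((ab.1 * cellNum g (z + i * P.B) P.B + ab.2) % p)}
  have hbad : ∀ i < nb, #(bad i) * 2 ^ P.E ≤ 2 * (P.N * (P.B + 1)) * p ^ 2 := by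
    intro i hi
    set cur := z + i * P.B with hcur
    set e := P.scan F z M i with he
    set u := P.newLen F M cur e.pos with hu
    by_cases hu0 : u = 0
    · have : bad i = ∅ := by
        simp only [bad, ← hcur, ← he, ← hu, hu0]
        simp
      simp [this]
    obtain ⟨X, hXc, hX⟩ := exists_words hF hv cur P.B
    have huE : u + P.E ≤ P.B - cellSum F cur P.B := by
      have : u ≤ P.B - cellSum F cur P.B - P.E := min_le_left _ _
      omega
    have hXc' : 2 ^ u * 2 ^ P.E ≤ #X := by
      rw [hXc, ← pow_add]
      exact Nat.pow_le_pow_right (by norm_num) huE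
    have hXB : #X ≤ 2 ^ P.B := by
      rw [hXc]; exact Nat.pow_le_pow_right (by norm_num) (Nat.sub_le _ _)
    have hRp : P.N * (P.B + 1) * 2 ^ u ≤ p := by
      calc P.N * (P.B + 1) * 2 ^ u ≤ 2 ^ P.E * 2 ^ u := Nat.mul_le_mul_right _ hE'
        _ = 2 ^ u * 2 ^ P.E := mul_comm _ _
        _ ≤ p := by omega
    obtain ⟨Y, hYc, hY⟩ := exists_matching (P := P) hm (pos := e.pos)
      (scan_p_lt (F := F) (M := M) hN hB hnb hi.le) (P.scan_l_le F z M i) hRp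
    rw [← he] at hY
    have hcount := card_affine_mod_avoiding_le hp (X := X) (Y := Y)
      (fun x hx => (hX x hx).1.trans hp1) (fun y hy => (hY y hy).1)
    have hsub : bad i ⊆ {ab ∈ range p ×ˢ range p | ∀ x ∈ X, (ab.1 * x + ab.2) % p ∉ Y} := by
      intro ab hab
      simp only [bad, mem_filter] at hab ⊢
      refine ⟨hab.1, fun x hx hy => hab.2.2 ?_⟩
      obtain ⟨_, g, hg1, hgF, rfl⟩ := hX x hx
      exact ⟨g, hg1, hgF, (hY _ hy).2⟩
    have hcount' : #(bad i) * (#X * #Y) ≤ p ^ 3 :=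
      (Nat.mul_le_mul_right _ (card_le_card hsub)).trans hcount
    refine Nat.le_of_mul_le_mul_right (c := p) ?_ hp.pos
    calc #(bad i) * 2 ^ P.E * p
        ≤ #(bad i) * 2 ^ P.E * (2 * (P.N * (P.B + 1) * 2 ^ u) * #Y) := Nat.mul_le_mul_left _ hYc
      _ = 2 * (P.N * (P.B + 1)) * (#(bad i) * ((2 ^ u * 2 ^ P.E) * #Y)) := by ring
      _ ≤ 2 * (P.N * (P.B + 1)) * (#(bad i) * (#X * #Y)) := by gcongr
      _ ≤ 2 * (P.N * (P.B + 1)) * p ^ 3 := by gcongr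
      _ = 2 * (P.N * (P.B + 1)) * p ^ 2 * p := by ring
  have hunion : #((range nb).biUnion bad) < #(range p ×ˢ range p) := by
    rw [card_product, card_range, ← sq]
    refine lt_of_le_of_lt card_biUnion_le ?_
    refine Nat.lt_of_mul_lt_mul_right (a := 2 ^ P.E) ?_
    rw [sum_mul]
    calc ∑ i ∈ range nb, #(bad i) * 2 ^ P.E
        ≤ ∑ i ∈ range nb, 2 * (P.N * (P.B + 1)) * p ^ 2 :=
          sum_le_sum fun i hi => hbad i (mem_range.mp hi)
      _ = 2 * (P.N * (P.B + 1)) * nb * p ^ 2 := by simp; ring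
      _ < 2 ^ P.E * p ^ 2 := Nat.mul_lt_mul_of_pos_right hE (by have := hp.pos; positivity)
      _ = p ^ 2 * 2 ^ P.E := mul_comm _ _
  obtain ⟨⟨a, b⟩, hab, hnot⟩ := exists_mem_notMem_of_card_lt_card hunion
  simp only [mem_product, mem_range] at hab
  have hQ0 := Q_pos (P := P)
  have hb : b < P.Q := hab.2.trans hpQ
  have ha : a < P.Q := hab.1.trans hpQ
  have d1 : (b + P.Q * (a + P.Q * p)) % P.Q = b := by
    rw [Nat.add_mul_mod_self_left, Nat.mod_eq_of_lt hb]
  have d2 : (b + P.Q * (a + P.Q * p)) / P.Q = a + P.Q * p := by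
    rw [Nat.add_mul_div_left _ _ hQ0, Nat.div_eq_of_lt hb, zero_add]
  refine ⟨b + P.Q * (a + P.Q * p), ?_, ?_⟩
  · have h1 : P.Q * (p + 1) ≤ P.Q * P.Q := Nat.mul_le_mul_left _ hpQ
    have h2 : P.Q * (a + P.Q * p + 1) ≤ P.Q * (P.Q * P.Q) :=
      Nat.mul_le_mul_left _ (by rw [mul_add] at h1; omega)
    rw [mul_add _ _ 1] at h2
    rw [mul_assoc]
    omega
  · intro i hi hne
    by_contra hno
    refine hnot (mem_biUnion.mpr ⟨i, mem_range.mpr hi, ?_⟩)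
    simp only [bad, mem_filter, mem_product, mem_range]
    refine ⟨hab, hne, ?_⟩
    rintro ⟨g, hg1, hgF, hmat⟩
    refine hno ⟨g, hg1, hgF, ?_⟩
    unfold hash
    rwa [d1, d2, Nat.add_mul_mod_self_left, Nat.mod_eq_of_lt ha, Nat.add_mul_div_left _ _ hQ0,
      Nat.div_eq_of_lt ha, zero_add]

/-- Each block either takes as many bits as its capacity allows or completes the message. -/
theorem le_scan_pos (F : ℕ → ℕ) (z M i : ℕ) :
    min M (∑ j ∈ Finset.range i, (P.B - cellSum F (z + j * P.B) P.B - P.E)) ≤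
      (P.scan F z M i).pos := by
  induction i with
  | zero => simp [scan]
  | succ i ih =>
    rw [Finset.sum_range_succ]
    have h := P.scan_pos_le F z M i
    simp only [scan]
    split_ifs with h0
    · simp only [newLen] at h0
      omega
    · show _ ≤ (P.scan F z M i).pos + P.newLen F M (z + i * P.B) (P.scan F z M i).pos
      simp only [newLen]
      omega

/-- Summing capacities gives at least `nb * B` minus frozen cells minus `nb * E`. Truncated
subtraction only helps: a block with fewer than `E` free cells counts as 0, not as negative. -/
theorem scan_pos_eq {F : ℕ → ℕ} {z M nb : ℕ}
    (h : M + cellSum F z (nb * P.B) + nb * P.E ≤ nb * P.B) : (P.scan F z M nb).pos = M := by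
  have hsum : ∀ i, i * P.B ≤
      ∑ j ∈ Finset.range i, (P.B - cellSum F (z + j * P.B) P.B - P.E) +
        cellSum F z (i * P.B) + i * P.E := by
    intro i
    induction i with
    | zero => simp
    | succ i ih =>
      rw [Finset.sum_range_succ, add_mul, one_mul, cellSum_add, add_mul, one_mul]
      omega
  have h1 := le_scan_pos (P := P) F z M nb
  have h2 := P.scan_pos_le F z M nb
  have h3 := hsum nb
  omega

end Par

/-! ### Choice of the parameters, and the budget of lost cells -/

/-- The parameters for codes of length `N` and gap `1 / k`. -/
def mkPar (k N : ℕ) : Par where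
  N := N
  B := 16 * k * N.size
  W := 8 * k * (((N - 1) / (8 * k)).sqrt + 1)
  n := N / (8 * k * (((N - 1) / (8 * k)).sqrt + 1))
  E := 2 * N.size + 2
  M₀ := N - N / k

/-- Compute the parameters from `k` and `N` in the registers 0 and 1. -/
def paramProg : Prog :=
  .assign 3 0 ;; .assign 20 1 ;;
  .loop ((Expr.reg 20).lt (.reg 1 + 1)) (.assign 20 (2 * .reg 20) ;; .assign 3 (.reg 3 + 1)) ;;
  .assign 4 (8 * .reg 0 * .reg 3) ;; .assign 4 (.reg 4 + .reg 4) ;;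
  .assign 5 4 ;; .assign 20 0 ;;
  .loop ((Expr.reg 20).lt (.reg 4)) (.assign 5 (.reg 5 * 2) ;; .assign 20 (.reg 20 + 1)) ;;
  .assign 20 0 ;; .assign 21 (8 * .reg 0) ;;
  .loop ((Expr.reg 21 * .reg 20 * .reg 20).lt (.reg 1)) (.assign 20 (.reg 20 + 1)) ;;
  .assign 6 (.reg 21 * .reg 20) ;; .assign 7 (.reg 1 / .reg 6) ;; .assign 8 (6 * (.reg 4 + 2)) ;;
  .assign 9 (.reg 1 - .reg 1 / .reg 0) ;; .assign 3 (2 * .reg 3 + 2)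

/-- So the square root expression in `mkPar` is the least `c` with `8 * k * c * c ≥ N`, which the
program finds by counting. -/
theorem mul_sq_lt_iff {k N : ℕ} (hk : 0 < k) (hN : 0 < N) (i : ℕ) :
    8 * k * i * i < N ↔ i < ((N - 1) / (8 * k)).sqrt + 1 := by
  rw [Nat.lt_succ_iff, Nat.le_sqrt, Nat.le_div_iff_mul_le (by omega)]
  rw [show 8 * k * i * i = i * i * (8 * k) by ring]
  omega

theorem paramProg_run {k N : ℕ} {s : State} (hk : 0 < k) (hkN : k ≤ N) (h0 : s.reg 0 = k)
    (h1 : s.reg 1 = N) :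
    Run (mkPar k N).L paramProg s (3 * N.size + 3 * (mkPar k N).B + 2 * N + 25) fun s' =>
      (mkPar k N).InRegs s' ∧ s'.reg 2 = s.reg 2 ∧ s'.mem = s.mem := by
  set P := mkPar k N with hP
  have hL := Par.one_le_L (P := P)
  have hQ := Par.Q_le (P := P)
  have hQQ := Par.Q_mul_Q_le (P := P)
  have hQ3 := Par.Q_mul_self_lt (P := P)
  have hBQ := Par.B_lt_Q (P := P)
  have h4Q := Par.four_two_pow (P := P)
  have hsz : N.size ≤ P.B := by
    show N.size ≤ 16 * k * N.size
    exact Nat.le_mul_of_pos_left _ (by omega)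
  have hNB : N < 2 ^ P.B := (Nat.lt_size_self N).trans_le (Nat.pow_le_pow_right (by norm_num) hsz)
  have hBdef : 16 * k * N.size = P.B := rfl
  set c := ((N - 1) / (8 * k)).sqrt + 1 with hc
  have hcN : c ≤ N := by
    have h1 := Nat.sqrt_le_self ((N - 1) / (8 * k))
    have h2 := Nat.div_le_self (N - 1) (8 * k)
    omega
  have hkc : 8 * k * c ≤ P.Q * P.Q := by
    calc 8 * k * c ≤ 8 * N * N := Nat.mul_le_mul (Nat.mul_le_mul_left _ hkN) hcN
      _ ≤ 4 * 2 ^ P.B * (4 * 2 ^ P.B) := by nlinarith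
      _ = _ := by rw [h4Q]
  refine .assign_seq hL (by decide) (by omega) (by simp) ?_
  refine .assign_seq hL (by decide) (by omega) (by simp; omega) ?_
  refine Run.seq (m := 3 * N.size + 1) ?_ (by omega)
  refine (Run.loop (n := N.size) (m := 2) (fun i t => t.reg 20 = 2 ^ i ∧ t.reg 3 = i ∧
    i ≤ N.size ∧ s.Keep 3 t ∧ t.mem = s.mem) (Q := fun t => t.reg 3 = N.size ∧ s.Keep 3 t ∧
      t.mem = s.mem) hL (by decide) ?_ ?_).mono (by omega) ?_
  · rintro i t ⟨t20, t3, hi, hk', hm⟩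
    have t1 := hk' 1 (by norm_num)
    have hiff := Nat.lt_size (m := i) (n := N)
    rcases eq_or_lt_of_le hi with rfl | hlt
    · refine Or.inl ⟨?_, t3, hk', hm⟩
      simp [t20, t1, h1]
      exact Nat.lt_size_self N
    · have h2i := hiff.mp hlt
      refine Or.inr ⟨by simp [t20, t1, h1]; omega, hlt, ?_⟩
      refine .assign_seq hL (by decide) (by omega) (by simp [t20]; omega) ?_
      refine (Run.assign hL (by decide) (by simp [t3]; omega) ?_).mono (by omega) fun _ h => h
      exact ⟨by simp [t20, pow_succ, mul_comm], by simp [t3], hlt,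
        (hk'.setReg (by norm_num)).setReg (by norm_num), by simp [hm]⟩
  · exact ⟨by simp, by simp, by omega, ((State.Keep.refl _ _).setReg (by norm_num)).setReg
      (by norm_num), by simp⟩
  rintro a ⟨a3, hka, hma⟩
  have a0 := hka 0 (by norm_num)
  have a1 := hka 1 (by norm_num)
  have a2 := hka 2 (by norm_num)
  have hB8 : 8 * k * N.size ≤ P.B := by
    rw [← hBdef]; gcongr; norm_num
  refine .assign_seq hL (by decide) (by omega) (by simp [a0, h0, a3]; omega) ?_
  refine .assign_seq hL (by decide) (by omega) (by simp [a0, h0, a3]; omega) ?_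
  refine .assign_seq hL (by decide) (by omega) (by simp; omega) ?_
  refine .assign_seq hL (by decide) (by omega) (by simp) ?_
  refine Run.seq (m := 3 * P.B + 1) ?_ (by omega)
  -- The program doubles `8 * k * N.size` because `Expr.Small` weighs constants in unary, and the
  -- constant 16 would exceed its limit here.
  have hB2 : 8 * k * N.size + 8 * k * N.size = P.B := by rw [← hBdef]; ring
  refine (Run.loop (n := P.B) (m := 2) (fun i t => t.reg 20 = i ∧ t.reg 5 = 2 ^ (i + 2) ∧
    i ≤ P.B ∧ s.Keep 3 t ∧ t.reg 3 = N.size ∧ t.reg 4 = P.B ∧ t.mem = s.mem)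
    (Q := fun t => t.reg 5 = P.Q ∧ s.Keep 3 t ∧ t.reg 3 = N.size ∧ t.reg 4 = P.B ∧
      t.mem = s.mem) hL (by decide) ?_ ?_).mono (by omega) ?_
  · rintro i t ⟨t20, t5, hi, hk', t3, t4, hm⟩
    rcases eq_or_lt_of_le hi with rfl | hlt
    · exact Or.inl ⟨by simp [t20, t4], t5, hk', t3, t4, hm⟩
    · have hpow : 2 ^ (i + 2) * 2 ≤ P.Q := by
        rw [← pow_succ]; exact Nat.pow_le_pow_right (by norm_num) (by omega)
      refine Or.inr ⟨by simp [t20, t4, hlt], hlt, ?_⟩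
      refine .assign_seq hL (by decide) (by omega) (by simp [t5]; omega) ?_
      refine (Run.assign hL (by decide) (by simp [t20]; omega) ?_).mono (by omega) fun _ h => h
      exact ⟨by simp [t20], by simp [t5, pow_succ], hlt,
        (hk'.setReg (by norm_num)).setReg (by norm_num), by simp [t3], by simp [t4], by simp [hm]⟩
  · refine ⟨by simp, by simp, by omega, ?_, by simp [a3], by simp [a0, h0, a3, hB2], by simp [hma]⟩
    exact ((((hka.setReg (by norm_num)).setReg (by norm_num)).setReg (by norm_num)).setReg
      (by norm_num))
  rintro b ⟨b5, hkb, b3, b4, hmb⟩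
  have b0 := hkb 0 (by norm_num)
  have b1 := hkb 1 (by norm_num)
  refine .assign_seq hL (by decide) (by omega) (by simp) ?_
  refine .assign_seq hL (by decide) (by omega) (by simp [b0, h0]; omega) ?_
  refine Run.seq (m := 2 * N + 1) ?_ (by omega)
  refine (Run.loop (n := c) (m := 1) (fun i t => t.reg 20 = i ∧ i ≤ c ∧ t.reg 21 = 8 * k ∧
    s.Keep 3 t ∧ t.reg 3 = N.size ∧ t.reg 4 = P.B ∧ t.reg 5 = P.Q ∧ t.mem = s.mem)
    (Q := fun t => t.reg 20 = c ∧ t.reg 21 = 8 * k ∧ s.Keep 3 t ∧ t.reg 3 = N.size ∧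
      t.reg 4 = P.B ∧ t.reg 5 = P.Q ∧ t.mem = s.mem) hL (by decide) ?_ ?_).mono (by omega) ?_
  · rintro i t ⟨t20, hi, t21, hk', t3, t4, t5, hm⟩
    have t1 := hk' 1 (by norm_num)
    have hiff := mul_sq_lt_iff hk (hk.trans_le hkN) i
    rw [← hc] at hiff
    rcases eq_or_lt_of_le hi with rfl | hlt
    · refine Or.inl ⟨?_, t20, t21, hk', t3, t4, t5, hm⟩
      simp [t20, t21, t1, h1]
      omega
    · have := hiff.mpr hlt
      refine Or.inr ⟨by simp [t20, t21, t1, h1]; omega, hlt, ?_⟩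
      refine (Run.assign hL (by decide) (by simp [t20]; omega) ?_).mono (by omega) fun _ h => h
      exact ⟨by simp [t20], hlt, by simp [t21], hk'.setReg (by norm_num), by simp [t3],
        by simp [t4], by simp [t5], by simp [hm]⟩
  · exact ⟨by simp, by omega, by simp [b0, h0], (hkb.setReg (by norm_num)).setReg (by norm_num),
      by simp [b3], by simp [b4], by simp [b5], by simp [hmb]⟩
  rintro d ⟨d20, d21, hkd, d3, d4, d5, hmd⟩
  have d0 := hkd 0 (by norm_num)
  have d1 := hkd 1 (by norm_num)
  have d2 := hkd 2 (by norm_num)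
  have hdiv : N / (8 * k * c) ≤ N := Nat.div_le_self _ _
  have hQpos := Par.Q_pos (P := P)
  have hQQ' : 0 < P.Q * P.Q := Nat.mul_pos hQpos hQpos
  refine .assign_seq hL (by decide) (by omega) (by simp [d20, d21]; omega) ?_
  refine .assign_seq hL (by decide) (by omega) (by simp [d20, d21, d1, h1]; omega) ?_
  refine .assign_seq hL (by decide) (by omega) ?_ ?_
  · have hr : P.r < P.L := by unfold Par.r Par.L; omega
    have : P.L < 2 ^ P.L := Nat.lt_two_pow_self
    simp [d4]
    unfold Par.r at hr
    omega
  refine .assign_seq hL (by decide) (by omega) (lt_of_le_of_lt (b := N) (by simp [d1, h1])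
    (by omega)) ?_
  refine (Run.assign hL (by decide) (by simp [d3]; omega) ?_).mono (by omega) fun _ h => h
  refine ⟨⟨?_, ?_, ?_, ?_, ?_, ?_, ?_, ?_⟩, by simp [d2], by simp [hmd]⟩
  · simp [d1, h1]; rfl
  · simp [d3]; rfl
  · simp [d4]
  · simp [d5]
  · simp [d20, d21]; rfl
  · simp [d20, d21, d1, h1]; rfl
  · simp [d4]; rfl
  · simp [d0, d1, h1, h0]; rfl

/-- A largeness condition on the length `N`, in terms of the gap `1 / k`. -/
structure Large (k N : ℕ) : Prop where
  two_le : 2 ≤ k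
  sq_le : (7168 * k ^ 3 * N.size) ^ 2 ≤ N
  pos : 0 < N

theorem exists_large {k : ℕ} (hk : 2 ≤ k) : ∃ N₀, ∀ N > N₀, Large k N := by
  have ht := tendsto_pow_const_div_const_pow_of_one_lt 2 (r := (2 : ℝ)) (by norm_num)
  have hC : (0 : ℝ) < 1 / (2 * (7168 * k ^ 3) ^ 2) := by
    have : (0 : ℝ) < k := by exact_mod_cast (by omega : 0 < k)
    positivity
  obtain ⟨S, hS⟩ := (ht.eventually (gt_mem_nhds hC)).exists_forall_of_atTop
  refine ⟨2 ^ S, fun N hN => ⟨hk, ?_, (Nat.zero_le _).trans_lt hN⟩⟩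
  have hSN : S < N.size := Nat.lt_size.mpr hN.le
  have h := hS N.size hSN.le
  have hk0 : (0 : ℝ) < k := by exact_mod_cast (by omega : 0 < k)
  rw [div_lt_div_iff₀ (by positivity) (by positivity), one_mul] at h
  have h' : N.size ^ 2 * (2 * (7168 * k ^ 3) ^ 2) < 2 ^ N.size := by exact_mod_cast h
  obtain ⟨l, hl⟩ : ∃ l, N.size = l + 1 := ⟨N.size - 1, by omega⟩
  have h2 : 2 ^ l ≤ N := Nat.lt_size.mp (by omega)
  have h3 : 2 ^ N.size = 2 * 2 ^ l := by rw [hl, pow_succ, mul_comm]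
  have h4 : (7168 * k ^ 3 * N.size) ^ 2 * 2 = N.size ^ 2 * (2 * (7168 * k ^ 3) ^ 2) := by ring
  omega

namespace Large

variable {k N : ℕ}

theorem size_pos (h : Large k N) : 0 < N.size := Nat.size_pos.mpr h.pos

/-- With `c` as in `mul_sq_lt_iff`, `r = O(k log N)` and `W = 8 * k * c`, so the left side is at
most `3584 * k ^ 3 * N.size * c`. Since `c ≤ 2√N`, this is at most `N` under the condition of
`Large`, where `7168 = 2 * 3584`. -/
theorem width_bound (h : Large k N) :
    (((mkPar k N).r + 2) * (mkPar k N).W + (mkPar k N).B) * (4 * k) ≤ N := by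
  have hk := h.two_le
  have hs := h.size_pos
  have hN := h.pos
  set c := ((N - 1) / (8 * k)).sqrt + 1 with hc
  have hW : (mkPar k N).W = 8 * k * c := rfl
  have hB : (mkPar k N).B = 16 * k * N.size := rfl
  have hr : (mkPar k N).r = 6 * (16 * k * N.size + 2) := rfl
  have hcN : c * c ≤ 4 * N := by
    have h1 : 8 * k * (c - 1) * (c - 1) < N := (mul_sq_lt_iff (by omega) hN _).mpr (by omega)
    obtain ⟨d, hd⟩ : ∃ d, c = d + 1 := ⟨_, hc⟩
    rw [hd, Nat.add_sub_cancel] at h1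
    have h2 : d * d ≤ 8 * k * d * d := by
      rw [mul_assoc]; exact Nat.le_mul_of_pos_left _ (by omega)
    rw [hd]
    nlinarith
  have hks : 1 ≤ k * N.size := Nat.mul_pos (by omega) hs
  have hmain : (((mkPar k N).r + 2) * (mkPar k N).W + (mkPar k N).B) * (4 * k) ≤
      3584 * k ^ 3 * N.size * c := by
    rw [hr, hW, hB]
    have e1 : 6 * (16 * k * N.size + 2) + 2 ≤ 110 * (k * N.size) := by nlinarith
    have e2 : 16 * k * N.size ≤ 8 * k * N.size * (2 * k * c) := by
      have : 2 ≤ 2 * k * c := by nlinarith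
      calc 16 * k * N.size = 8 * k * N.size * 2 := by ring
        _ ≤ _ := Nat.mul_le_mul_left _ this
    calc _ ≤ (110 * (k * N.size) * (8 * k * c) + 8 * k * N.size * (2 * k * c)) * (4 * k) := by
          gcongr
      _ = 3584 * k ^ 3 * N.size * c := by ring
  refine hmain.trans ((Nat.pow_le_pow_iff_left (n := 2) (by norm_num)).mp ?_)
  calc (3584 * k ^ 3 * N.size * c) ^ 2 = (3584 * k ^ 3 * N.size) ^ 2 * (c * c) := by ring
    _ ≤ (3584 * k ^ 3 * N.size) ^ 2 * (4 * N) := by gcongr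
    _ = (7168 * k ^ 3 * N.size) ^ 2 * N := by ring
    _ ≤ N * N := Nat.mul_le_mul_right _ h.sq_le
    _ = N ^ 2 := by ring

theorem mul_B_le (h : Large k N) : (mkPar k N).B * (4 * k) ≤ N :=
  (Nat.mul_le_mul_right _ (Nat.le_add_left _ _)).trans h.width_bound

theorem mul_rW_le (h : Large k N) :
    ((mkPar k N).r + 2) * (mkPar k N).W * (4 * k) ≤ N :=
  (Nat.mul_le_mul_right _ (Nat.le_add_right _ _)).trans h.width_bound

theorem thirty_two_le_B (h : Large k N) : 32 ≤ (mkPar k N).B := by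
  have := Nat.mul_le_mul h.two_le h.size_pos
  show 32 ≤ 16 * k * N.size
  nlinarith

theorem k_le_B (h : Large k N) : 16 * k ≤ (mkPar k N).B := by
  have := h.size_pos
  exact Nat.le_mul_of_pos_right _ this

theorem eight_B_le (h : Large k N) : 8 * (mkPar k N).B ≤ N := by
  have := h.mul_B_le
  have := h.two_le
  nlinarith

theorem N_lt_two_pow (h : Large k N) : N < 2 ^ (mkPar k N).B := by
  have hk := h.two_le
  exact (Nat.lt_size_self N).trans_le (Nat.pow_le_pow_right (by norm_num)
    (Nat.le_mul_of_pos_left _ (by omega)))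

theorem W_pos (h : Large k N) : 0 < (mkPar k N).W :=
  Nat.mul_pos (by have := h.two_le; omega) (Nat.succ_pos _)

theorem basic (h : Large k N) : (mkPar k N).Basic where
  n_pos := by
    have h1 := h.mul_rW_le
    have h2 := h.W_pos
    have h3 := h.two_le
    refine Nat.div_pos ?_ h2
    change (mkPar k N).W ≤ N
    nlinarith [Nat.zero_le ((mkPar k N).r * (mkPar k N).W * (4 * k))]
  W_pos := h.W_pos
  nW_le := Nat.div_mul_le_self _ _
  N_lt := h.N_lt_two_pow
  M₀_lt := Nat.sub_le _ _
  M₀_gt := by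
    have h1 := h.eight_B_le
    have h2 := h.thirty_two_le_B
    have h3 : N / k ≤ N / 2 := Nat.div_le_div_left h.two_le (by norm_num)
    change 1 < N - N / k
    omega

/-- All losses together are less than the gap. -/
theorem budget (h : Large k N) : (mkPar k N).B + ((mkPar k N).r + 2) * (mkPar k N).W +
    2 * (mkPar k N).n * (mkPar k N).n + N / (mkPar k N).B * (mkPar k N).E < N / k := by
  have hk := h.two_le
  have hs := h.size_pos
  have hB32 := h.thirty_two_le_B
  have h1 := h.width_bound
  -- The width `8 * k * c` is chosen for this: `n ≤ c` turns the left side into at most `n * W`.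
  have h2 : 2 * (mkPar k N).n * (mkPar k N).n * (4 * k) ≤ N := by
    set c := ((N - 1) / (8 * k)).sqrt + 1 with hc
    have hW : (mkPar k N).W = 8 * k * c := rfl
    have hcc : N ≤ 8 * k * c * c := by
      have := (mul_sq_lt_iff (k := k) (by omega) h.pos c).not
      rw [← hc] at this
      omega
    have hnc : (mkPar k N).n ≤ c := by
      refine Nat.div_le_of_le_mul ?_
      exact hcc
    have hnW : (mkPar k N).n * (mkPar k N).W ≤ N := h.basic.nW_le
    calc 2 * (mkPar k N).n * (mkPar k N).n * (4 * k)
        ≤ 2 * (mkPar k N).n * c * (4 * k) := by gcongr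
      _ = (mkPar k N).n * (mkPar k N).W := by rw [hW]; ring
      _ ≤ N := hnW
  -- The factor 16 in `B` makes `E * (4 * k) ≤ B`, so each message block loses at most the fraction
  -- `1 / (4k)` of its cells.
  have h3 : N / (mkPar k N).B * (mkPar k N).E * (4 * k) ≤ N := by
    refine le_trans ?_ (Nat.div_mul_le_self N (mkPar k N).B)
    rw [mul_assoc]
    refine Nat.mul_le_mul_left _ ?_
    change (2 * N.size + 2) * (4 * k) ≤ 16 * k * N.size
    nlinarith
  have h4 := h.k_le_B
  have h5 := h.eight_B_le
  rw [← Nat.succ_le_iff, Nat.le_div_iff_mul_le (by omega), Nat.succ_eq_add_one]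
  -- Three losses of at most `N / (4k)` each leave a quarter of the gap, enough for the strict
  -- inequality and the rounding.
  refine Nat.le_of_mul_le_mul_left (c := 4) ?_ (by norm_num)
  linarith

/-- `E = 2 * N.size + 2` makes `2 ^ E` larger than `4 * N ^ 2`, which exceeds the union bound
because `(B + 1) * nb ≤ 2 * N`. The message fits since the space lost before `z`, a tail shorter
than `B` and `E` cells per block together stay below the gap. -/
theorem goodSeed (h : Large k N) {F v m : ℕ → ℕ} (hF : ∀ j, F j ≤ 1) (hv : ∀ j, v j ≤ 1)
    (hm : ∀ j, m j ≤ 1) {M z : ℕ} (hM : M + cellSum F 0 N = (mkPar k N).M₀) (hz : z ≤ N)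
    (hzF : z ≤ cellSum F 0 z + ((mkPar k N).r + 1) * (mkPar k N).W +
      2 * (mkPar k N).n * (mkPar k N).n) :
    ∃ nb sd, (∀ i, i < nb ↔ z + i * (mkPar k N).B + (mkPar k N).B ≤ N) ∧
      nb ≤ N / (mkPar k N).B ∧
      sd < (mkPar k N).Q * (mkPar k N).Q * (mkPar k N).Q ∧
      (mkPar k N).GoodSeed F v m z M nb sd ∧ ((mkPar k N).scan F z M nb).pos = M := by
  have hbudget := h.budget
  have hB8 := h.eight_B_le
  have hB32 := h.thirty_two_le_B
  have hM₀ : (mkPar k N).M₀ = N - N / k := rfl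
  have hE : (mkPar k N).E = 2 * N.size + 2 := rfl
  have hPN : (mkPar k N).N = N := rfl
  set P := mkPar k N
  have hNN : N * N < 2 ^ N.size * 2 ^ N.size :=
    Nat.mul_lt_mul'' (Nat.lt_size_self N) (Nat.lt_size_self N)
  have h2E : 2 ^ P.E = 4 * (2 ^ N.size * 2 ^ N.size) := by rw [hE, pow_add, two_mul, pow_add]; ring
  have hnb : ∀ i, i < (N - z) / P.B ↔ z + i * P.B + P.B ≤ N := by
    intro i
    rw [← Nat.succ_le_iff, Nat.le_div_iff_mul_le (by omega), Nat.succ_mul]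
    omega
  have hnbB : (N - z) / P.B * P.B ≤ N - z := Nat.div_mul_le_self _ _
  have hnbN : (N - z) / P.B ≤ N / P.B := Nat.div_le_div_right (Nat.sub_le _ _)
  have hlast : N < z + (N - z) / P.B * P.B + P.B := by
    have := (hnb ((N - z) / P.B)).not
    omega
  set nb := (N - z) / P.B
  obtain ⟨sd, hsd, hgood⟩ := Par.exists_goodSeed (P := P) hF hv hm (z := z) (M := M) (nb := nb)
    hnb h.pos (by omega) (by
      rw [h2E, hPN]
      have e1 : nb ≤ nb * P.B := Nat.le_mul_of_pos_right _ (by omega)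
      have e2 : (P.B + 1) * nb ≤ 2 * N := by rw [add_mul, mul_comm]; omega
      calc 2 * (N * (P.B + 1)) * nb = 2 * N * ((P.B + 1) * nb) := by ring
        _ ≤ 2 * N * (2 * N) := Nat.mul_le_mul_left _ e2
        _ = 4 * (N * N) := by ring
        _ < _ := by omega) (by
      rw [h2E, hPN]
      have : N * (P.B + 1) ≤ N * N := Nat.mul_le_mul_left _ (by omega)
      omega)
  refine ⟨nb, sd, hnb, hnbN, hsd, hgood, Par.scan_pos_eq ?_⟩
  have s1 := cellSum_add F 0 z (nb * P.B)
  have s2 := cellSum_add F 0 (z + nb * P.B) (N - (z + nb * P.B))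
  rw [show z + nb * P.B + (N - (z + nb * P.B)) = N by omega] at s2
  have s3 : nb * P.E ≤ N / P.B * P.E := Nat.mul_le_mul_right _ hnbN
  have s4 : N / k ≤ N := Nat.div_le_self _ _
  rw [zero_add] at s1 s2
  rw [show (P.r + 2) * P.W = (P.r + 1) * P.W + P.W by ring] at hbudget
  omega

/-- More than `N / k` cells are free, and at most `W` of them lie behind the `n` blocks. The rest is
more than `r` usable blocks and `n` unusable ones can contain. -/
theorem free_budget (h : Large k N) {F : ℕ → ℕ} {M : ℕ} (hM0 : 0 < M)
    (hM : M + cellSum F 0 N = (mkPar k N).M₀) :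
    cellSum F 0 ((mkPar k N).n * (mkPar k N).W) + (mkPar k N).r * (mkPar k N).W +
      2 * (mkPar k N).n * (mkPar k N).n < (mkPar k N).n * (mkPar k N).W := by
  have hbudget := h.budget
  have hM₀ : (mkPar k N).M₀ = N - N / k := rfl
  have hn : N < (mkPar k N).n * (mkPar k N).W + (mkPar k N).W := Nat.lt_div_mul_add h.W_pos
  have hnW : (mkPar k N).n * (mkPar k N).W ≤ N := h.basic.nW_le
  set P := mkPar k N
  have s2 := cellSum_add F 0 (P.n * P.W) (N - P.n * P.W)
  rw [Nat.add_sub_cancel' hnW] at s2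
  rw [show (P.r + 2) * P.W = P.r * P.W + P.W + P.W by ring] at hbudget
  omega

end Large

/-! ### The two programs and their costs -/

/-- The program which computes the encoder. -/
def encoder : Prog := .branch ((Expr.reg 0).lt 2) .skip (paramProg ;; Par.encodeProg)

/-- The program which computes the decoder. -/
def decoder : Prog := .branch ((Expr.reg 0).lt 2) .skip (paramProg ;; Par.decodeProg)

theorem Par.setBits_le_one {f : ℕ → ℕ} (hf : ∀ j, f j ≤ 1) (pos len y j : ℕ) :
    setBits f pos len y j ≤ 1 := by
  unfold setBits
  split_ifs
  · omega
  · exact hf j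

theorem Par.decOut_le_one (P : Par) (f : ℕ → ℕ) (j : ℕ) : P.decOut f j ≤ 1 := by
  unfold decOut
  generalize P.side f / P.Q / P.Q / P.Q = sd
  have key : ∀ t (d : DecState), (∀ j, d.out j ≤ 1) →
      ∀ j, ((P.decStep sd f)^[t] d).out j ≤ 1 := by
    intro t
    induction t with
    | zero => exact fun d hd => hd
    | succ t ih =>
      intro d hd
      rw [Function.iterate_succ_apply]
      exact ih _ fun j => setBits_le_one hd _ _ _ j
  exact key _ _ (fun _ => by simp [decInit]) j

namespace Large

variable {k N : ℕ}

theorem k_le (h : Large k N) : k ≤ N := by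
  have := h.k_le_B
  have := h.eight_B_le
  omega

theorem N_lt_two_pow_L (h : Large k N) : N < 2 ^ (mkPar k N).L :=
  h.N_lt_two_pow.trans_le (Nat.pow_le_pow_right (by norm_num) Par.B_lt_L.le)

theorem one_lt_two_pow_L : 1 < 2 ^ (mkPar k N).L :=
  Nat.one_lt_two_pow (by have := Par.one_le_L (P := mkPar k N); omega)

/-- The parameters take `O(N)` units, the side information `O(N + r * W)`, and the chain `N / B`
steps of `O(B)` units. All of this is `O(N)`. -/
theorem decoder_run (h : Large k N) {s : State} (h0 : s.reg 0 = k) (h1 : s.reg 1 = N)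
    (hf : ∀ j, s.mem 0 j ≤ 1) (h2 : s.mem 2 = fun _ => 0) :
    Run (mkPar k N).L decoder s (113 * N) fun s' =>
      s'.reg 2 = (mkPar k N).decLen ((mkPar k N).side (s.mem 0)) ∧
        s'.mem 2 = (mkPar k N).decOut (s.mem 0) := by
  have hL := Par.one_le_L (P := mkPar k N)
  have hk := h.two_le
  have hB8 := h.eight_B_le
  have hB32 := h.thirty_two_le_B
  have hsz : N.size ≤ (mkPar k N).B := Nat.le_mul_of_pos_left _ (by omega)
  have hrW : 8 * ((mkPar k N).r * (mkPar k N).W) ≤ N := by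
    have := h.mul_rW_le
    nlinarith [Nat.zero_le ((mkPar k N).r * (mkPar k N).W * (k - 2)),
      Nat.zero_le ((mkPar k N).W * k), Nat.mul_le_mul_left ((mkPar k N).r * (mkPar k N).W) hk]
  have hr : (mkPar k N).r ≤ N := by
    have := h.W_pos
    have : (mkPar k N).r ≤ (mkPar k N).r * (mkPar k N).W := Nat.le_mul_of_pos_right _ this
    omega
  have hNB : N / (mkPar k N).B * (mkPar k N).B ≤ N := Nat.div_mul_le_self _ _
  have hNB' : N / (mkPar k N).B ≤ N := Nat.div_le_self _ _
  have key : 3 * N.size + 3 * (mkPar k N).B + 2 * N + 25 + (3 * N + 34 +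
      (mkPar k N).r * (3 * (mkPar k N).W + 20) +
      N / (mkPar k N).B * (7 * (mkPar k N).B + 14)) + 1 ≤ 113 * N := by
    have e1 : (mkPar k N).r * (3 * (mkPar k N).W + 20) =
      3 * ((mkPar k N).r * (mkPar k N).W) + 20 * (mkPar k N).r := by ring
    have e2 : N / (mkPar k N).B * (7 * (mkPar k N).B + 14) =
      7 * (N / (mkPar k N).B * (mkPar k N).B) + 14 * (N / (mkPar k N).B) := by ring
    omega
  refine (Run.branch hL (by decide) (fun hne => absurd hne ?_) (fun _ => ?_)).mono key
    fun _ h => h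
  · simp [h0]; omega
  refine Run.seq (m := 3 * N.size + 3 * (mkPar k N).B + 2 * N + 25) ?_ (by omega)
  refine (paramProg_run (by omega) h.k_le h0 h1).mono le_rfl ?_
  rintro t ⟨hP, -, hm⟩
  have := Par.decodeProg_run h.basic hP (by simpa [hm] using hf) (by simpa [hm] using h2)
  rw [hm] at this
  refine this.mono ?_ fun _ h => h
  rw [Nat.add_sub_cancel_left]
  exact le_rfl

/-- The search dominates: `Q ^ 3` seeds, at most `N ≤ Q` blocks, `Q` words and `O(B)` units for each
word, hence `O(Q ^ 6)`. One more factor `Q ≥ 1024` absorbs the constants. -/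
theorem encoder_ticks (h : Large k N) (n W : ℕ) (hn : n ≤ N) (hW : W ≤ N) :
    3 * N.size + 3 * (mkPar k N).B + 2 * N + 25 + (2 * (n * (13 * W + 3 * N + 40) + 10) +
      (mkPar k N).Q * (mkPar k N).Q * (mkPar k N).Q *
        (N * ((mkPar k N).Q * (12 * (mkPar k N).B + 15) + 3 * (mkPar k N).B + 25) + 20) + 6) + 1 ≤
      (mkPar k N).Q ^ 7 := by
  have hk := h.two_le
  have hB32 := h.thirty_two_le_B
  have hsz : N.size ≤ (mkPar k N).B := Nat.le_mul_of_pos_left _ (by omega)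
  have hQ : 1024 ≤ (mkPar k N).Q :=
    calc 1024 = 2 ^ 10 := by norm_num
      _ ≤ _ := Nat.pow_le_pow_right (by norm_num) (by omega)
  have hBQ := Par.B_lt_Q (P := mkPar k N)
  have hNQ : N ≤ (mkPar k N).Q := by
    have := Par.four_two_pow (P := mkPar k N)
    have := h.N_lt_two_pow
    omega
  generalize (mkPar k N).Q = q at *
  generalize (mkPar k N).B = B at *
  have hB' : B ≤ q := by omega
  have hs' : N.size ≤ q := by omega
  have hn' : n ≤ q := by omega
  have hW' : W ≤ q := by omega
  have p1 : q ≤ q ^ 6 := Nat.le_self_pow (by norm_num) _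
  have p0 : 1 ≤ q ^ 6 := Nat.one_le_pow _ _ (by omega)
  have p2 : q ^ 2 ≤ q ^ 6 := Nat.pow_le_pow_right (by omega) (by norm_num)
  have p3 : q ^ 3 ≤ q ^ 6 := Nat.pow_le_pow_right (by omega) (by norm_num)
  have p4 : q ^ 4 ≤ q ^ 6 := Nat.pow_le_pow_right (by omega) (by norm_num)
  have p5 : q ^ 5 ≤ q ^ 6 := Nat.pow_le_pow_right (by omega) (by norm_num)
  calc _ ≤ 3 * q + 3 * q + 2 * q + 25 + (2 * (q * (13 * q + 3 * q + 40) + 10) +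
        q * q * q * (q * (q * (12 * q + 15) + 3 * q + 25) + 20) + 6) + 1 := by gcongr
    _ = 12 * q ^ 6 + 15 * q ^ 5 + 3 * q ^ 5 + 25 * q ^ 4 + 20 * q ^ 3 + 32 * q ^ 2 + 88 * q +
          52 := by
        ring
    _ ≤ 1024 * q ^ 6 := by linarith
    _ ≤ q * q ^ 6 := Nat.mul_le_mul_right _ hQ
    _ = q ^ 7 := by ring

theorem encoder_run (h : Large k N) {s : State} {M : ℕ} (h0 : s.reg 0 = k) (h1 : s.reg 1 = N)
    (h2 : s.reg 2 = M) (hf : ∀ j, s.mem 0 j ≤ 1) (hF : ∀ j, s.mem 1 j ≤ 1)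
    (hm : ∀ j, s.mem 2 j ≤ 1) (hM0 : 0 < M) (hi : 0 < cellSum (s.mem 1) 0 N)
    (hM : M + cellSum (s.mem 1) 0 N = (mkPar k N).M₀) :
    Run (mkPar k N).L encoder s ((mkPar k N).Q ^ 7) fun s' => ∃ g,
      s'.mem 0 = g ∧ (∀ j, g j ≤ 1) ∧ (∀ j, N ≤ j ∨ s.mem 1 j ≠ 0 → g j = s.mem 0 j) ∧
      (mkPar k N).decLen ((mkPar k N).side g) = M ∧
      ∀ j < M, (mkPar k N).decOut g j = s.mem 2 j := by
  have hL := Par.one_le_L (P := mkPar k N)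
  have hk := h.two_le
  have hb := h.basic
  refine (Run.branch hL (by decide) (fun hne => absurd hne ?_) (fun _ => ?_)).mono
    (h.encoder_ticks (mkPar k N).n (mkPar k N).W hb.n_le hb.W_le) fun _ h => h
  · simp [h0]; omega
  refine Run.seq (m := 3 * N.size + 3 * (mkPar k N).B + 2 * N + 25) ?_ (by omega)
  refine (paramProg_run (by omega) h.k_le h0 h1).mono le_rfl ?_
  rintro t ⟨hP, ht2, htm⟩
  have := Par.encodeProg_run (M := M) hb hP (by have := h.thirty_two_le_B; omega)
    (by simpa [htm] using hf) (by simpa [htm] using hF) (by rw [htm]; exact h.free_budget hM0 hM)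
    hM0 (by omega) (by rw [ht2, h2])
    (by rw [htm]; exact fun z hz hzF => h.goodSeed hF hf hm hM hz hzF)
  rw [htm] at this
  refine this.mono ?_ fun _ h => h
  rw [Nat.add_sub_cancel_left]
  exact le_rfl

end Large

end RAM

/-! ### From the programs to a code -/

theorem mem_bitStrings {m : ℕ} {l : List Bool} : l ∈ bitStrings m ↔ l.length = m := by
  simp only [bitStrings, Finset.mem_image, Finset.mem_univ, true_and]
  constructor
  · rintro ⟨f, rfl⟩; simp
  · rintro rfl; exact ⟨l.get, List.ofFn_get l⟩

theorem card_bitStrings (m : ℕ) : (bitStrings m).card = 2 ^ m := by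
  rw [bitStrings, Finset.card_image_of_injective _ List.ofFn_injective]
  simp

namespace StrongStuckAtCode

open RAM

variable {k N : ℕ}

/-- The cells which hold a vector. -/
def cells (w : Fin N → Bool) (j : ℕ) : ℕ := if h : j < N then (w ⟨j, h⟩).toNat else 0

theorem cells_le_one (w : Fin N → Bool) (j : ℕ) : cells w j ≤ 1 := by
  unfold cells; split_ifs
  · exact Bool.toNat_le _
  · omega

theorem toNat_decide_eq_one {x : ℕ} (hx : x ≤ 1) : (decide (x = 1)).toNat = x := by
  interval_cases x <;> rfl

theorem cellSum_cells (F : Finset (Fin N)) :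
    cellSum (cells fun j => decide (j ∈ F)) 0 N = F.card := by
  rw [cellSum, Finset.sum_range, Finset.card_eq_sum_ones, ← Finset.sum_filter_add_sum_filter_not
    Finset.univ (· ∈ F)]
  rw [Finset.sum_congr rfl (g := fun _ => 1) fun x hx => by
      simp [cells, (Finset.mem_filter.mp hx).2],
    Finset.sum_congr (s₁ := Finset.univ.filter (· ∉ F)) rfl (g := fun _ => 0) fun x hx => by
      simp [cells, (Finset.mem_filter.mp hx).2]]
  simp

/-- The message which is decoded from a vector. -/
def decode (k : ℕ) (w : Fin N → Bool) : List Bool :=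
  List.ofFn fun j : Fin ((mkPar k N).decLen ((mkPar k N).side (cells w))) =>
    decide ((mkPar k N).decOut (cells w) j = 1)

theorem length_decode (w : Fin N → Bool) :
    (decode k w).length = (mkPar k N).decLen ((mkPar k N).side (cells w)) := List.length_ofFn

theorem exists_decoder_exec (h : Large k N) (w : Fin N → Bool) :
    ∃ t s, Exec decoder (decInput k w) t s ∧ t ≤ 113 * N * (128 * (mkPar k N).L) ∧
      s.reg 2 = (decode k w).length ∧
      ∀ j : Fin (decode k w).length, s.mem 2 j = ((decode k w).get j).toNat := by
  have h1 := Large.one_lt_two_pow_L (k := k) (N := N)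
  have hN := h.N_lt_two_pow_L
  have hk := h.k_le
  have hmem : (decInput k w).mem 0 = cells w := by funext j; simp [decInput, cells]
  have hbdd : (decInput k w).Bdd (mkPar k N).L := by
    refine ⟨fun r => ?_, fun a j => ?_⟩
    · simp only [decInput]; split_ifs <;> omega
    · by_cases ha : a = 0
      · rw [ha, hmem]; exact (cells_le_one w j).trans_lt h1
      · simp [decInput, ha]
  obtain ⟨t, s, he, ht, -, hr, hm⟩ := h.decoder_run (s := decInput k w) rfl rfl
    (by rw [hmem]; exact cells_le_one w) (by funext j; simp [decInput]) hbdd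
  rw [hmem] at hr hm
  refine ⟨t, s, he, ht, by rw [hr, length_decode], fun j => ?_⟩
  have hget : (decode k w).get j = decide ((mkPar k N).decOut (cells w) j = 1) :=
    List.get_ofFn _ _
  rw [hm, hget, toNat_decide_eq_one ((mkPar k N).decOut_le_one _ _)]

theorem exists_encoder_exec (h : Large k N) {i : ℕ} (hi : 0 < i) (hiM : i < (mkPar k N).M₀)
    (v : Fin N → Bool) (F : Finset (Fin N)) (hF : F.card = i) (m : List Bool)
    (hm : m.length = (mkPar k N).M₀ - i) :
    ∃ (w : Fin N → Bool) (t : ℕ) (s : State), Exec encoder (encInput k v F m) t s ∧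
      t ≤ (mkPar k N).Q ^ 7 * (128 * (mkPar k N).L) ∧ (∀ j : Fin N, s.mem 0 j = (w j).toNat) ∧
      (∀ j ∈ F, w j = v j) ∧ decode k w = m := by
  have h1 := Large.one_lt_two_pow_L (k := k) (N := N)
  have hN := h.N_lt_two_pow_L
  have hk := h.k_le
  have hM₀ := h.basic.M₀_lt
  change (mkPar k N).M₀ ≤ N at hM₀
  have hm0 : (encInput k v F m).mem 0 = cells v := by funext j; simp [encInput, cells]
  have hm1 : (encInput k v F m).mem 1 = cells fun j => decide (j ∈ F) := by
    funext j; simp [encInput, cells]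
  have hm2 : (encInput k v F m).mem 2 = fun j => (m.getD j false).toNat := by
    funext j; simp [encInput]
  have hb2 : ∀ j, (encInput k v F m).mem 2 j ≤ 1 := by
    rw [hm2]; exact fun j => Bool.toNat_le _
  have hbdd : (encInput k v F m).Bdd (mkPar k N).L := by
    refine ⟨fun r => ?_, fun a j => ?_⟩
    · simp only [encInput]; split_ifs <;> omega
    · by_cases ha : a = 0
      · rw [ha, hm0]; exact (cells_le_one v j).trans_lt h1
      by_cases ha1 : a = 1
      · rw [ha1, hm1]; exact (cells_le_one _ j).trans_lt h1
      by_cases ha2 : a = 2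
      · rw [ha2]; exact (hb2 j).trans_lt h1
      · simp [encInput, ha, ha1, ha2]
  obtain ⟨t, s, he, ht, -, g, hg, hg1, hgv, hlen, hout⟩ := h.encoder_run (s := encInput k v F m)
    (M := m.length) rfl rfl rfl (by rw [hm0]; exact cells_le_one v)
    (by rw [hm1]; exact cells_le_one _) hb2 (by omega) (by rw [hm1, cellSum_cells]; omega)
    (by rw [hm1, cellSum_cells]; omega) hbdd
  -- No cell behind the vector was changed, so the decoder starts from exactly the array the encoder
  -- left.
  have hw : cells (fun j : Fin N => decide (g j = 1)) = g := by
    funext j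
    unfold cells
    split_ifs with hj
    · exact toNat_decide_eq_one (hg1 j)
    · rw [hgv j (Or.inl (by omega)), hm0, cells, dif_neg hj]
  refine ⟨fun j => decide (g j = 1), t, s, he, ht, fun j => ?_, fun j hj => ?_, ?_⟩
  · rw [hg]
    exact (toNat_decide_eq_one (hg1 j)).symm
  · change decide (g j = 1) = v j
    rw [hgv j (Or.inr (by rw [hm1]; simp [cells, hj])), hm0]
    simp [cells]
  · refine List.ext_get (by rw [length_decode, hw, hlen]) fun j hj1 hj2 => ?_
    simp only [decode, List.get_ofFn, Fin.val_cast, hw]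
    rw [hout j hj2, hm2]
    simp [hj2]

/-- The encoding map is defined as the output of the program. For `i ≥ N - N / k` the message set is
empty, which is allowed because no rate is required there. -/
theorem exists_code_of_large (h : Large k N) : ∃ C : StrongStuckAtCode N,
    (∀ i < N - N / k, C.messages i = bitStrings (N - N / k - i)) ∧
    C.EncodesWithin encoder k (((mkPar k N).Q ^ 7 * (128 * (mkPar k N).L) : ℕ) : ℝ) ∧
    C.DecodesWithin decoder k ((113 * N * (128 * (mkPar k N).L) : ℕ) : ℝ) := by
  classical
  have hM₀ : (mkPar k N).M₀ = N - N / k := rfl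
  have hkey := fun i (hi : i ∈ Finset.Icc 1 N) (v : Fin N → Bool) F (hF : F.card = i)
      (m : List Bool) (hm : i < N - N / k ∧ m.length = N - N / k - i) =>
    exists_encoder_exec h (Finset.mem_Icc.mp hi).1 hm.1 v F hF m hm.2
  choose! w hw using hkey
  have hmem : ∀ {i m}, m ∈ (if i < N - N / k then bitStrings (N - N / k - i) else ∅) →
      i < N - N / k ∧ m.length = N - N / k - i := by
    intro i m hm
    split_ifs at hm with hi
    · exact ⟨hi, mem_bitStrings.mp hm⟩
    · simp at hm
  refine ⟨{
    messages := fun i => if i < N - N / k then bitStrings (N - N / k - i) else ∅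
    enc := w
    dec := decode k
    dec_mem := ?_
    consistent := ?_
    decodable := ?_ }, fun i hi => if_pos hi, ?_, ?_⟩
  · intro x
    have h1 := Par.decLen_le h.basic ((mkPar k N).side (cells x))
    have h2 := Par.decLen_pos (P := mkPar k N) ((mkPar k N).side (cells x))
    rw [← length_decode, hM₀] at h1
    rw [← length_decode] at h2
    have h3 : N / k ≤ N := Nat.div_le_self _ _
    have h4 : (decode k x).length ≤ N - N / k := h1.le
    -- The length of a message determines the number of frozen cells for which it is meant.
    refine ⟨N - N / k - (decode k x).length,
      Finset.mem_Icc.mpr ⟨by omega, (Nat.sub_le _ _).trans (Nat.sub_le _ _)⟩, ?_⟩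
    rw [if_pos (by omega), mem_bitStrings]
    omega
  · intro i hi v F hF m hm
    obtain ⟨t, s, -, -, -, hc, -⟩ := hw i hi v F hF m (hmem hm)
    exact hc
  · intro i hi v F hF m hm
    obtain ⟨t, s, -, -, -, -, hd⟩ := hw i hi v F hF m (hmem hm)
    exact hd
  · intro i hi v F hF m hm
    obtain ⟨t, s, he, ht, hs, -, -⟩ := hw i hi v F hF m (hmem hm)
    exact ⟨t, s, he, by exact_mod_cast ht, hs⟩
  · intro x
    obtain ⟨t, s, he, ht, hs⟩ := exists_decoder_exec h x
    exact ⟨t, s, he, by exact_mod_cast ht, hs⟩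

/-- If there is no rate to achieve, the code with the empty message suffices. -/
theorem exists_trivial_code (hN : 0 < N) : ∃ C : StrongStuckAtCode N,
    C.EncodesWithin encoder 1 8 ∧ C.DecodesWithin decoder 1 8 := by
  classical
  refine ⟨{
    messages := fun i => if i = 1 then {[]} else ∅
    enc := fun _ v _ _ => v
    dec := fun _ => []
    dec_mem := fun w => ⟨1, Finset.mem_Icc.mpr ⟨le_rfl, hN⟩, by simp⟩
    consistent := fun _ _ _ _ _ _ _ _ _ => rfl
    decodable := ?_ }, ?_, ?_⟩
  · intro i _ v F _ m hm
    split_ifs at hm with hi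
    · exact (Finset.mem_singleton.mp hm).symm
    · simp at hm
  · intro i _ v F _ m _
    refine ⟨_, _, Exec.branch_true ?_ (Exec.skip _), ?_, fun j => ?_⟩
    · change (if 1 < 2 then 1 else 0) ≠ 0
      norm_num
    · change (((len 1 + len 2 + len 1 + len 2 + 1 + 1 : ℕ) : ℝ)) ≤ 8
      simp [len]; norm_num
    · simp [encInput]
  · intro x
    -- Register 2 keeps its initial value 0, the length of the empty message.
    refine ⟨_, _, Exec.branch_true ?_ (Exec.skip _), ?_, rfl, fun j => absurd j.2 (by simp)⟩
    · change (if 1 < 2 then 1 else 0) ≠ 0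
      norm_num
    · change (((len 1 + len 2 + len 1 + len 2 + 1 + 1 : ℕ) : ℝ)) ≤ 8
      simp [len]; norm_num

end StrongStuckAtCode

/-! ### Bounds in terms of `ε` -/

section

open RAM StrongStuckAtCode Filter

theorem StrongStuckAtCode.EncodesWithin.mono {N : ℕ} {C : StrongStuckAtCode N} {p : Prog} {k : ℕ}
    {T T' : ℝ} (h : C.EncodesWithin p k T) (hT : T ≤ T') : C.EncodesWithin p k T' := by
  intro i hi v F hF m hm
  obtain ⟨t, s, he, ht, hs⟩ := h i hi v F hF m hm
  exact ⟨t, s, he, ht.trans hT, hs⟩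

theorem StrongStuckAtCode.DecodesWithin.mono {N : ℕ} {C : StrongStuckAtCode N} {p : Prog} {k : ℕ}
    {T T' : ℝ} (h : C.DecodesWithin p k T) (hT : T ≤ T') : C.DecodesWithin p k T' := by
  intro w
  obtain ⟨t, s, he, ht, hs⟩ := h w
  exact ⟨t, s, he, ht.trans hT, hs⟩

namespace RAM.Large

variable {k N : ℕ}

theorem two_pow_size_le (h : Large k N) : 2 ^ N.size ≤ 2 * N := by
  have hs := h.size_pos
  obtain ⟨l, hl⟩ : ∃ l, N.size = l + 1 := ⟨N.size - 1, by omega⟩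
  have h2 : 2 ^ l ≤ N := Nat.lt_size.mp (by omega)
  rw [hl, pow_succ]
  omega

/-- The cost is at most `Q ^ 9 = 2 ^ (9 * (B + 2))`. Here `9 * (16 * k * N.size + 2) ≤ 153 * k *
N.size` because `k * N.size ≥ 2`, and `2 ^ N.size ≤ 2 * N ≤ N ^ 2` doubles 153 to 306. -/
theorem encoder_cost_le (h : Large k N) :
    (mkPar k N).Q ^ 7 * (128 * (mkPar k N).L) ≤ N ^ (306 * k) := by
  have hk := h.two_le
  have hB32 := h.thirty_two_le_B
  have hB8 := h.eight_B_le
  have hB : (mkPar k N).B = 16 * k * N.size := rfl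
  have hks : 2 * 1 ≤ k * N.size := Nat.mul_le_mul hk h.size_pos
  have hL : 128 * (mkPar k N).L ≤ (mkPar k N).Q ^ 2 := by
    have h1 : (mkPar k N).B + 2 ≤ (mkPar k N).Q := Nat.lt_two_pow_self.le
    have h2 : 1024 ≤ (mkPar k N).Q :=
      calc 1024 = 2 ^ 10 := by norm_num
        _ ≤ _ := Nat.pow_le_pow_right (by norm_num) (by omega)
    calc 128 * (mkPar k N).L = 1024 * ((mkPar k N).B + 2) := by unfold Par.L; ring
      _ ≤ (mkPar k N).Q * (mkPar k N).Q := Nat.mul_le_mul h2 h1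
      _ = _ := by ring
  have hN2 : 2 ^ N.size ≤ N ^ 2 := h.two_pow_size_le.trans (by
    rw [sq]; exact Nat.mul_le_mul_right _ (by omega))
  calc (mkPar k N).Q ^ 7 * (128 * (mkPar k N).L)
      ≤ (mkPar k N).Q ^ 7 * (mkPar k N).Q ^ 2 := Nat.mul_le_mul_left _ hL
    _ = 2 ^ (9 * ((mkPar k N).B + 2)) := by rw [← pow_add, Par.Q_pow]
    _ ≤ 2 ^ (N.size * (153 * k)) := Nat.pow_le_pow_right (by norm_num) (by rw [hB]; nlinarith)
    _ = (2 ^ N.size) ^ (153 * k) := pow_mul _ _ _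
    _ ≤ (N ^ 2) ^ (153 * k) := Nat.pow_le_pow_left hN2 _
    _ = N ^ (306 * k) := by rw [← pow_mul]; congr 1; ring

theorem decoder_cost_le (h : Large k N) :
    113 * N * (128 * (mkPar k N).L) ≤ 2000000 * N * (k * N.size) := by
  have hks : 2 * 1 ≤ k * N.size := Nat.mul_le_mul h.two_le h.size_pos
  have hL : (mkPar k N).L = 8 * (16 * k * N.size + 2) := rfl
  calc 113 * N * (128 * (mkPar k N).L)
      = 115712 * N * (16 * (k * N.size) + 2) := by rw [hL]; ring
    _ ≤ 115712 * N * (17 * (k * N.size)) := Nat.mul_le_mul_left _ (by omega)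
    _ = 1967104 * N * (k * N.size) := by ring
    _ ≤ _ := by gcongr; norm_num

end RAM.Large

theorem Nat.size_le_two_mul_logb {N : ℕ} (hN : 2 ≤ N) : (N.size : ℝ) ≤ 2 * Real.logb 2 N := by
  have hN0 : (0 : ℝ) < N := by exact_mod_cast (by omega : 0 < N)
  have hs : 1 < N.size := Nat.lt_size.mpr (by simpa using hN)
  obtain ⟨l, hl⟩ : ∃ l, N.size = l + 1 := ⟨N.size - 1, by omega⟩
  have h2 : 2 ^ l ≤ N := Nat.lt_size.mp (by omega)
  have h3 : (l : ℝ) ≤ Real.logb 2 N := by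
    rw [Real.le_logb_iff_rpow_le (by norm_num) hN0, Real.rpow_natCast]
    exact_mod_cast h2
  have h4 : (1 : ℝ) ≤ l := by exact_mod_cast (by omega : 1 ≤ l)
  rw [hl]; push_cast; linarith

/-- Rounding up costs at most a factor 2 because `1 / ε > 1`; this converts bounds in `k` into
bounds in `1 / ε`. -/
theorem natCeil_one_div_le {ε : ℝ} (h0 : 0 < ε) (h1 : ε < 1) : (⌈1 / ε⌉₊ : ℝ) ≤ 2 * (1 / ε) := by
  have h2 := (Nat.ceil_lt_add_one (by positivity : 0 ≤ 1 / ε)).le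
  have h3 : 1 < 1 / ε := (one_lt_div h0).mpr h1
  linarith

/-- From `k ≥ 1 / ε` it follows that `N / k ≤ ε * N`, so every `i < (1 - ε) * N` has the full
message set. The exponent is `306 * k ≤ 612 / ε`; in the decoder's constant, `k ≤ 2 / ε` and `N.size
≤ 2 * logb 2 N` contribute a factor 2 each. -/
theorem exists_gapped_code_of_lt_one {ε : ℝ} (h0 : 0 < ε) (h1 : ε < 1) {N : ℕ}
    (h : Large ⌈1 / ε⌉₊ N) : ∃ C : StrongStuckAtCode N,
      C.IsGapped ε ∧
      (∀ i ∈ Finset.Icc 1 N, (i : ℝ) < (1 - ε) * N →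
        C.messages i = bitStrings (N - N / ⌈1 / ε⌉₊ - i)) ∧
      C.EncodesWithin encoder ⌈1 / ε⌉₊ ((N : ℝ) ^ (((1000 : ℕ) : ℝ) / ε)) ∧
      C.DecodesWithin decoder ⌈1 / ε⌉₊
        (((8000000 : ℕ) : ℝ) * (N * Real.logb 2 N ^ 1 * (1 / ε) ^ 1)) := by
  have hk2 := natCeil_one_div_le h0 h1
  have hk1 : 1 / ε ≤ (⌈1 / ε⌉₊ : ℝ) := Nat.le_ceil _
  obtain ⟨C, hmes, henc, hdec⟩ := exists_code_of_large h
  have hcost1 := h.encoder_cost_le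
  have hcost2 := h.decoder_cost_le
  have hN0 := h.pos
  have hNB := h.eight_B_le
  have hB32 := h.thirty_two_le_B
  have hk := h.two_le
  set k := ⌈1 / ε⌉₊
  have hN0' : (0 : ℝ) < N := by exact_mod_cast hN0
  have hk0 : (0 : ℝ) < k := by exact_mod_cast (by omega : 0 < k)
  have hdiv : ((N / k : ℕ) : ℝ) ≤ ε * N := by
    refine Nat.cast_div_le.trans ?_
    rw [div_le_iff₀ hk0]
    have : 1 ≤ ε * k := by rwa [div_le_iff₀' h0] at hk1
    nlinarith
  have hcast : ((N - N / k : ℕ) : ℝ) = N - (N / k : ℕ) := Nat.cast_sub (Nat.div_le_self _ _)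
  have hlt : ∀ i : ℕ, (i : ℝ) < (1 - ε) * N → i < N - N / k := by
    intro i hi
    have : (i : ℝ) < (N - N / k : ℕ) := by rw [hcast]; linarith
    exact_mod_cast this
  refine ⟨C, ?_, fun i _ hi => hmes i (hlt i hi), henc.mono ?_, hdec.mono ?_⟩
  · intro ρ _ hρ i _ hi
    have hi' : i < N - N / k := hlt i (by rw [hi]; exact mul_lt_mul_of_pos_right hρ hN0')
    rw [rate, hmes i hi', card_bitStrings, Nat.cast_pow, Nat.cast_ofNat,
      ← Real.rpow_natCast, Real.logb_rpow (by norm_num) (by norm_num), le_div_iff₀ hN0',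
      Nat.cast_sub hi'.le, hcast, hi]
    linarith
  · have hN1 : (1 : ℝ) ≤ N := by exact_mod_cast hN0
    calc _ ≤ ((N ^ (306 * k) : ℕ) : ℝ) := by exact_mod_cast hcost1
      _ = (N : ℝ) ^ ((306 * k : ℕ) : ℝ) := by rw [Real.rpow_natCast, Nat.cast_pow]
      _ ≤ _ := Real.rpow_le_rpow_of_exponent_le hN1 (by
        have : 0 < 1 / ε := by positivity
        push_cast
        rw [← mul_one_div 1000 ε]
        linarith)
  · have hlog := Nat.size_le_two_mul_logb (N := N) (by omega)
    have hε : 0 < 1 / ε := by positivity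
    calc _ ≤ ((2000000 * N * (k * N.size) : ℕ) : ℝ) := by exact_mod_cast hcost2
      _ = 2000000 * N * (k * N.size) := by push_cast; ring
      _ ≤ 2000000 * N * ((2 * (1 / ε)) * (2 * Real.logb 2 N)) := by gcongr
      _ = _ := by push_cast; ring

/-- No defect fraction lies in `(0, 1 - ε)`, so the conditions on rates and message sets are void.
The threshold only ensures that the time bounds, which shrink as `ε` grows, still allow the constant
cost 8. -/
theorem exists_gapped_code_of_one_le {ε : ℝ} (h1 : 1 ≤ ε) : ∃ N₀ : ℕ, ∀ N > N₀,
    ∃ C : StrongStuckAtCode N,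
      C.IsGapped ε ∧
      (∀ i ∈ Finset.Icc 1 N, (i : ℝ) < (1 - ε) * N →
        C.messages i = bitStrings (N - N / ⌈1 / ε⌉₊ - i)) ∧
      C.EncodesWithin encoder ⌈1 / ε⌉₊ ((N : ℝ) ^ (((1000 : ℕ) : ℝ) / ε)) ∧
      C.DecodesWithin decoder ⌈1 / ε⌉₊
        (((8000000 : ℕ) : ℝ) * (N * Real.logb 2 N ^ 1 * (1 / ε) ^ 1)) := by
  have h0 : 0 < ε := by linarith
  have hk : ⌈1 / ε⌉₊ = 1 := by
    rw [Nat.ceil_eq_iff (by norm_num)]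
    refine ⟨by simpa using h0, ?_⟩
    rw [div_le_iff₀ h0]; simpa using h1
  have hpow : Tendsto (fun N : ℕ => (N : ℝ) ^ (((1000 : ℕ) : ℝ) / ε)) atTop atTop :=
    (tendsto_rpow_atTop (by positivity)).comp tendsto_natCast_atTop_atTop
  obtain ⟨N₁, hN₁⟩ := (hpow.eventually_ge_atTop 8).exists_forall_of_atTop
  refine ⟨max N₁ (max 2 ⌈ε⌉₊), fun N hN => ?_⟩
  have hN1 : N₁ ≤ N := by have := le_max_left N₁ (max 2 ⌈ε⌉₊); omega
  have hN2 : 2 ≤ N := by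
    have := (le_max_left 2 ⌈ε⌉₊).trans (le_max_right N₁ (max 2 ⌈ε⌉₊)); omega
  have hN3 : ε ≤ N := Nat.ceil_le.mp (by
    have := (le_max_right 2 ⌈ε⌉₊).trans (le_max_right N₁ (max 2 ⌈ε⌉₊)); omega)
  obtain ⟨C, henc, hdec⟩ := exists_trivial_code (N := N) (by omega)
  have hN0 : (0 : ℝ) < N := by linarith
  rw [hk]
  refine ⟨C, fun ρ hρ hρ' => by linarith, fun i _ hi => ?_, henc.mono (hN₁ N hN1), hdec.mono ?_⟩
  · have : (0 : ℝ) ≤ i := Nat.cast_nonneg i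
    nlinarith
  · have hlog : 1 ≤ Real.logb 2 N := by
      rw [Real.le_logb_iff_rpow_le (by norm_num) hN0, Real.rpow_one]
      exact_mod_cast hN2
    have hNε : 1 ≤ N * (1 / ε) := by
      rw [mul_one_div, le_div_iff₀ h0]; linarith
    rw [pow_one, pow_one]
    push_cast
    nlinarith

end

theorem theorem3 :
    ∃ (encoder decoder : RAM.Prog) (a b c d : ℕ),
      ∀ ε : ℝ, 0 < ε → ∃ N₀ : ℕ, ∀ N : ℕ, N₀ < N →
        ∃ C : StrongStuckAtCode N,
          C.IsGapped ε ∧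
          (∀ i ∈ Finset.Icc 1 N, (i : ℝ) < (1 - ε) * N →
            C.messages i = bitStrings (N - N / ⌈1 / ε⌉₊ - i)) ∧
          C.EncodesWithin encoder ⌈1 / ε⌉₊ ((N : ℝ) ^ ((a : ℝ) / ε)) ∧
          C.DecodesWithin decoder ⌈1 / ε⌉₊
            ((b : ℝ) * (N * Real.logb 2 N ^ c * (1 / ε) ^ d)) := by
  refine ⟨RAM.encoder, RAM.decoder, 1000, 8000000, 1, 1, fun ε h0 => ?_⟩
  rcases lt_or_ge ε 1 with h1 | h1
  · have hk : 2 ≤ ⌈1 / ε⌉₊ := Nat.succ_le_iff.mpr (Nat.lt_ceil.mpr (by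
      rw [Nat.cast_one]; exact (one_lt_div h0).mpr h1))
    obtain ⟨N₀, hN₀⟩ := RAM.exists_large hk
    exact ⟨N₀, fun N hN => exists_gapped_code_of_lt_one h0 h1 (hN₀ N hN)⟩
  · exact exists_gapped_code_of_one_le h1
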